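/- Let $P$ be a set of $n$ points in the plane and let $\pi$ be a permutation of $P$; the priority of $p\in P$ is its rank $1,\dots,n$ in $\pi$. Points are ordered by $x$-coordinate, ties being broken by $y$-coordinate. Add to $P$ the dummy points $p_{-\infty}=(-\infty,-\infty)$ and $p_{\infty}=(\infty,-\infty)$, of priorities $-1$ and $0$. *The tree.* For a set $Q$ of at least two points that are consecutive in the order of the augmented set, with leftmost point $\mathrm{left}(Q)$ and rightmost point $\mathrm{right}(Q)$, define a binary tree $\mathcal{PT}^+(Q)$ recursively. If $|Q|=2$, it is empty. Otherwise let $\mathrm{mid}(Q)$ be the point of least priority in $Q\setminus\{\mathrm{left}(Q),\mathrm{right}(Q)\}$, and let $Q_L$ and $Q_R$ be the sets of points of $Q$ up to, respectively from, $\mathrm{mid}(Q)$ (inclusive). The root of $\mathcal{PT}^+(Q)$ represents a pseudo-triangle $\tau$ with endpoints $\mathrm{left}(Q)$, $\mathrm{right}(Q)$ and apex $\mathrm{mid}(Q)$, and its subtrees are $\mathcal{PT}^+(Q_L)$ and $\mathcal{PT}^+(Q_R)$. If the apex lies on the upper hull of $Q$, then the funnel of $\tau$ consists of the apex only, and there is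 no bridge. Otherwise $\mathrm{bridge}(\tau)$ is the segment $pq$, $p\in Q_L$, $q\in Q_R$, of the upper common tangent of $Q_L$ and $Q_R$ between the points of tangency; the left chain $\mathcal L(\tau)$ is the part of the upper hull of $Q_L$ from $p$ to the apex, and the right chain $\mathcal R(\tau)$ is the part of the upper hull of $Q_R$ from the apex to $q$. (Points of $Q$ on an edge of its upper hull count as hull vertices, and a bridge contains no points of $Q$ in its relative interior.) *The chords.* The funnel of $\tau$, the region bounded by its bridge (its base) and its two chains, is triangulated recursively: let $q$ be the vertex of least priority other than the apex and the two ends of the base (if there is none, stop). Join $q$ by a chord to the vertex $\nu(q)$, on the chain not containing $q$, that is the farthest along this chain from the apex among those visible from $q$, i.e. such that the segment meets the boundary of the funnel only in its endpoints. Treat in the same way the two parts: the part above the chord, with the same base and with apex $q$, and the part below the chord, with base $q\nu(q)$ and the same apex. *The augmented structure.* Each node of $\mathcal{PT}^+(P)$ stores the apex, the two endpoints and the bridge of its pseudo-triangle $\tau$, the vertices of $\mathcal L(\tau)$ and of $\mathcal R(\tau)$, each in left-to-right order, and the chords of the triangulation of its funnel in the order in which they meet the vertical line through the apex; in addition the vertices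 of the upper hull of $P$ are stored from left to right. Each of these sorted lists is kept in a height-balanced (AVL) binary tree. Then, for every $P$ and every $\pi$, the augmented structure $\mathcal{PT}^+(P)$ uses $O(n)$ words of memory, and there is one algorithm (a real-RAM program with unit-cost operations on reals and on words of $O(\log n)$ bits) that constructs it, for every $n$, $P$ and $\pi$, from the coordinates and the priorities of the points, in $O(n\log n)$ time (that is, in at most $C(n\log_2 n+1)$ steps with an absolute constant $C$). -/

import Mathlib

/-! ### A real RAM with a step count -/

namespace RealRAM

/-- A configuration: registers for words (natural numbers) and for reals, and a memory for words and
for reals. Memory is divided into segments; `mem k a` is the cell with address `a` of segment `k`.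
The segment is fixed in the program text, the address is computed at run time. -/
structure State where
  reg : ℕ → ℕ
  rreg : ℕ → ℝ
  mem : ℕ → ℕ → ℕ
  rmem : ℕ → ℕ → ℝ

/-- The elementary instructions. In each of them the first register named is the target, except
that `store k a r` and `rstore k a x` write register `r`, resp. `x`, to the address held in
register `a`. -/
inductive Instr
  | const (r c : ℕ)
  | move (r s : ℕ)
  | add (r s t : ℕ)
  | sub (r s t : ℕ)
  | half (r s : ℕ)
  | load (r k a : ℕ)
  | store (k a r : ℕ)
  | rload (x k a : ℕ)
  | rstore (k a x : ℕ)
  | radd (x y z : ℕ)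
  | rsub (x y z : ℕ)
  | rmul (x y z : ℕ)

/-- Set a word register. -/
def State.setReg (σ : State) (r v : ℕ) : State :=
  { σ with reg := Function.update σ.reg r v }

/-- Set a real register. -/
noncomputable def State.setRReg (σ : State) (x : ℕ) (v : ℝ) : State :=
  { σ with rreg := Function.update σ.rreg x v }

/-- Execute one instruction on a machine whose words are the numbers below `W`; an instruction
whose result does not fit into a word has no effect defined. -/
noncomputable def Instr.step (W : ℕ) : Instr → State → Option State
  | .const r c, σ => if c < W then some (σ.setReg r c) else none
  | .move r s, σ => some (σ.setReg r (σ.reg s))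
  | .add r s t, σ =>
      if σ.reg s + σ.reg t < W then some (σ.setReg r (σ.reg s + σ.reg t)) else none
  | .sub r s t, σ => some (σ.setReg r (σ.reg s - σ.reg t))
  | .half r s, σ => some (σ.setReg r (σ.reg s / 2))
  | .load r k a, σ => some (σ.setReg r (σ.mem k (σ.reg a)))
  | .store k a r, σ =>
      some { σ with mem :=
        Function.update σ.mem k (Function.update (σ.mem k) (σ.reg a) (σ.reg r)) }
  | .rload x k a, σ => some (σ.setRReg x (σ.rmem k (σ.reg a)))
  | .rstore k a x, σ =>
      some { σ with rmem :=
        Function.update σ.rmem k (Function.update (σ.rmem k) (σ.reg a) (σ.rreg x)) }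
  | .radd x y z, σ => some (σ.setRReg x (σ.rreg y + σ.rreg z))
  | .rsub x y z, σ => some (σ.setRReg x (σ.rreg y - σ.rreg z))
  | .rmul x y z, σ => some (σ.setRReg x (σ.rreg y * σ.rreg z))

/-- The tests: comparison of two word registers, or of two real registers. -/
inductive Test
  | lt (r s : ℕ)
  | eq (r s : ℕ)
  | rlt (x y : ℕ)

/-- The truth value of a test. -/
def Test.Holds : Test → State → Prop
  | .lt r s, σ => σ.reg r < σ.reg s
  | .eq r s, σ => σ.reg r = σ.reg s
  | .rlt x y, σ => σ.rreg x < σ.rreg y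

/-- Programs: instructions combined by sequencing, branching and (while-)loops. -/
inductive Prog
  | skip
  | instr (i : Instr)
  | seq (p q : Prog)
  | branch (t : Test) (p q : Prog)
  | loop (t : Test) (p : Prog)

/-- `Exec W p σ T σ'`: on a machine with words below `W`, program `p` started in `σ` halts in `σ'`
after exactly `T` steps. Every instruction and every evaluation of a test is one step. -/
inductive Exec (W : ℕ) : Prog → State → ℕ → State → Prop
  | skip (σ : State) : Exec W .skip σ 1 σ
  | instr {i : Instr} {σ σ' : State} : i.step W σ = some σ' → Exec W (.instr i) σ 1 σ'
  | seq {p q : Prog} {σ σ' σ'' : State} {a b : ℕ} :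
      Exec W p σ a σ' → Exec W q σ' b σ'' → Exec W (.seq p q) σ (a + b) σ''
  | branch_true {t : Test} {p q : Prog} {σ σ' : State} {a : ℕ} :
      t.Holds σ → Exec W p σ a σ' → Exec W (.branch t p q) σ (a + 1) σ'
  | branch_false {t : Test} {p q : Prog} {σ σ' : State} {a : ℕ} :
      ¬ t.Holds σ → Exec W q σ a σ' → Exec W (.branch t p q) σ (a + 1) σ'
  | loop_true {t : Test} {p : Prog} {σ σ' σ'' : State} {a b : ℕ} :
      t.Holds σ → Exec W p σ a σ' → Exec W (.loop t p) σ' b σ'' →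
      Exec W (.loop t p) σ (a + b + 1) σ''
  | loop_false {t : Test} {p : Prog} {σ : State} :
      ¬ t.Holds σ → Exec W (.loop t p) σ 1 σ

end RealRAM

/-! ### The pseudo-triangulation of the region between the chain of the points and the upper hull -/

namespace PseudoTri

/-- The points `0, …, n - 1` of the input, together with the two dummy points
`(-∞, -∞)` and `(∞, -∞)`. -/
inductive APt (n : ℕ)
  | negInf : APt n
  | pt (i : Fin n) : APt n
  | posInf : APt n

/-- Twice the signed area of the triangle `abc`. If `a` is to the left of `b`, it is positive,
zero or negative according as `c` is above, on or below the line `ab`. -/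
def orient (a b c : ℝ × ℝ) : ℝ :=
  (b.1 - a.1) * (c.2 - a.2) - (b.2 - a.2) * (c.1 - a.1)

section

variable {n : ℕ} (P : Fin n → ℝ × ℝ)

/-- The `x`-order of the input points; points with equal `x`-coordinate are ordered by their
`y`-coordinate. -/
def LtX (i j : Fin n) : Prop :=
  (P i).1 < (P j).1 ∨ ((P i).1 = (P j).1 ∧ (P i).2 < (P j).2)

/-- The `x`-order of the augmented point set. -/
def ALtX : APt n → APt n → Prop
  | .negInf, .negInf => False
  | .negInf, _ => True
  | .pt i, .pt j => LtX P i j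
  | .pt _, .posInf => True
  | .pt _, .negInf => False
  | .posInf, _ => False

/-- `a` is the leftmost point of `Q`. -/
def IsLeft (Q : Set (APt n)) (a : APt n) : Prop :=
  a ∈ Q ∧ ∀ p ∈ Q, p ≠ a → ALtX P a p

/-- `b` is the rightmost point of `Q`. -/
def IsRight (Q : Set (APt n)) (b : APt n) : Prop :=
  b ∈ Q ∧ ∀ p ∈ Q, p ≠ b → ALtX P p b

/-- The priorities: the rank in the permutation for the input points, `-1` and `0` for the
dummies. -/
def priority (π : Equiv.Perm (Fin n)) : APt n → ℤ
  | .negInf => -1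
  | .posInf => 0
  | .pt i => ((π i : ℕ) : ℤ) + 1

/-- `m` is the point of least priority in `Q`, the extreme points `a` and `b` excluded. -/
def IsMid (π : Equiv.Perm (Fin n)) (Q : Set (APt n)) (a b : APt n) (m : Fin n) : Prop :=
  .pt m ∈ Q ∧ .pt m ≠ a ∧ .pt m ≠ b ∧
    ∀ p ∈ Q, p ≠ a → p ≠ b → priority π (.pt m) ≤ priority π p

/-- The part of `Q` up to and including `m`. -/
def leftPart (Q : Set (APt n)) (m : Fin n) : Set (APt n) :=
  {p ∈ Q | p = .pt m ∨ ALtX P p (.pt m)}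

/-- The part of `Q` from `m` on. -/
def rightPart (Q : Set (APt n)) (m : Fin n) : Set (APt n) :=
  {p ∈ Q | p = .pt m ∨ ALtX P (.pt m) p}

/-- The points of `Q` on its upper hull: those not strictly below a segment that joins a point of
`Q` to their left with a point of `Q` to their right. A segment that ends in a dummy is a vertical
ray hanging from its other end, with no point of `Q` below it. -/
def upperHull (Q : Set (APt n)) : Set (APt n) :=
  {r ∈ Q | ∀ a b c : Fin n, r = .pt b → .pt a ∈ Q → .pt c ∈ Q → LtX P a b → LtX P b c →
    0 ≤ orient (P a) (P c) (P b)}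

/-- `pq` is the upper common tangent, cut off at the points of tangency, of the upper hulls of
`QL` and `QR` (in case of collinearities, cut off as short as possible). -/
def IsUpperTangent (QL QR : Set (APt n)) (p q : Fin n) : Prop :=
  .pt p ∈ QL ∧ .pt q ∈ QR ∧ LtX P p q ∧
    (∀ r : Fin n, .pt r ∈ QL ∪ QR → orient (P p) (P q) (P r) ≤ 0) ∧
    (∀ r : Fin n, .pt r ∈ QL ∪ QR → LtX P p r → LtX P r q → orient (P p) (P q) (P r) < 0)

/-- `l` lists the members of `S` from left to right. -/
def Enumerates (l : List (Fin n)) (S : Set (APt n)) : Prop :=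
  l.Pairwise (LtX P) ∧ ∀ r : Fin n, r ∈ l ↔ .pt r ∈ S

/-! A funnel, and each sub-pseudo-triangle of it, is given by the vertices of its left chain, from
the left end of the base to the apex, and of its right chain, from the apex to the right end of the
base. -/

/-- The polygonal chain with the given vertices, as a set of points. -/
def chainSet (l : List (Fin n)) : Set (ℝ × ℝ) :=
  {z | ∃ a b : Fin n, [a, b] <:+: l ∧ z ∈ segment ℝ (P a) (P b)}

/-- The boundary: both chains and the base. -/
def boundary (L R : List (Fin n)) : Set (ℝ × ℝ) :=
  chainSet P L ∪ chainSet P R ∪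
    {z | ∃ a ∈ L.head?, ∃ b ∈ R.getLast?, z ∈ segment ℝ (P a) (P b)}

/-- The segment `pq` meets the boundary at most in its endpoints. -/
def Visible (L R : List (Fin n)) (p q : Fin n) : Prop :=
  segment ℝ (P p) (P q) ∩ boundary P L R ⊆ {P p, P q}

/-- The vertices other than the ends of the base and the apex. -/
def nonCorners (L R : List (Fin n)) : List (Fin n) :=
  L.tail.dropLast ++ R.tail.dropLast

/-- `Chords P π L R T`: the recursive triangulation of the pseudo-triangle with chains `L` and `R`
consists of the chords `T`, each given by its left and its right endpoint. The non-corner vertex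
`q` of least priority is joined with the visible vertex on the other chain that is farthest from
the apex, and the two sub-pseudo-triangles above and below this chord are treated alike. -/
inductive Chords (π : Equiv.Perm (Fin n)) :
    List (Fin n) → List (Fin n) → Multiset (Fin n × Fin n) → Prop
  | done {L R : List (Fin n)} : nonCorners L R = [] → Chords π L R 0
  | left {A B C D : List (Fin n)} {q w : Fin n} {T₁ T₂ : Multiset (Fin n × Fin n)} :
      A ≠ [] → B ≠ [] →
      (∀ r ∈ nonCorners (A ++ q :: B) (C ++ w :: D), π q ≤ π r) →
      Visible P (A ++ q :: B) (C ++ w :: D) q w →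
      (∀ r ∈ D, ¬ Visible P (A ++ q :: B) (C ++ w :: D) q r) →
      Chords π (A ++ [q]) (q :: w :: D) T₁ →
      Chords π (q :: B) (C ++ [w]) T₂ →
      Chords π (A ++ q :: B) (C ++ w :: D) ((q, w) ::ₘ (T₁ + T₂))
  | right {A B C D : List (Fin n)} {q w : Fin n} {T₁ T₂ : Multiset (Fin n × Fin n)} :
      A ≠ [] → B ≠ [] →
      (∀ r ∈ nonCorners (C ++ w :: D) (A ++ q :: B), π q ≤ π r) →
      Visible P (C ++ w :: D) (A ++ q :: B) q w →
      (∀ r ∈ C, ¬ Visible P (C ++ w :: D) (A ++ q :: B) q r) →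
      Chords π (C ++ [w, q]) (q :: B) T₁ →
      Chords π (w :: D) (A ++ [q]) T₂ →
      Chords π (C ++ w :: D) (A ++ q :: B) ((w, q) ::ₘ (T₁ + T₂))

/-- `e` meets the vertical line through `m` nowhere above the point where `f` does. -/
def BelowAt (m : Fin n) (e f : Fin n × Fin n) : Prop :=
  ∀ y y' : ℝ, ((P m).1, y) ∈ segment ℝ (P e.1) (P e.2) →
    ((P m).1, y') ∈ segment ℝ (P f.1) (P f.2) → y ≤ y'

end

/-! ### The augmented tree -/

/-- The items of a tree, in symmetric order. -/
def inorder {α : Type} : BinaryTree α → List α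
  | .nil => []
  | .node v l r => inorder l ++ v :: inorder r

/-- Height-balanced (AVL) trees. -/
def Balanced {α : Type} : BinaryTree α → Prop
  | .nil => True
  | .node _ l r =>
      Balanced l ∧ Balanced r ∧ l.height ≤ r.height + 1 ∧ r.height ≤ l.height + 1

/-- The items stored at a node: the apex, the two endpoints, the bridge (if the funnel is not
empty), the vertices of the left and of the right chain, and the chords of the triangulation. -/
structure NodeData (n : ℕ) where
  apex : Fin n
  left : APt n
  right : APt n
  bridge : Option (Fin n × Fin n)
  chainL : BinaryTree (Fin n)
  chainR : BinaryTree (Fin n)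
  chords : BinaryTree (Fin n × Fin n)

/-- The pseudo-triangulation tree with its auxiliary data and the upper hull of all points. -/
structure AugTree (n : ℕ) where
  tree : BinaryTree (NodeData n)
  hull : BinaryTree (Fin n)

/-- The chains and the bridge stored in `d` are those of the pseudo-triangle of `Q`. If the apex is
on the upper hull of `Q`, there is no bridge, and the funnel consists of the apex alone. -/
def FunnelSpec {n : ℕ} (P : Fin n → ℝ × ℝ) (Q : Set (APt n)) (d : NodeData n) : Prop :=
  (APt.pt d.apex ∈ upperHull P Q ∧ d.bridge = none ∧
    inorder d.chainL = [d.apex] ∧ inorder d.chainR = [d.apex]) ∨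
  (APt.pt d.apex ∉ upperHull P Q ∧ ∃ p q : Fin n, d.bridge = some (p, q) ∧
    IsUpperTangent P (leftPart P Q d.apex) (rightPart P Q d.apex) p q ∧
    Enumerates P (inorder d.chainL)
      {r ∈ upperHull P (leftPart P Q d.apex) | r = .pt p ∨ ALtX P (.pt p) r} ∧
    Enumerates P (inorder d.chainR)
      {r ∈ upperHull P (rightPart P Q d.apex) | r = .pt q ∨ ALtX P r (.pt q)})

/-- `d` holds the data of the pseudo-triangle of `Q`, with all lists in balanced trees and the
chords in their vertical order above the apex. -/
def NodeSpec {n : ℕ} (P : Fin n → ℝ × ℝ) (π : Equiv.Perm (Fin n)) (Q : Set (APt n))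
    (d : NodeData n) : Prop :=
  IsLeft P Q d.left ∧ IsRight P Q d.right ∧ IsMid π Q d.left d.right d.apex ∧
  FunnelSpec P Q d ∧
  Chords P π (inorder d.chainL) (inorder d.chainR) (inorder d.chords : Multiset (Fin n × Fin n)) ∧
  (inorder d.chords).Pairwise (BelowAt P d.apex) ∧
  Balanced d.chainL ∧ Balanced d.chainR ∧ Balanced d.chords

/-- `t` represents the recursive pseudo-triangulation for the set `Q` of consecutive points. -/
inductive IsPTTree {n : ℕ} (P : Fin n → ℝ × ℝ) (π : Equiv.Perm (Fin n)) :
    Set (APt n) → BinaryTree (NodeData n) → Prop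
  | nil {Q : Set (APt n)} {a b : APt n} : a ≠ b → Q = {a, b} → IsPTTree P π Q .nil
  | node {Q : Set (APt n)} {d : NodeData n} {l r : BinaryTree (NodeData n)} :
      NodeSpec P π Q d →
      IsPTTree P π (leftPart P Q d.apex) l →
      IsPTTree P π (rightPart P Q d.apex) r →
      IsPTTree P π Q (.node d l r)

/-- `S` is the augmented pseudo-triangulation tree of the points `P` with priorities `π`. -/
def IsAugTree {n : ℕ} (P : Fin n → ℝ × ℝ) (π : Equiv.Perm (Fin n)) (S : AugTree n) : Prop :=
  IsPTTree P π Set.univ S.tree ∧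
  Enumerates P (inorder S.hull) (upperHull P Set.univ) ∧ Balanced S.hull

/-! ### Storage

A structure is stored in records. A record at address `a ≠ 0` consists of the cells `mem k a` for
`k = 0, 1, …`; address `0` is the null pointer. The records of vertex lists, chord lists and of the
pseudo-triangulation tree have 4, 5 and 10 cells. -/

/-- The number of words in the pseudo-triangulation tree, with all the lists at its nodes. -/
def treeWords {n : ℕ} : BinaryTree (NodeData n) → ℕ
  | .nil => 0
  | .node d l r =>
      10 + 4 * d.chainL.numNodes + 4 * d.chainR.numNodes + 5 * d.chords.numNodes +
        treeWords l + treeWords r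

/-- The number of words in the whole structure. -/
def AugTree.words {n : ℕ} (S : AugTree n) : ℕ :=
  treeWords S.tree + 4 * S.hull.numNodes

open RealRAM

/-- The list tree `t` is stored at address `a`, in the records with the addresses `A`: cells 0 and 1
hold the children, cell 2 the height, and the cells from 3 on hold the item, as stated by `item`. -/
def StoresList {α : Type} (σ : State) (item : α → ℕ → Prop) :
    BinaryTree α → ℕ → List ℕ → Prop
  | .nil, a, A => a = 0 ∧ A = []
  | .node v l r, a, A =>
      a ≠ 0 ∧ item v a ∧ σ.mem 2 a = (BinaryTree.node v l r).height ∧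
        ∃ Al Ar : List ℕ, StoresList σ item l (σ.mem 0 a) Al ∧
          StoresList σ item r (σ.mem 1 a) Ar ∧ A = a :: (Al ++ Ar)

/-- A list tree of points. -/
def StoresPts {n : ℕ} (σ : State) : BinaryTree (Fin n) → ℕ → List ℕ → Prop :=
  StoresList σ fun v a => σ.mem 3 a = v

/-- A list tree of chords. -/
def StoresChords {n : ℕ} (σ : State) : BinaryTree (Fin n × Fin n) → ℕ → List ℕ → Prop :=
  StoresList σ fun e a => σ.mem 3 a = e.1 ∧ σ.mem 4 a = e.2

/-- The numbers that name the input points and the two dummies. -/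
def APt.code {n : ℕ} : APt n → ℕ
  | .pt i => i
  | .negInf => n
  | .posInf => n + 1

/-- The pair of numbers that names a bridge. -/
def bridgeCode {n : ℕ} : Option (Fin n × Fin n) → ℕ × ℕ
  | some (p, q) => (p, q)
  | none => (n + 2, n + 2)

/-- The pseudo-triangulation tree `t`, with all the lists at its nodes, is stored at address `a`, in
the records with the addresses `A`. -/
def StoresTree {n : ℕ} (σ : State) : BinaryTree (NodeData n) → ℕ → List ℕ → Prop
  | .nil, a, A => a = 0 ∧ A = []
  | .node d l r, a, A =>
      a ≠ 0 ∧ σ.mem 2 a = d.apex ∧ σ.mem 3 a = d.left.code ∧ σ.mem 4 a = d.right.code ∧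
        σ.mem 5 a = (bridgeCode d.bridge).1 ∧ σ.mem 6 a = (bridgeCode d.bridge).2 ∧
        ∃ A₁ A₂ A₃ Al Ar : List ℕ,
          StoresPts σ d.chainL (σ.mem 7 a) A₁ ∧ StoresPts σ d.chainR (σ.mem 8 a) A₂ ∧
          StoresChords σ d.chords (σ.mem 9 a) A₃ ∧
          StoresTree σ l (σ.mem 0 a) Al ∧ StoresTree σ r (σ.mem 1 a) Ar ∧
          A = a :: (A₁ ++ A₂ ++ A₃ ++ Al ++ Ar)

/-- The coordinates and the priorities of the points are in memory. -/
def HoldsPoints {n : ℕ} (P : Fin n → ℝ × ℝ) (π : Equiv.Perm (Fin n)) (σ : State) : Prop :=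
  ∀ i : Fin n, σ.rmem 0 i = (P i).1 ∧ σ.rmem 1 i = (P i).2 ∧ σ.mem 10 i = (π i : ℕ) + 1

/-- The initial configuration: register 0 holds `n`, memory holds the points and their priorities,
and everything else is zero. -/
noncomputable def input {n : ℕ} (P : Fin n → ℝ × ℝ) (π : Equiv.Perm (Fin n)) : State where
  reg r := if r = 0 then n else 0
  rreg _ := 0
  mem k a := if h : k = 10 ∧ a < n then (π ⟨a, h.2⟩ : ℕ) + 1 else 0
  rmem k a := if h : a < n then
      (if k = 0 then (P ⟨a, h⟩).1 else if k = 1 then (P ⟨a, h⟩).2 else 0)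
    else 0

/-- The whole structure is in memory: registers 0 and 1 point to the tree and to the upper hull, no
two records share an address, and the points are still there. -/
def Stores {n : ℕ} (P : Fin n → ℝ × ℝ) (π : Equiv.Perm (Fin n)) (σ : State) (S : AugTree n) :
    Prop :=
  HoldsPoints P π σ ∧ ∃ A B : List ℕ,
    StoresTree σ S.tree (σ.reg 0) A ∧ StoresPts σ S.hull (σ.reg 1) B ∧ (A ++ B).Nodup

end PseudoTri

/-! The tree is built bottom-up, by treating the points from the highest rank to the lowest. At each
moment the points not yet treated, together with the dummies, are separators, and two consecutive
separators bound a gap. Treating the point `m` of highest remaining rank removes it from the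
separators and fuses the two gaps beside it. All other points inside the fused gap were treated
before, so `m` has the least priority there: it is the apex of the pseudo-triangle of the fused gap,
and the trees of the two old gaps are its subtrees (`Sweep.step`).

The upper hulls of all gaps are kept in one doubly linked list. If `m` is on or above the segment
between its two neighbours in this list, it stays on the hull and the funnel is a single point
(`HullPair.apex_onHull`). Otherwise a chord is placed on the two neighbours and one of its ends is
moved outwards as long as the next hull vertex is above it; where it stops is the bridge
(`HullPair.bridge`). The same movement yields the triangulation, provided that the end of smaller
priority stays whenever both ends could move. Indeed, the non-corner vertex `q` of least priority
then keeps its end of the chord until the other end has reached the point of tangency seen from `q`,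
which is the farthest visible vertex on the other chain. The chord at this moment is the first chord
of the recursive definition, and the positions before and after it are runs of the same kind in the
funnels below and above it (`Stair.split`, `Funnel.split`, `Funnel.chords`). The positions also
appear from bottom to top (`Stair.pairwise`), as the stored order requires.

The cost is amortized. The apex and the inner vertices of both chains leave the hull list for good,
and the numbers of chords and of chain vertices are bounded by twice the number of points that
leave, plus a constant (`NodeStep.len`). Turning a list of `k` items into a balanced tree takes time
`O(k log k)`, so the length of the hull list is a potential for the whole sweep (`runs_nodeProg`).
The initial left-to-right order comes from a tournament tree. The memory bound holds for every
correct structure, not only for the one constructed: a funnel has no more chords than chain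
vertices, and chain vertices are paid for by the decrease of the total hull size
(`NodeSpec.size_le`, `IsPTTree.words_le`).

Equal `x`-coordinates are removed from the geometry by a small shear, which preserves orientation
and visibility (`exists_shear`). Loop-free code is verified by symbolic execution; loops are
verified by invariants that contain the remaining number of steps (`Runs.loop`). -/

/-! ### Symbolic execution, cost bounds and frame conditions -/

namespace RealRAM

/-- Write a word to memory. -/
def State.setMem (σ : State) (k a v : ℕ) : State :=
  { σ with mem := Function.update σ.mem k (Function.update (σ.mem k) a v) }

/-- Write a real to memory. -/
noncomputable def State.setRMem (σ : State) (k a : ℕ) (v : ℝ) : State :=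
  { σ with rmem := Function.update σ.rmem k (Function.update (σ.rmem k) a v) }

section simp_lemmas

variable (σ : State) (r v k a : ℕ) (x : ℝ)

@[simp] theorem State.setReg_reg (s : ℕ) :
    (σ.setReg r v).reg s = if s = r then v else σ.reg s := by
  simp [State.setReg, Function.update_apply]
@[simp] theorem State.setReg_mem : (σ.setReg r v).mem = σ.mem := rfl
@[simp] theorem State.setReg_rreg : (σ.setReg r v).rreg = σ.rreg := rfl
@[simp] theorem State.setReg_rmem : (σ.setReg r v).rmem = σ.rmem := rfl
@[simp] theorem State.setRReg_reg : (σ.setRReg r x).reg = σ.reg := rfl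
@[simp] theorem State.setRReg_mem : (σ.setRReg r x).mem = σ.mem := rfl
@[simp] theorem State.setRReg_rreg (s : ℕ) :
    (σ.setRReg r x).rreg s = if s = r then x else σ.rreg s := by
  simp [State.setRReg, Function.update_apply]
@[simp] theorem State.setRReg_rmem : (σ.setRReg r x).rmem = σ.rmem := rfl
@[simp] theorem State.setMem_reg : (σ.setMem k a v).reg = σ.reg := rfl
@[simp] theorem State.setMem_mem (k' a' : ℕ) :
    (σ.setMem k a v).mem k' a' = if k' = k ∧ a' = a then v else σ.mem k' a' := by
  by_cases h : k' = k
  · subst h; simp [State.setMem, Function.update_apply]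
  · simp [State.setMem, h]
@[simp] theorem State.setMem_rreg : (σ.setMem k a v).rreg = σ.rreg := rfl
@[simp] theorem State.setMem_rmem : (σ.setMem k a v).rmem = σ.rmem := rfl

end simp_lemmas

/-- The effect of an instruction, word overflow disregarded. -/
noncomputable def Instr.eff : Instr → State → State
  | .const r c, σ => σ.setReg r c
  | .move r s, σ => σ.setReg r (σ.reg s)
  | .add r s t, σ => σ.setReg r (σ.reg s + σ.reg t)
  | .sub r s t, σ => σ.setReg r (σ.reg s - σ.reg t)
  | .half r s, σ => σ.setReg r (σ.reg s / 2)
  | .load r k a, σ => σ.setReg r (σ.mem k (σ.reg a))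
  | .store k a r, σ => σ.setMem k (σ.reg a) (σ.reg r)
  | .rload x k a, σ => σ.setRReg x (σ.rmem k (σ.reg a))
  | .rstore k a x, σ => σ.setRMem k (σ.reg a) (σ.rreg x)
  | .radd x y z, σ => σ.setRReg x (σ.rreg y + σ.rreg z)
  | .rsub x y z, σ => σ.setRReg x (σ.rreg y - σ.rreg z)
  | .rmul x y z, σ => σ.setRReg x (σ.rreg y * σ.rreg z)

/-- The result of the instruction fits into a word. -/
def Instr.Safe (W : ℕ) : Instr → State → Prop
  | .const _ c, _ => c < W
  | .add _ s t, σ => σ.reg s + σ.reg t < W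
  | _, _ => True

theorem Instr.step_eq {W : ℕ} {i : Instr} {σ : State} (h : i.Safe W σ) :
    i.step W σ = some (i.eff σ) := by
  cases i <;> simp_all [Instr.Safe, Instr.step, Instr.eff] <;> rfl

open Classical in
/-- The effect of a program without loops, word overflow disregarded. -/
noncomputable def Prog.eff : Prog → State → State
  | .skip, σ => σ
  | .instr i, σ => i.eff σ
  | .seq p q, σ => q.eff (p.eff σ)
  | .branch t p q, σ => if t.Holds σ then p.eff σ else q.eff σ
  | .loop _ _, σ => σ

/-- The program runs through no loop, and all its results fit into words. -/
def Prog.Safe (W : ℕ) : Prog → State → Prop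
  | .skip, _ => True
  | .instr i, σ => i.Safe W σ
  | .seq p q, σ => p.Safe W σ ∧ q.Safe W (p.eff σ)
  | .branch t p q, σ => (t.Holds σ → p.Safe W σ) ∧ (¬ t.Holds σ → q.Safe W σ)
  | .loop _ _, _ => False

/-- A bound for the number of steps of a program without loops. -/
def Prog.cost : Prog → ℕ
  | .skip => 1
  | .instr _ => 1
  | .seq p q => p.cost + q.cost
  | .branch _ p q => max p.cost q.cost + 1
  | .loop _ _ => 0

/-- Reduces loop-free code to computation: the final state is the term `p.eff σ`, which `simp`
evaluates, and the time bound `p.cost` is a numeral. -/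
theorem Prog.Safe.exec {W : ℕ} {p : Prog} : ∀ {σ : State}, p.Safe W σ →
    ∃ T ≤ p.cost, Exec W p σ T (p.eff σ) := by
  induction p with
  | skip => exact fun _ => ⟨1, le_rfl, .skip _⟩
  | instr i => exact fun h => ⟨1, le_rfl, .instr (Instr.step_eq h)⟩
  | seq p q ihp ihq =>
    rintro σ ⟨h1, h2⟩
    obtain ⟨a, ha, ea⟩ := ihp h1
    obtain ⟨b, hb, eb⟩ := ihq h2
    exact ⟨a + b, add_le_add ha hb, .seq ea eb⟩
  | branch t p q ihp ihq =>
    rintro σ ⟨h1, h2⟩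
    by_cases h : t.Holds σ
    · obtain ⟨a, ha, ea⟩ := ihp (h1 h)
      exact ⟨a + 1, by simp only [Prog.cost]; omega,
        by simp only [Prog.eff, h, if_true]; exact .branch_true h ea⟩
    · obtain ⟨a, ha, ea⟩ := ihq (h2 h)
      exact ⟨a + 1, by simp only [Prog.cost]; omega,
        by simp only [Prog.eff, h, if_false]; exact .branch_false h ea⟩
  | loop t p _ => exact fun h => h.elim

/-- Word register that an instruction writes. -/
def Instr.wReg : Instr → ℕ → Bool
  | .const r _, s => s == r
  | .move r _, s => s == r
  | .add r _ _, s => s == r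
  | .sub r _ _, s => s == r
  | .half r _, s => s == r
  | .load r _ _, s => s == r
  | _, _ => false

/-- Memory segment that an instruction writes. -/
def Instr.wMem : Instr → ℕ → Bool
  | .store k _ _, s => s == k
  | _, _ => false

/-- Real register that an instruction writes. -/
def Instr.wRReg : Instr → ℕ → Bool
  | .rload x _ _, s => s == x
  | .radd x _ _, s => s == x
  | .rsub x _ _, s => s == x
  | .rmul x _ _, s => s == x
  | _, _ => false

/-- The instruction writes to the real memory. -/
def Instr.wRMem : Instr → Bool
  | .rstore _ _ _ => true
  | _ => false

/-- Some instruction of the program satisfies `f`. -/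
def Prog.anyInstr (f : Instr → Bool) : Prog → Bool
  | .skip => false
  | .instr i => f i
  | .seq p q => p.anyInstr f || q.anyInstr f
  | .branch _ p q => p.anyInstr f || q.anyInstr f
  | .loop _ p => p.anyInstr f

/-- `σ'` agrees with `σ` on everything that `p` does not write. -/
structure Frame (p : Prog) (σ σ' : State) : Prop where
  reg : ∀ r, p.anyInstr (·.wReg r) = false → σ'.reg r = σ.reg r
  mem : ∀ k, p.anyInstr (·.wMem k) = false → σ'.mem k = σ.mem k
  rreg : ∀ x, p.anyInstr (·.wRReg x) = false → σ'.rreg x = σ.rreg x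
  rmem : p.anyInstr (·.wRMem) = false → σ'.rmem = σ.rmem

theorem Frame.refl (p : Prog) (σ : State) : Frame p σ σ :=
  ⟨fun _ _ => rfl, fun _ _ => rfl, fun _ _ => rfl, fun _ => rfl⟩

theorem Frame.trans {p : Prog} {σ₁ σ₂ σ₃ : State} (h : Frame p σ₁ σ₂) (h' : Frame p σ₂ σ₃) :
    Frame p σ₁ σ₃ :=
  ⟨fun r hr => (h'.reg r hr).trans (h.reg r hr), fun r hr => (h'.mem r hr).trans (h.mem r hr),
    fun r hr => (h'.rreg r hr).trans (h.rreg r hr), fun hr => (h'.rmem hr).trans (h.rmem hr)⟩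

theorem Frame.mono {p q : Prog} {σ σ' : State} (h : Frame p σ σ')
    (hpq : ∀ f, q.anyInstr f = false → p.anyInstr f = false) : Frame q σ σ' :=
  ⟨fun r hr => h.reg r (hpq _ hr), fun r hr => h.mem r (hpq _ hr),
    fun r hr => h.rreg r (hpq _ hr), fun hr => h.rmem (hpq _ hr)⟩

theorem Instr.eff_eq {W : ℕ} {i : Instr} {σ σ' : State} (h : i.step W σ = some σ') :
    σ' = i.eff σ := by
  by_cases hs : i.Safe W σ
  · rw [Instr.step_eq hs] at h
    exact (Option.some.inj h).symm
  · cases i <;> simp_all [Instr.Safe, Instr.step]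

theorem Instr.frame {W : ℕ} {i : Instr} {σ σ' : State} (h : i.step W σ = some σ') :
    Frame (.instr i) σ σ' := by
  rw [Instr.eff_eq h]
  constructor <;> intros <;> cases i <;>
    simp_all [Prog.anyInstr, Instr.wReg, Instr.wMem, Instr.wRReg, Instr.wRMem, Instr.eff,
      State.setMem, State.setRMem]

/-- Which registers and segments are written can be read off the program text, loops included. For a
concrete program the side conditions of `Frame` hold by `rfl`, so nothing untouched has to be
carried through an invariant. -/
theorem Exec.frame {W T : ℕ} {p : Prog} {σ σ' : State} (h : Exec W p σ T σ') : Frame p σ σ' := by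
  have hl : ∀ {a b : Bool}, (a || b) = false → a = false := fun h => (Bool.or_eq_false_iff.1 h).1
  have hr : ∀ {a b : Bool}, (a || b) = false → b = false := fun h => (Bool.or_eq_false_iff.1 h).2
  induction h with
  | skip σ => exact .refl _ _
  | instr h => exact Instr.frame h
  | seq _ _ h1 h2 => exact Frame.trans (h1.mono (q := .seq _ _) fun f hf => hl hf) (h2.mono fun f hf => hr hf)
  | branch_true _ _ h => exact h.mono (q := .branch _ _ _) fun f hf => hl hf
  | branch_false _ _ h => exact h.mono (q := .branch _ _ _) fun f hf => hr hf
  | loop_true _ _ _ h1 h2 =>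
    exact Frame.trans (h1.mono (q := .loop _ _) fun f hf => hf) h2
  | loop_false _ => exact .refl _ _

/-! ### Total correctness with time bounds -/

/-- Started in `σ`, the program halts within `t` steps in a state that satisfies `Q`. -/
def Runs (W : ℕ) (p : Prog) (σ : State) (t : ℕ) (Q : State → Prop) : Prop :=
  ∃ T ≤ t, ∃ σ', Exec W p σ T σ' ∧ Q σ'

theorem Runs.free {W t : ℕ} {p : Prog} {σ : State} {Q : State → Prop} (h : p.Safe W σ)
    (ht : p.cost ≤ t) (hQ : Q (p.eff σ)) : Runs W p σ t Q := by
  obtain ⟨T, hT, e⟩ := h.exec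
  exact ⟨T, hT.trans ht, _, e, hQ⟩

/-- The new postcondition may use the frame condition, which every execution provides for free. -/
theorem Runs.mono {W t t' : ℕ} {p : Prog} {σ : State} {Q Q' : State → Prop} (h : Runs W p σ t Q)
    (ht : t ≤ t') (hQ : ∀ σ', Frame p σ σ' → Q σ' → Q' σ') : Runs W p σ t' Q' := by
  obtain ⟨T, hT, σ', e, q⟩ := h
  exact ⟨T, hT.trans ht, σ', e, hQ _ e.frame q⟩

theorem Runs.seq {W a b t : ℕ} {p q : Prog} {σ : State} {R Q : State → Prop}
    (h : Runs W p σ a R) (h' : ∀ σ', Frame p σ σ' → R σ' → Runs W q σ' b Q)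
    (ht : a + b ≤ t) : Runs W (.seq p q) σ t Q := by
  obtain ⟨T, hT, σ', e, r⟩ := h
  obtain ⟨T', hT', σ'', e', q'⟩ := h' _ e.frame r
  exact ⟨T + T', by omega, σ'', .seq e e', q'⟩

theorem Runs.branch {W a t : ℕ} {p q : Prog} {c : Test} {σ : State} {Q : State → Prop}
    (h : c.Holds σ → Runs W p σ a Q) (h' : ¬ c.Holds σ → Runs W q σ a Q)
    (ht : a + 1 ≤ t) : Runs W (.branch c p q) σ t Q := by
  by_cases hc : c.Holds σ
  · obtain ⟨T, hT, σ', e, r⟩ := h hc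
    exact ⟨T + 1, by omega, σ', .branch_true hc e, r⟩
  · obtain ⟨T, hT, σ', e, r⟩ := h' hc
    exact ⟨T + 1, by omega, σ', .branch_false hc e, r⟩

/-- The rule for loops. The first argument of the invariant is a bound for the number of the steps
still to come. -/
theorem Runs.loop {W : ℕ} {p : Prog} {c : Test} (σ₀ : State) (I : ℕ → State → Prop)
    (hbody : ∀ b σ, I b σ → Frame p σ₀ σ → c.Holds σ →
      ∃ t, Runs W p σ t fun σ' => ∃ b', t + 1 + b' ≤ b ∧ I b' σ')
    {b : ℕ} (h0 : I b σ₀) :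
    Runs W (.loop c p) σ₀ (b + 1) fun σ' => (∃ b', I b' σ') ∧ Frame p σ₀ σ' ∧ ¬ c.Holds σ' := by
  suffices H : ∀ b σ, I b σ → Frame p σ₀ σ →
      Runs W (.loop c p) σ (b + 1) fun σ' => (∃ b', I b' σ') ∧ Frame p σ₀ σ' ∧ ¬ c.Holds σ' from
    H b σ₀ h0 (.refl _ _)
  intro b
  -- Every round pays at least one step for its test, so the budget `b` also serves as the
  -- termination measure.
  induction b using Nat.strong_induction_on with
  | _ b ih =>
    intro σ hI hF
    by_cases hc : c.Holds σ
    · obtain ⟨t, T, hT, σ', e, b', hb', hI'⟩ := hbody b σ hI hF hc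
      obtain ⟨T', hT', σ'', e', q⟩ := ih b' (by omega) σ' hI' (hF.trans e.frame)
      exact ⟨T + T' + 1, by omega, σ'', .loop_true hc e e', q⟩
    · exact ⟨1, by omega, σ, .loop_false hc, ⟨b, hI⟩, hF, hc⟩

/-- Straight-line code. -/
def blk : List Instr → Prog
  | [] => .skip
  | [i] => .instr i
  | i :: j :: l => .seq (.instr i) (blk (j :: l))

end RealRAM

/-! ### Balanced trees from arrays -/

namespace PseudoTri

/-- The balanced search tree with the items `f lo, …, f (hi - 1)`. -/
def midTree {α : Type} (f : ℕ → α) (lo hi : ℕ) : BinaryTree α :=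
  if lo < hi then
    .node (f ((lo + hi) / 2)) (midTree f lo ((lo + hi) / 2)) (midTree f ((lo + hi) / 2 + 1) hi)
  else .nil
termination_by hi - lo

/-- The interval of `midTree f lo hi` of which `i` is the middle. -/
def midNode (lo hi i : ℕ) : ℕ × ℕ :=
  if lo < hi then
    if (lo + hi) / 2 < i then midNode ((lo + hi) / 2 + 1) hi i
    else if i < (lo + hi) / 2 then midNode lo ((lo + hi) / 2) i
    else (lo, hi)
  else (lo, hi)
termination_by hi - lo

theorem size_half {s : ℕ} (h : 0 < s) : Nat.size s = Nat.size (s / 2) + 1 := by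
  refine eq_of_forall_ge_iff fun k => ?_
  rw [Nat.size_le]
  cases k with
  | zero => simp; omega
  | succ k => rw [Nat.succ_le_succ_iff, Nat.size_le, pow_succ]; omega

theorem size_le_log {s n : ℕ} (h : s ≤ n) : Nat.size s ≤ Nat.log 2 n + 1 :=
  Nat.size_le.2 (h.trans_lt (Nat.lt_pow_succ_log_self one_lt_two n))

/-- Of `s` items the left subtree gets `s / 2` and the right one `(s - 1) / 2`, so the left one
determines the height, and halving `s` lowers its bit length by one. The height thus depends on the
length of the interval only and can be computed by repeated halving. -/
theorem height_midTree {α : Type} (f : ℕ → α) (lo hi : ℕ) :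
    (midTree f lo hi).height = Nat.size (hi - lo) := by
  induction lo, hi using midTree.induct with
  | case1 lo hi h ih1 ih2 =>
    rw [midTree, if_pos h, BinaryTree.height, ih1, ih2, size_half (s := hi - lo) (by omega)]
    have : (lo + hi) / 2 - lo = (hi - lo) / 2 := by omega
    rw [this, max_eq_left (Nat.size_le_size (by omega))]
  | case2 lo hi h =>
    rw [midTree, if_neg h, Nat.sub_eq_zero_of_le (by omega)]
    simp

theorem balanced_midTree {α : Type} (f : ℕ → α) (lo hi : ℕ) : Balanced (midTree f lo hi) := by
  induction lo, hi using midTree.induct with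
  | case1 lo hi h ih1 ih2 =>
    rw [midTree, if_pos h]
    refine ⟨ih1, ih2, ?_, ?_⟩ <;> rw [height_midTree, height_midTree]
    -- With `r` items on the right there are at most `r + 1` on the left, and `r < 2 ^ size r` gives
    -- `r + 1 < 2 ^ (size r + 1)`.
    · rw [Nat.size_le, pow_succ]
      have := Nat.lt_size_self (hi - ((lo + hi) / 2 + 1))
      omega
    · exact (Nat.size_le_size (by omega)).trans (Nat.le_succ _)
  | case2 lo hi h => rw [midTree, if_neg h]; trivial

theorem inorder_midTree {α : Type} (f : ℕ → α) (lo hi : ℕ) :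
    inorder (midTree f lo hi) = (List.range' lo (hi - lo)).map f := by
  induction lo, hi using midTree.induct with
  | case1 lo hi h ih1 ih2 =>
    rw [midTree, if_pos h, inorder, ih1, ih2]
    have : hi - lo = ((lo + hi) / 2 - lo) + ((hi - ((lo + hi) / 2 + 1)) + 1) := by omega
    rw [this, ← List.range'_append_1, List.map_append, List.range'_succ, List.map_cons]
    have : lo + ((lo + hi) / 2 - lo) = (lo + hi) / 2 := by omega
    rw [this]
  | case2 lo hi h =>
    rw [midTree, if_neg h, Nat.sub_eq_zero_of_le (by omega)]
    rfl

/-- The address of the root of the tree for the interval, if item `i` is stored at `base + i`. -/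
def midPtr (base lo hi : ℕ) : ℕ := if lo < hi then base + (lo + hi) / 2 else 0

open RealRAM

/-- The record of item `i` of a balanced tree, as determined by its interval. -/
def MidRecord (σ : State) (base lo hi i : ℕ) : Prop :=
  σ.mem 0 (base + i) = midPtr base lo i ∧ σ.mem 1 (base + i) = midPtr base (i + 1) hi ∧
    σ.mem 2 (base + i) = Nat.size (hi - lo)

/-- Each record depends only on the interval of which its item is the middle. Hence the records can
be written one by one, without recursion or a stack, and the linked tree is recovered by induction
on the intervals. The address range in the conclusion gives the disjointness of the two subtrees. -/
theorem storesList_midTree {α : Type} (σ : State) (item : α → ℕ → Prop) (f : ℕ → α) (base : ℕ)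
    (hb : 0 < base) (lo hi : ℕ)
    (hr : ∀ i, lo ≤ i → i < hi →
      MidRecord σ base (midNode lo hi i).1 (midNode lo hi i).2 i ∧ item (f i) (base + i)) :
    ∃ A : List ℕ, StoresList σ item (midTree f lo hi) (midPtr base lo hi) A ∧ A.Nodup ∧
      ∀ x ∈ A, base + lo ≤ x ∧ x < base + hi := by
  induction lo, hi using midTree.induct with
  | case1 lo hi h ih1 ih2 =>
    obtain ⟨A, hA, nA, bA⟩ := ih1 fun i h1 h2 => by
      have := hr i h1 (by omega)
      rwa [midNode, if_pos h, if_neg (by omega), if_pos h2] at this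
    obtain ⟨B, hB, nB, bB⟩ := ih2 fun i h1 h2 => by
      have := hr i (by omega) (by omega)
      rwa [midNode, if_pos h, if_pos (by omega)] at this
    have hm := hr ((lo + hi) / 2) (by omega) (by omega)
    rw [midNode, if_pos h, if_neg (by omega), if_neg (by omega)] at hm
    obtain ⟨⟨h0, h1, h2⟩, h3⟩ := hm
    refine ⟨(base + (lo + hi) / 2) :: (A ++ B), ?_, ?_, ?_⟩
    · have h2' := height_midTree f lo hi
      rw [midTree, if_pos h] at h2' ⊢
      rw [midPtr, if_pos h]
      refine ⟨by omega, h3, h2.trans h2'.symm, A, B, ?_, ?_, rfl⟩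
      · rwa [h0]
      · rwa [h1]
    · refine List.nodup_cons.2 ⟨?_, List.Nodup.append nA nB ?_⟩
      · simp only [List.mem_append, not_or]
        exact ⟨fun hx => by have := bA _ hx; omega, fun hx => by have := bB _ hx; omega⟩
      · intro x hx hx'
        have := bA _ hx
        have := bB _ hx'
        omega
    · intro x hx
      simp only [List.mem_cons, List.mem_append] at hx
      rcases hx with rfl | hx | hx
      · omega
      · have := bA _ hx; omega
      · have := bB _ hx; omega
  | case2 lo hi h =>
    refine ⟨[], ?_, List.nodup_nil, by simp⟩
    rw [midTree, if_neg h, midPtr, if_neg h]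
    exact ⟨rfl, rfl⟩

end PseudoTri

/-! ### The program that builds a balanced tree -/

namespace PseudoTri

open RealRAM

/-- Registers with constants and the number of points: `n`, `n + 1`, `1`, `n + 2` and `0`. -/
structure Consts (n : ℕ) (σ : State) : Prop where
  r0 : σ.reg 0 = n
  r1 : σ.reg 1 = n + 1
  r2 : σ.reg 2 = 1
  r3 : σ.reg 3 = n + 2
  r4 : σ.reg 4 = 0

/-- One step of the search for the interval with the middle in register 30. -/
def descendStep : Prog :=
  .seq (.branch (.lt 33 30) (.instr (.add 31 33 2)) (.instr (.move 32 33)))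
    (blk [.add 33 31 32, .half 33 33, .sub 34 33 30, .sub 35 30 33, .add 34 34 35])

/-- One step of the computation of a height. -/
def heightStep : Prog := blk [.half 34 34, .add 35 35 2]

/-- Write the item and the links of the record of the item in register 30. -/
def recordLinks : Prog :=
  .seq (blk [.add 36 5 30, .load 34 18 30, .store 3 36 34, .load 34 19 30, .store 4 36 34])
  (.seq (.branch (.lt 31 33) (blk [.add 34 31 33, .half 34 34, .add 34 34 5])
    (.instr (.const 34 0)))
  (.seq (blk [.store 0 36 34, .add 35 33 2])
  (.seq (.branch (.lt 35 32) (blk [.add 34 35 32, .half 34 34, .add 34 34 5])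
    (.instr (.const 34 0)))
    (blk [.store 1 36 34, .sub 34 32 31, .const 35 0]))))

/-- Write the record of the item in register 30. -/
def recordItem : Prog :=
  .seq (blk [.const 31 0, .move 32 17, .half 33 17, .sub 34 33 30, .sub 35 30 33, .add 34 34 35])
  (.seq (.loop (.lt 4 34) descendStep)
  (.seq recordLinks
  (.seq (.loop (.lt 4 34) heightStep)
    (blk [.store 2 36 35, .add 30 30 2]))))

/-- Build a balanced tree of the first `k` items of the segments 18 and 19, `k` being in register
17, and put its root into register 24. The records are allocated from register 5 on. -/
def buildTree : Prog :=
  .seq (.instr (.const 30 0))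
  (.seq (.loop (.lt 30 17) recordItem)
  (.seq (.branch (.lt 4 17) (blk [.half 24 17, .add 24 24 5]) (.instr (.const 24 0)))
    (.instr (.add 5 5 17))))

/-- Binary search from the root interval. Register 34 holds the distance of the current middle from
`i`, the sum of two truncated differences, so that `0 < reg 34` expresses inequality. Each round
costs 8 steps and halves the interval, whence the bit length as potential. -/
theorem runs_descend {W k i : ℕ} (σ : State) (hW : 2 * k + 2 ≤ W) (hi : i < k)
    (h2 : σ.reg 2 = 1) (h4 : σ.reg 4 = 0) (h30 : σ.reg 30 = i) (h31 : σ.reg 31 = 0)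
    (h32 : σ.reg 32 = k) (h33 : σ.reg 33 = k / 2) (h34 : σ.reg 34 = (k / 2 - i) + (i - k / 2)) :
    Runs W (.loop (.lt 4 34) descendStep) σ (8 * Nat.size k + 1) fun σ' =>
      σ'.reg 33 = i ∧ σ'.reg 31 ≤ i ∧ i < σ'.reg 32 ∧ σ'.reg 32 ≤ k ∧
      midNode 0 k i = (σ'.reg 31, σ'.reg 32) := by
  refine (Runs.loop (σ₀ := σ) (fun b s => b = 8 * Nat.size (s.reg 32 - s.reg 31) ∧
    s.reg 33 = (s.reg 31 + s.reg 32) / 2 ∧ s.reg 34 = (s.reg 33 - i) + (i - s.reg 33) ∧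
    s.reg 31 ≤ i ∧ i < s.reg 32 ∧ s.reg 32 ≤ k ∧
    midNode 0 k i = midNode (s.reg 31) (s.reg 32) i) ?_ ?_).mono le_rfl ?_
  · rintro b s ⟨hb, e33, e34, hlo, hhi, hk, hn⟩ hF hc
    have e2 : s.reg 2 = 1 := (hF.reg 2 rfl).trans h2
    have e4 : s.reg 4 = 0 := (hF.reg 4 rfl).trans h4
    have e30 : s.reg 30 = i := (hF.reg 30 rfl).trans h30
    simp only [Test.Holds, e4] at hc
    rw [midNode.eq_def (s.reg 31), if_pos (by omega), ← e33] at hn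
    rw [size_half (by omega)] at hb
    refine ⟨7, Runs.free ?_ (by decide) ?_⟩
    · by_cases h : s.reg 33 < i <;>
        simp [descendStep, blk, Prog.Safe, Instr.Safe, Prog.eff, Instr.eff, Test.Holds, e2, e30, h] <;>
        omega
    · by_cases h : s.reg 33 < i
      · simp [descendStep, blk, Prog.eff, Instr.eff, Test.Holds, e2, e30, h]
        rw [if_pos h] at hn
        refine ⟨?_, hhi, hk, hn⟩
        have := Nat.size_le_size (show s.reg 32 - (s.reg 33 + 1) ≤ (s.reg 32 - s.reg 31) / 2 by omega)
        omega
      · simp [descendStep, blk, Prog.eff, Instr.eff, Test.Holds, e30, h]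
        rw [if_neg h, if_pos (by omega)] at hn
        refine ⟨?_, by omega, by omega, by omega, hn⟩
        have := Nat.size_le_size (show s.reg 33 - s.reg 31 ≤ (s.reg 32 - s.reg 31) / 2 by omega)
        omega
  · simp [*]
  · rintro s - ⟨⟨b, hb, e33, e34, hlo, hhi, hk, hn⟩, hF, hc⟩
    have e4 : s.reg 4 = 0 := (hF.reg 4 rfl).trans h4
    simp only [Test.Holds, e4] at hc
    rw [midNode.eq_def (s.reg 31), if_pos (by omega), ← e33, if_neg (by omega), if_neg (by omega)] at hn
    exact ⟨by omega, hlo, hhi, hk, hn⟩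

theorem runs_height {W s : ℕ} (σ : State) (hW : 2 * s + 2 ≤ W)
    (h2 : σ.reg 2 = 1) (h4 : σ.reg 4 = 0) (h34 : σ.reg 34 = s) (h35 : σ.reg 35 = 0) :
    Runs W (.loop (.lt 4 34) heightStep) σ (3 * Nat.size s + 1) fun σ' =>
      σ'.reg 35 = Nat.size s := by
  have hs : Nat.size s ≤ s := Nat.size_le.2 Nat.lt_two_pow_self
  refine (Runs.loop (σ₀ := σ) (fun b σ' => b = 3 * Nat.size (σ'.reg 34) ∧
    σ'.reg 35 + Nat.size (σ'.reg 34) = Nat.size s) ?_ ?_).mono le_rfl ?_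
  · rintro b σ' ⟨hb, e⟩ hF hc
    have e2 : σ'.reg 2 = 1 := (hF.reg 2 rfl).trans h2
    have e4 : σ'.reg 4 = 0 := (hF.reg 4 rfl).trans h4
    simp only [Test.Holds, e4] at hc
    rw [size_half hc] at hb e
    refine ⟨2, Runs.free ?_ (by decide) ?_⟩
    · simp [heightStep, blk, Prog.Safe, Instr.Safe, Prog.eff, Instr.eff, e2]; omega
    · simp [heightStep, blk, Prog.eff, Instr.eff, e2]; omega
  · simp [*]
  · rintro σ' - ⟨⟨b, hb, e⟩, hF, hc⟩
    have e4 : σ'.reg 4 = 0 := (hF.reg 4 rfl).trans h4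
    simp only [Test.Holds, e4] at hc
    have : σ'.reg 34 = 0 := by omega
    simpa [this] using e

theorem runs_recordLinks {W k i lo hi base : ℕ} (σ : State) (hW : base + 2 * k + 2 ≤ W)
    (hlo : lo ≤ i) (hhi : i < hi) (hk : hi ≤ k)
    (h2 : σ.reg 2 = 1) (h5 : σ.reg 5 = base) (h30 : σ.reg 30 = i)
    (h31 : σ.reg 31 = lo) (h32 : σ.reg 32 = hi) (h33 : σ.reg 33 = i) :
    Runs W recordLinks σ 18 fun σ' =>
      σ'.mem 0 (base + i) = midPtr base lo i ∧ σ'.mem 1 (base + i) = midPtr base (i + 1) hi ∧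
      σ'.mem 3 (base + i) = σ.mem 18 i ∧ σ'.mem 4 (base + i) = σ.mem 19 i ∧
      σ'.reg 36 = base + i ∧ σ'.reg 34 = hi - lo ∧ σ'.reg 35 = 0 ∧
      ∀ j x, x ≠ base + i → σ'.mem j x = σ.mem j x := by
  refine Runs.free ?_ (by decide) ?_
  · by_cases h : lo < i <;> by_cases h' : i + 1 < hi <;>
      simp [recordLinks, blk, Prog.Safe, Instr.Safe, Prog.eff, Instr.eff, Test.Holds, *] <;> omega
  · by_cases h : lo < i <;> by_cases h' : i + 1 < hi <;>
      simp +contextual [recordLinks, blk, Prog.eff, Instr.eff, Test.Holds, midPtr, *] <;> omega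

/-- The factor 11 is 8 for the search of the interval plus 3 for the height, both proportional to
the bit length of `k`. -/
theorem runs_recordItem {W k i base : ℕ} (σ : State) (hW : base + 2 * k + 2 ≤ W) (hi : i < k)
    (h2 : σ.reg 2 = 1) (h4 : σ.reg 4 = 0) (h5 : σ.reg 5 = base) (h17 : σ.reg 17 = k)
    (h30 : σ.reg 30 = i) :
    Runs W recordItem σ (11 * Nat.size k + 28) fun σ' => σ'.reg 30 = i + 1 ∧
      MidRecord σ' base (midNode 0 k i).1 (midNode 0 k i).2 i ∧
      σ'.mem 3 (base + i) = σ.mem 18 i ∧ σ'.mem 4 (base + i) = σ.mem 19 i ∧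
      ∀ j x, x ≠ base + i → σ'.mem j x = σ.mem j x := by
  refine Runs.seq (a := 6) (b := 11 * Nat.size k + 22)
    (R := fun s => s.reg 31 = 0 ∧ s.reg 32 = k ∧ s.reg 33 = k / 2 ∧
      s.reg 34 = (k / 2 - i) + (i - k / 2)) (Runs.free ?_ (by decide) ?_) ?_ (by omega)
  · simp [blk, Prog.Safe, Instr.Safe, Prog.eff, Instr.eff, *]; omega
  · simp [blk, Prog.eff, Instr.eff, *]
  rintro s1 f1 ⟨a31, a32, a33, a34⟩
  refine Runs.seq (b := 3 * Nat.size k + 21) (runs_descend (W := W) (k := k) (i := i) s1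
    (by omega) hi ((f1.reg 2 rfl).trans h2) ((f1.reg 4 rfl).trans h4) ((f1.reg 30 rfl).trans h30)
    a31 a32 a33 a34) ?_ (by omega)
  rintro s2 f2 ⟨b33, blo, bhi, bk, bn⟩
  have e2 : s2.reg 2 = 1 := (f2.reg 2 rfl).trans ((f1.reg 2 rfl).trans h2)
  have e4 : s2.reg 4 = 0 := (f2.reg 4 rfl).trans ((f1.reg 4 rfl).trans h4)
  have e5 : s2.reg 5 = base := (f2.reg 5 rfl).trans ((f1.reg 5 rfl).trans h5)
  have e30 : s2.reg 30 = i := (f2.reg 30 rfl).trans ((f1.reg 30 rfl).trans h30)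
  have em : s2.mem = σ.mem := funext fun j => (f2.mem j rfl).trans (f1.mem j rfl)
  refine Runs.seq (b := 3 * Nat.size k + 3) (runs_recordLinks (W := W) (k := k) s2 hW blo bhi bk e2
    e5 e30 rfl rfl b33) ?_ (by omega)
  rintro s3 f3 ⟨c0, c1, c3, c4, c36, c34, c35, cm⟩
  have hsz : Nat.size (s2.reg 32 - s2.reg 31) ≤ Nat.size k := Nat.size_le_size (by omega)
  refine Runs.seq (b := 2) (runs_height (W := W) s3 (by omega) ((f3.reg 2 rfl).trans e2)
    ((f3.reg 4 rfl).trans e4) c34 c35) ?_ (by omega)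
  intro s4 f4 d35
  have g36 : s4.reg 36 = base + i := (f4.reg 36 rfl).trans c36
  have g30 : s4.reg 30 = i := (f4.reg 30 rfl).trans ((f3.reg 30 rfl).trans e30)
  have g2 : s4.reg 2 = 1 := (f4.reg 2 rfl).trans ((f3.reg 2 rfl).trans e2)
  have gm : s4.mem = s3.mem := funext fun j => f4.mem j rfl
  refine Runs.free ?_ (by decide) ?_
  · simp [blk, Prog.Safe, Instr.Safe, Prog.eff, Instr.eff, *]; omega
  · simp +contextual [blk, Prog.eff, Instr.eff, MidRecord, *]

/-- The registers and segments after the tree for the items in the segments 18 and 19 was built. -/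
structure Built (k base : ℕ) (σ σ' : State) : Prop where
  reg5 : σ'.reg 5 = base + k
  reg24 : σ'.reg 24 = midPtr base 0 k
  records : ∀ i < k, MidRecord σ' base (midNode 0 k i).1 (midNode 0 k i).2 i
  item3 : ∀ i < k, σ'.mem 3 (base + i) = σ.mem 18 i
  item4 : ∀ i < k, σ'.mem 4 (base + i) = σ.mem 19 i
  old : ∀ j x, x < base → σ'.mem j x = σ.mem j x

theorem runs_buildTree {W k base : ℕ} (σ : State) (hW : base + 2 * k + 2 ≤ W)
    (h2 : σ.reg 2 = 1) (h4 : σ.reg 4 = 0) (h5 : σ.reg 5 = base) (h17 : σ.reg 17 = k) :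
    Runs W buildTree σ (k * (11 * Nat.size k + 29) + 6) (Built k base σ) := by
  refine Runs.seq (a := 1) (b := k * (11 * Nat.size k + 29) + 5)
    (R := fun s => s.reg 30 = 0) (Runs.free ?_ (by decide) ?_) ?_ (by omega)
  · simp [Prog.Safe, Instr.Safe]; omega
  · simp [Prog.eff, Instr.eff]
  intro s1 f1 a30
  have a2 : s1.reg 2 = 1 := (f1.reg 2 rfl).trans h2
  have a4 : s1.reg 4 = 0 := (f1.reg 4 rfl).trans h4
  have a5 : s1.reg 5 = base := (f1.reg 5 rfl).trans h5
  have a17 : s1.reg 17 = k := (f1.reg 17 rfl).trans h17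
  have am : s1.mem = σ.mem := funext fun j => f1.mem j rfl
  refine Runs.seq (a := k * (11 * Nat.size k + 29) + 1) (b := 4)
    (R := fun s => Frame recordItem s1 s ∧
      (∀ i < k, MidRecord s base (midNode 0 k i).1 (midNode 0 k i).2 i ∧
        s.mem 3 (base + i) = σ.mem 18 i ∧ s.mem 4 (base + i) = σ.mem 19 i) ∧
      ∀ j x, x < base → s.mem j x = σ.mem j x) ?_ ?_ (by omega)
  · refine (Runs.loop s1 (fun b s => b = (k - s.reg 30) * (11 * Nat.size k + 29) ∧ s.reg 30 ≤ k ∧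
      (∀ i < s.reg 30, MidRecord s base (midNode 0 k i).1 (midNode 0 k i).2 i ∧
        s.mem 3 (base + i) = σ.mem 18 i ∧ s.mem 4 (base + i) = σ.mem 19 i) ∧
      ∀ j x, x < base → s.mem j x = σ.mem j x) ?_ ?_).mono le_rfl ?_
    · rintro b s ⟨hb, hik, hr, ho⟩ hF hc
      have e17 : s.reg 17 = k := (hF.reg 17 rfl).trans a17
      have e18 : s.mem 18 = σ.mem 18 := (hF.mem 18 rfl).trans (by rw [am])
      have e19 : s.mem 19 = σ.mem 19 := (hF.mem 19 rfl).trans (by rw [am])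
      simp only [Test.Holds, e17] at hc
      refine ⟨_, (runs_recordItem (W := W) (k := k) (base := base) s hW hc ((hF.reg 2 rfl).trans a2)
        ((hF.reg 4 rfl).trans a4) ((hF.reg 5 rfl).trans a5) e17 rfl).mono le_rfl ?_⟩
      rintro s' - ⟨b30, brec, b3, b4, bm⟩
      refine ⟨_, ?_, rfl, by omega, fun i hi => ?_, fun j x hx => ?_⟩
      · rw [hb, b30]
        obtain ⟨d, hd⟩ : ∃ d, k - s.reg 30 = d + 1 := ⟨k - s.reg 30 - 1, by omega⟩
        rw [hd, show k - (s.reg 30 + 1) = d by omega]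
        ring_nf; omega
      · rcases Nat.lt_or_ge i (s.reg 30) with h | h
        · have := hr i h
          simp only [MidRecord] at this ⊢
          simpa only [bm _ _ (show base + i ≠ base + s.reg 30 by omega)] using this
        · obtain rfl : i = s.reg 30 := by omega
          exact ⟨brec, by rw [b3, e18], by rw [b4, e19]⟩
      · rw [bm _ _ (by omega), ho _ _ hx]
    · simp [a30, am]
    · rintro s - ⟨⟨b, hb, hik, hr, ho⟩, hF, hc⟩
      have e17 : s.reg 17 = k := (hF.reg 17 rfl).trans a17
      simp only [Test.Holds, e17] at hc
      exact ⟨hF, fun i hi => hr i (by omega), ho⟩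
  · rintro s - ⟨hF, hr, ho⟩
    have e17 : s.reg 17 = k := (hF.reg 17 rfl).trans a17
    have e5 : s.reg 5 = base := (hF.reg 5 rfl).trans a5
    have e4 : s.reg 4 = 0 := (hF.reg 4 rfl).trans a4
    refine Runs.free ?_ (by decide) ?_
    · by_cases h : 0 < k <;>
        simp [blk, Prog.Safe, Instr.Safe, Prog.eff, Instr.eff, Test.Holds, *] <;> omega
    · simp only [MidRecord] at hr
      by_cases h : 0 < k <;>
        refine ⟨?_, ?_, fun i hi => ?_, fun i hi => ?_, fun i hi => ?_, fun j x hx => ?_⟩ <;>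
        simp [blk, Prog.eff, Instr.eff, Test.Holds, midPtr, MidRecord, *] <;> omega

end PseudoTri

/-! ### From linked lists to balanced trees -/

namespace PseudoTri

open RealRAM

/-- The balanced tree with the items of a list. -/
def balTree {α : Type} : List α → BinaryTree α
  | [] => .nil
  | x :: l => midTree (fun i => (x :: l).getD i x) 0 (l.length + 1)

theorem balanced_balTree {α : Type} : ∀ l : List α, Balanced (balTree l)
  | [] => trivial
  | _ :: _ => balanced_midTree _ _ _

theorem inorder_balTree {α : Type} : ∀ l : List α, inorder (balTree l) = l
  | [] => rfl
  | x :: l => by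
    rw [balTree, inorder_midTree]
    refine List.ext_getElem (by simp) fun i h1 h2 => ?_
    simp only [List.length_map, List.length_range'] at h1
    simp [List.getD_eq_getElem?_getD, List.getElem?_eq_getElem h2]

theorem storesList_balTree {α : Type} {k base : ℕ} {σ σ' : State} (h : Built k base σ σ')
    (hb : 0 < base) (l : List α) (hl : l.length = k) (item : α → ℕ → Prop)
    (hitem : ∀ i (hi : i < l.length), item l[i] (base + i)) :
    ∃ A : List ℕ, StoresList σ' item (balTree l) (σ'.reg 24) A ∧ A.Nodup ∧
      ∀ x ∈ A, base ≤ x ∧ x < base + k := by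
  subst hl
  rw [h.reg24]
  cases l with
  | nil => exact ⟨[], ⟨by simp [midPtr], rfl⟩, List.nodup_nil, by simp⟩
  | cons x l =>
    refine storesList_midTree σ' item _ base hb 0 _ fun i _ hi => ⟨h.records i hi, ?_⟩
    have := hitem i hi
    rwa [List.getD_eq_getElem?_getD, List.getElem?_eq_getElem hi]

/-- Copy one vertex of a linked list to segment 18 and go to the next. -/
def walkStep : Prog :=
  blk [.store 18 17 25, .add 17 17 2, .load 25 13 25, .sub 34 25 26, .sub 35 26 25, .add 34 34 35]

/-- Copy the linked list of segment 13, from the vertex in register 25 up to and excluding the one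
in register 26, to segment 18, and count its vertices in register 17. -/
def walkList : Prog :=
  .seq (blk [.const 17 0, .sub 34 25 26, .sub 35 26 25, .add 34 34 35])
    (.loop (.lt 4 34) walkStep)

/-- The function `f` enumerates the list together with its end marker `e = f k`, which is not
copied. -/
theorem runs_walkList {W k N e : ℕ} (σ : State) (f : ℕ → ℕ) (hW : N + k + 1 < W)
    (h2 : σ.reg 2 = 1) (h4 : σ.reg 4 = 0) (h25 : σ.reg 25 = f 0) (h26 : σ.reg 26 = e)
    (hN : ∀ i ≤ k, f i ≤ N) (hstep : ∀ i < k, σ.mem 13 (f i) = f (i + 1))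
    (hne : ∀ i < k, f i ≠ e) (hk : f k = e) :
    Runs W walkList σ (7 * k + 5) fun σ' => σ'.reg 17 = k ∧ ∀ i < k, σ'.mem 18 i = f i := by
  have he : e ≤ N := hk ▸ hN k le_rfl
  have h0 := hN 0 (Nat.zero_le _)
  refine Runs.seq (a := 4) (b := 7 * k + 1)
    (R := fun s => s.reg 17 = 0 ∧ s.reg 34 = (f 0 - e) + (e - f 0)) (Runs.free ?_ (by decide) ?_)
    ?_ (by omega)
  · simp [blk, Prog.Safe, Instr.Safe, Prog.eff, Instr.eff, *]; omega
  · simp [blk, Prog.eff, Instr.eff, *]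
  rintro s1 f1 ⟨a17, a34⟩
  refine (Runs.loop s1 (fun b s => b = 7 * (k - s.reg 17) ∧ s.reg 17 ≤ k ∧
    s.reg 25 = f (s.reg 17) ∧ s.reg 34 = (s.reg 25 - e) + (e - s.reg 25) ∧
    ∀ i < s.reg 17, s.mem 18 i = f i) ?_ ?_).mono le_rfl ?_
  · rintro b s ⟨hb, hsk, e25, e34, hm⟩ hF hc
    have e2 : s.reg 2 = 1 := (hF.reg 2 rfl).trans ((f1.reg 2 rfl).trans h2)
    have e4 : s.reg 4 = 0 := (hF.reg 4 rfl).trans ((f1.reg 4 rfl).trans h4)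
    have e26 : s.reg 26 = e := (hF.reg 26 rfl).trans ((f1.reg 26 rfl).trans h26)
    have e13 : s.mem 13 = σ.mem 13 := (hF.mem 13 rfl).trans (f1.mem 13 rfl)
    simp only [Test.Holds, e4] at hc
    -- The loop test says that the current vertex is not the end marker, so the walk has not reached
    -- position `k`.
    have hlt : s.reg 17 < k := by
      rcases hsk.lt_or_eq with h | h
      · exact h
      · rw [h, hk] at e25; omega
    have hs := hstep _ hlt
    have hn := hN (s.reg 17 + 1) hlt
    refine ⟨6, Runs.free ?_ (by decide) ⟨7 * (k - (s.reg 17 + 1)), ?_, ?_⟩⟩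
    · simp [walkStep, blk, Prog.Safe, Instr.Safe, Prog.eff, Instr.eff, e2, e25, e26, e13, hs]; omega
    · omega
    · simp [walkStep, blk, Prog.eff, Instr.eff, e2, e25, e26, e13, hs]
      refine ⟨hlt, fun i hi => ?_⟩
      split_ifs with h
      · rw [h]
      · exact hm i (by omega)
  · simp [a17, a34, f1.reg 25 rfl, h25]
  · rintro s - ⟨⟨b, hb, hsk, e25, e34, hm⟩, hF, hc⟩
    have e4 : s.reg 4 = 0 := (hF.reg 4 rfl).trans ((f1.reg 4 rfl).trans h4)
    simp only [Test.Holds, e4] at hc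
    have : s.reg 17 = k := by
      by_contra h
      exact hne (s.reg 17) (by omega) (by omega)
    exact ⟨this, this ▸ hm⟩

/-- Build a balanced tree of the linked list between the vertices in registers 25 and 26. -/
def listTree : Prog := .seq walkList buildTree

/-- Only the segments 0 to 4 are claimed to be unchanged below `base`: these hold the list records,
whereas the walk overwrites segment 18. -/
theorem runs_listTree {W n N base e : ℕ} (σ : State) (l : List (Fin n))
    (hW : base + N + 2 * l.length + 2 < W) (hb : 0 < base)
    (h2 : σ.reg 2 = 1) (h4 : σ.reg 4 = 0) (h5 : σ.reg 5 = base) (h26 : σ.reg 26 = e)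
    (hn : n ≤ N) (heN : e ≤ N) (h25 : [σ.reg 25] <+: l.map Fin.val ++ [e])
    (hchain : (l.map Fin.val ++ [e]).IsChain fun a b => σ.mem 13 a = b) (hne : e ∉ l.map Fin.val) :
    Runs W listTree σ (l.length * (11 * Nat.size l.length + 36) + 11) fun σ' =>
      σ'.reg 5 = base + l.length ∧
      (∀ j < 5, ∀ x < base, σ'.mem j x = σ.mem j x) ∧
      ∃ A, StoresPts σ' (balTree l) (σ'.reg 24) A ∧ A.Nodup ∧
        ∀ x ∈ A, base ≤ x ∧ x < base + l.length := by
  set f : ℕ → ℕ := fun i => (l.map Fin.val ++ [e]).getD i 0 with hf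
  have hfl : ∀ i (hi : i < l.length), f i = l[i] := fun i hi => by
    simp [hf, List.getElem?_append_left, hi]
  have hfg : ∀ i (hi : i < (l.map Fin.val ++ [e]).length), f i = (l.map Fin.val ++ [e])[i] :=
    fun i hi => by simp only [hf, List.getD_eq_getElem?_getD, List.getElem?_eq_getElem hi]; rfl
  have hfe : f l.length = e := by simp [hf]
  have hstep : ∀ i < l.length, σ.mem 13 (f i) = f (i + 1) := fun i hi => by
    have := List.isChain_iff_getElem.1 hchain i (by simpa using hi)
    rw [← hfg i (by simp; omega), ← hfg (i + 1) (by simp; omega)] at this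
    exact this
  refine Runs.seq (runs_walkList (W := W) (k := l.length) (N := N) (e := e) σ f (by omega) h2 h4 ?_
    h26 ?_ hstep ?_ hfe) ?_ (t := l.length * (11 * Nat.size l.length + 36) + 11)
    (b := l.length * (11 * Nat.size l.length + 29) + 6) (by ring_nf; omega)
  · obtain ⟨t, ht⟩ := h25
    simp [hf, ← ht]
  · intro i hi
    rcases hi.lt_or_eq with h | rfl
    · rw [hfl i h]; omega
    · omega
  · intro i hi h
    rw [hfl i hi] at h
    exact hne (List.mem_map.2 ⟨l[i], List.getElem_mem _, h⟩)
  rintro s1 f1 ⟨a17, am⟩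
  refine (runs_buildTree (W := W) s1 (by omega) ((f1.reg 2 rfl).trans h2) ((f1.reg 4 rfl).trans h4)
    ((f1.reg 5 rfl).trans h5) a17).mono le_rfl fun s f2 h => ⟨h.reg5, fun j hj x hx => ?_, ?_⟩
  · rw [h.old j x hx]
    have : j ≠ 18 := by omega
    exact congrFun (f1.mem j (by simp [walkList, walkStep, blk, Prog.anyInstr, Instr.wMem, this])) x
  · refine storesList_balTree h hb l rfl _ fun i hi => ?_
    rw [h.item3 i hi, am i hi, hfl i hi]

end PseudoTri

/-! ### Orientation of points in the plane -/

namespace PseudoTri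

/-- The orientation of a triangle, computed from the heights above a line. -/
theorem orient_heights (p e a b c : ℝ × ℝ) :
    (e.1 - p.1) * orient a b c = (b.1 - a.1) * orient p e c - (b.1 - c.1) * orient p e a
      - (c.1 - a.1) * orient p e b := by
  simp only [orient]; ring

theorem orient_swap_right (a b c : ℝ × ℝ) : orient a c b = -orient a b c := by
  simp only [orient]; ring

theorem orient_rotate (a b c : ℝ × ℝ) : orient b c a = orient a b c := by
  simp only [orient]; ring

theorem orient_self_left (a b : ℝ × ℝ) : orient a b a = 0 := by simp only [orient]; ring

theorem orient_self_right (a b : ℝ × ℝ) : orient a b b = 0 := by simp only [orient]; ring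

theorem orient_combo (p q a b : ℝ × ℝ) {s t : ℝ} (h : s + t = 1) :
    orient p q (s • a + t • b) = s * orient p q a + t * orient p q b := by
  obtain rfl : s = 1 - t := by linarith
  simp only [orient, Prod.fst_add, Prod.snd_add, Prod.smul_fst, Prod.smul_snd, smul_eq_mul]; ring

/-- Replacing the left end of a chord by a point above it raises the chord. -/
theorem orient_raise_left {x' x y z : ℝ × ℝ} (h1 : x'.1 < x.1) (h3 : z.1 ≤ y.1)
    (hxy : x.1 < y.1) (hx' : 0 < orient x y x') (hz : orient x y z ≤ 0) : orient x' y z ≤ 0 := by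
  have key := orient_heights x y x' y z
  rw [orient_self_right] at key
  by_contra hc
  push Not at hc
  nlinarith [mul_pos (sub_pos.2 hxy) hc, mul_nonneg (sub_nonneg.2 h3) hx'.le,
    mul_nonneg (sub_nonneg.2 (h1.trans hxy).le) (neg_nonneg.2 hz)]

theorem orient_raise_left_lt {x' x y z : ℝ × ℝ} (h1 : x'.1 < x.1)
    (h3 : z.1 ≤ y.1) (hxy : x.1 < y.1) (hx' : 0 < orient x y x') (hz : orient x y z ≤ 0)
    (hs : orient x y z < 0 ∨ z.1 < y.1) : orient x' y z < 0 := by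
  have key := orient_heights x y x' y z
  rw [orient_self_right] at key
  by_contra hc
  push Not at hc
  have e1 := mul_nonneg (sub_pos.2 hxy).le hc
  rcases hs with hs | hs
  · nlinarith [mul_nonneg (sub_nonneg.2 h3) hx'.le,
      mul_pos (sub_pos.2 (h1.trans hxy)) (neg_pos.2 hs)]
  · nlinarith [mul_pos (sub_pos.2 hs) hx',
      mul_nonneg (sub_nonneg.2 (h1.trans hxy).le) (neg_nonneg.2 hz)]

/-- Reflection in the vertical axis. -/
def mirrorPt (z : ℝ × ℝ) : ℝ × ℝ := (-z.1, z.2)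

theorem mirror_fst (z : ℝ × ℝ) : (mirrorPt z).1 = -z.1 := rfl

theorem orient_mirror (a b c : ℝ × ℝ) : orient (mirrorPt b) (mirrorPt a) (mirrorPt c) = orient a b c := by
  simp only [orient, mirrorPt]; ring

/-- Slopes decrease along `a`, `b`, `c`, `d`, so the whole continuation of a concave chain stays
below the line of its first edge. With `orient_trans_right` this makes local concavity global. -/
theorem orient_trans_left {a b c d : ℝ × ℝ} (h1 : a.1 < b.1) (h2 : b.1 < c.1) (h3 : c.1 < d.1)
    (h : orient a b c ≤ 0) (h' : orient b c d ≤ 0) : orient a b d ≤ 0 := by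
  have key := orient_heights a b b c d
  rw [orient_self_right] at key
  have e1 := mul_nonneg (sub_pos.2 h1).le (neg_nonneg.2 h')
  have e2 := mul_nonneg (sub_pos.2 (h2.trans h3)).le (neg_nonneg.2 h)
  by_contra hc
  push Not at hc
  nlinarith [mul_pos (sub_pos.2 h2) hc]

theorem orient_trans_right {a b c d : ℝ × ℝ} (h1 : a.1 < b.1) (h2 : b.1 < c.1) (h3 : c.1 < d.1)
    (h : orient a b c ≤ 0) (h' : orient b c d ≤ 0) : orient a c d ≤ 0 := by
  have := orient_trans_left (a := mirrorPt d) (b := mirrorPt c) (c := mirrorPt b) (d := mirrorPt a)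
    (by simp only [mirror_fst]; linarith) (by simp only [mirror_fst]; linarith)
    (by simp only [mirror_fst]; linarith)
    (by rwa [orient_mirror, orient_rotate])
    (by rwa [orient_mirror, orient_rotate])
  rwa [orient_mirror, orient_rotate] at this

theorem orient_raise_right {x y y' z : ℝ × ℝ} (h1 : y.1 < y'.1) (h2 : x.1 ≤ z.1)
    (hxy : x.1 < y.1) (hy' : 0 < orient x y y') (hz : orient x y z ≤ 0) : orient x y' z ≤ 0 := by
  have := orient_raise_left (x' := mirrorPt y') (x := mirrorPt y) (y := mirrorPt x) (z := mirrorPt z)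
    (by simp only [mirror_fst]; linarith) (by simp only [mirror_fst]; linarith)
    (by simp only [mirror_fst]; linarith)
    (by rwa [orient_mirror]) (by rwa [orient_mirror])
  rwa [orient_mirror] at this

theorem orient_raise_right_lt {x y y' z : ℝ × ℝ} (h1 : y.1 < y'.1) (h2 : x.1 ≤ z.1)
    (hxy : x.1 < y.1) (hy' : 0 < orient x y y') (hz : orient x y z ≤ 0)
    (hs : orient x y z < 0 ∨ x.1 < z.1) : orient x y' z < 0 := by
  have := orient_raise_left_lt (x' := mirrorPt y') (x := mirrorPt y) (y := mirrorPt x) (z := mirrorPt z)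
    (by simp only [mirror_fst]; linarith) (by simp only [mirror_fst]; linarith)
    (by simp only [mirror_fst]; linarith)
    (by rwa [orient_mirror]) (by rwa [orient_mirror])
    (by rw [orient_mirror]; exact hs.imp_right fun h => by simp only [mirror_fst]; linarith)
  rwa [orient_mirror] at this

/-- In a funnel with base `pe`, the apex `m` is below the segment from the vertex `q` of the left
chain to any vertex `r` of the right chain that is not before the point of tangency `w`. -/
theorem orient_apex_neg {p e q w r m : ℝ × ℝ} (hpq : p.1 < q.1) (hqm : q.1 < m.1) (hmw : m.1 < w.1)
    (hwr : w.1 < r.1) (hre : r = e ∨ (r.1 < e.1 ∧ orient w r e ≤ 0))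
    (hq : orient p e q < 0) (hw : orient p e w < 0) (hL : orient p q m ≤ 0)
    (ht : orient q w r ≤ 0) : orient q r m < 0 := by
  have hre1 : r.1 ≤ e.1 := by rcases hre with rfl | h; exacts [le_rfl, h.1.le]
  have hpe : p.1 < e.1 := by linarith
  have hm : orient p e m < orient p e q := by
    have key := orient_heights p e p q m
    rw [orient_self_left] at key
    have e1 := mul_nonneg (sub_pos.2 hpe).le (neg_nonneg.2 hL)
    nlinarith [mul_pos (sub_pos.2 hqm) (neg_pos.2 hq)]
  have hr : orient p e q ≤ orient p e r := by
    rcases hre with rfl | ⟨hre, hc⟩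
    · rw [orient_self_right]; exact hq.le
    · have k1 := orient_heights p e w r e
      rw [orient_self_right] at k1
      have e1 := mul_nonneg (sub_pos.2 hpe).le (neg_nonneg.2 hc)
      have hwr' : orient p e w ≤ orient p e r := by
        by_contra hcon
        push Not at hcon
        nlinarith [mul_pos (sub_pos.2 (hwr.trans hre)) (sub_pos.2 hcon),
          mul_pos (sub_pos.2 hwr) (neg_pos.2 hw)]
      have k2 := orient_heights p e q w r
      have e2 := mul_nonneg (sub_pos.2 hpe).le (neg_nonneg.2 ht)
      by_contra hcon
      push Not at hcon
      nlinarith [mul_pos (sub_pos.2 (hqm.trans hmw)) (sub_pos.2 hcon),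
        mul_nonneg (sub_pos.2 (hwr)).le (sub_nonneg.2 hwr'),
        mul_pos (sub_pos.2 (hwr)) (sub_pos.2 hcon)]
  have key := orient_heights p e q r m
  by_contra hcon
  push Not at hcon
  nlinarith [mul_nonneg (sub_pos.2 hpe).le hcon, mul_nonneg (sub_pos.2 hqm).le (sub_nonneg.2 hr),
    mul_pos (sub_pos.2 (hqm.trans (hmw.trans hwr))) (sub_pos.2 hm)]

/-- A segment whose ends are on opposite sides of the line `qr` meets the segment `qr`. -/
theorem exists_crossing {q r a b : ℝ × ℝ} (hqa : q.1 < a.1) (hab : a.1 < b.1) (hbr : b.1 < r.1)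
    (ha : orient q r a < 0) (hb : 0 ≤ orient q r b) :
    ∃ z ∈ segment ℝ a b, z ∈ segment ℝ q r ∧ z ≠ q ∧ z ≠ r := by
  set A := orient q r a
  set B := orient q r b
  have hBA : 0 < B - A := by linarith
  -- The zero of the affine function `orient q r` along the segment from `a` (value `A`) to `b`
  -- (value `B`).
  set t := -A / (B - A)
  have ht0 : 0 < t := div_pos (by linarith) hBA
  have ht1 : t ≤ 1 := (div_le_one hBA).2 (by linarith)
  set z := (1 - t) • a + t • b with hz
  have hz0 : orient q r z = 0 := by
    rw [hz, orient_combo _ _ _ _ (by ring)]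
    change (1 - t) * A + t * B = 0
    have : t * (B - A) = -A := div_mul_cancel₀ _ hBA.ne'
    linarith
  have hz1 : z.1 = (1 - t) * a.1 + t * b.1 := by simp [hz]
  have hza : a.1 ≤ z.1 := by nlinarith
  have hzb : z.1 ≤ b.1 := by nlinarith
  have hqr : 0 < r.1 - q.1 := by linarith
  refine ⟨z, ⟨1 - t, t, by linarith, ht0.le, by ring, rfl⟩, ?_, ?_, ?_⟩
  · have hs : (z.1 - q.1) / (r.1 - q.1) ≤ 1 := (div_le_one hqr).2 (by linarith)
    refine ⟨1 - (z.1 - q.1) / (r.1 - q.1), (z.1 - q.1) / (r.1 - q.1), by linarith,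
      div_nonneg (by linarith) hqr.le, by ring, ?_⟩
    simp only [orient] at hz0
    ext
    · simp only [Prod.fst_add, Prod.smul_fst, smul_eq_mul]; field_simp; ring
    · simp only [Prod.snd_add, Prod.smul_snd, smul_eq_mul]; field_simp; linarith
  · intro h; rw [h] at hza; linarith
  · intro h; rw [h] at hzb; linarith

end PseudoTri

/-! ### The triangulation of a funnel as a merging of its chains -/

namespace PseudoTri

variable {n : ℕ} {P : Fin n → ℝ × ℝ} {π : Equiv.Perm (Fin n)}

/-- `Stair P π X Y T`: the chords `T`, from bottom to top, that arise by moving from the chord that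
joins the first vertices of the left chain `X` and of the right chain `Y` to the base, which joins
their last vertices. Both chains are listed from the apex outwards, the apex excluded. In each step
one end of the chord moves to the next vertex, if this vertex is above the chord; if both ends can
move, the one of least priority stays. -/
inductive Stair (P : Fin n → ℝ × ℝ) (π : Equiv.Perm (Fin n)) :
    List (Fin n) → List (Fin n) → List (Fin n × Fin n) → Prop
  | base (p q : Fin n) : Stair P π [p] [q] []
  | left {x x' y : Fin n} {X Y : List (Fin n)} {T : List (Fin n × Fin n)} :
      0 < orient (P x) (P y) (P x') →
      (∀ y' ∈ Y.head?, orient (P x) (P y) (P y') ≤ 0 ∨ π y ≤ π x) →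
      Stair P π (x' :: X) (y :: Y) T → Stair P π (x :: x' :: X) (y :: Y) ((x, y) :: T)
  | right {x y y' : Fin n} {X Y : List (Fin n)} {T : List (Fin n × Fin n)} :
      0 < orient (P x) (P y) (P y') →
      (∀ x' ∈ X.head?, orient (P x) (P y) (P x') ≤ 0 ∨ π x ≤ π y) →
      Stair P π (x :: X) (y' :: Y) T → Stair P π (x :: X) (y :: y' :: Y) ((x, y) :: T)

theorem Stair.mirror {X Y : List (Fin n)} {T : List (Fin n × Fin n)} (h : Stair P π X Y T) :
    Stair (fun i => mirrorPt (P i)) π Y X (T.map Prod.swap) := by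
  induction h with
  | base p q => exact .base q p
  | left h1 h2 _ ih =>
    exact .right (by rwa [orient_mirror]) (by simpa only [orient_mirror] using h2) ih
  | right h1 h2 _ ih =>
    exact .left (by rwa [orient_mirror]) (by simpa only [orient_mirror] using h2) ih

theorem Stair.ne_nil {X Y : List (Fin n)} {T : List (Fin n × Fin n)} (h : Stair P π X Y T) :
    X ≠ [] ∧ Y ≠ [] := by
  cases h <;> simp

theorem Stair.length {X Y : List (Fin n)} {T : List (Fin n × Fin n)} (h : Stair P π X Y T) :
    T.length + 2 = X.length + Y.length := by
  induction h <;> simp_all <;> omega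

theorem Stair.mem {X Y : List (Fin n)} {T : List (Fin n × Fin n)} (h : Stair P π X Y T) :
    ∀ f ∈ T, f.1 ∈ X ∧ f.2 ∈ Y := by
  induction h with
  | base => simp
  | left _ _ _ ih =>
    intro f hf
    rcases List.mem_cons.1 hf with rfl | hf
    · simp
    · exact ⟨List.mem_cons_of_mem _ (ih f hf).1, (ih f hf).2⟩
  | right _ _ _ ih =>
    intro f hf
    rcases List.mem_cons.1 hf with rfl | hf
    · simp
    · exact ⟨(ih f hf).1, List.mem_cons_of_mem _ (ih f hf).2⟩

/-- The `x`-coordinate decreases. -/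
abbrev DecX (P : Fin n → ℝ × ℝ) (l : List (Fin n)) : Prop := l.Pairwise fun a b => (P b).1 < (P a).1

/-- The `x`-coordinate increases. -/
abbrev IncX (P : Fin n → ℝ × ℝ) (l : List (Fin n)) : Prop := l.Pairwise fun a b => (P a).1 < (P b).1

/-- What is below the first chord is below all chords and below the base. -/
theorem Stair.below_first {X Y : List (Fin n)} {T : List (Fin n × Fin n)} (h : Stair P π X Y T) {m : ℝ}
    (hX : DecX P X) (hY : IncX P Y) (hm : ∀ a ∈ X, (P a).1 < m) (hm' : ∀ a ∈ Y, m < (P a).1) :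
    ∀ x ∈ X.head?, ∀ y ∈ Y.head?, ∀ z : ℝ × ℝ, (P x).1 ≤ z.1 → z.1 ≤ (P y).1 →
      (orient (P x) (P y) z ≤ 0 → ∀ f ∈ T, orient (P f.1) (P f.2) z ≤ 0) ∧
      (orient (P x) (P y) z < 0 → (∀ f ∈ T, orient (P f.1) (P f.2) z < 0) ∧
        ∀ p ∈ X.getLast?, ∀ q ∈ Y.getLast?, orient (P p) (P q) z < 0) := by
  induction h with
  | base p q => simp
  | @left x x' y X Y T h1 h2 _ ih =>
    intro _ hx _ hy z hxz hzy
    obtain rfl := Option.some.inj hx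
    obtain rfl := Option.some.inj hy
    have hxx : (P x').1 < (P x).1 := List.rel_of_pairwise_cons hX (by simp)
    have hxy : (P x).1 < (P y).1 := (hm x (by simp)).trans (hm' y (by simp))
    have key := ih hX.tail hY (fun a ha => hm a (List.mem_cons_of_mem _ ha)) hm' x' rfl y rfl z
      (hxx.le.trans hxz) hzy
    refine ⟨fun hz f hf => ?_, fun hz => ⟨fun f hf => ?_, ?_⟩⟩
    · rcases List.mem_cons.1 hf with rfl | hf
      · exact hz
      · exact key.1 (orient_raise_left hxx hzy hxy h1 hz) f hf
    · rcases List.mem_cons.1 hf with rfl | hf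
      · exact hz
      · exact (key.2 (orient_raise_left_lt hxx hzy hxy h1 hz.le (.inl hz))).1 f hf
    · rw [List.getLast?_cons_cons]
      exact (key.2 (orient_raise_left_lt hxx hzy hxy h1 hz.le (.inl hz))).2
  | @right x y y' X Y T h1 h2 _ ih =>
    intro _ hx _ hy z hxz hzy
    obtain rfl := Option.some.inj hx
    obtain rfl := Option.some.inj hy
    have hyy : (P y).1 < (P y').1 := List.rel_of_pairwise_cons hY (by simp)
    have hxy : (P x).1 < (P y).1 := (hm x (by simp)).trans (hm' y (by simp))
    have key := ih hX hY.tail hm (fun a ha => hm' a (List.mem_cons_of_mem _ ha)) x rfl y' rfl z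
      hxz (hzy.trans hyy.le)
    refine ⟨fun hz f hf => ?_, fun hz => ⟨fun f hf => ?_, ?_⟩⟩
    · rcases List.mem_cons.1 hf with rfl | hf
      · exact hz
      · exact key.1 (orient_raise_right hyy hxz hxy h1 hz) f hf
    · rcases List.mem_cons.1 hf with rfl | hf
      · exact hz
      · exact (key.2 (orient_raise_right_lt hyy hxz hxy h1 hz.le (.inl hz))).1 f hf
    · rw [List.getLast?_cons_cons]
      exact (key.2 (orient_raise_right_lt hyy hxz hxy h1 hz.le (.inl hz))).2

/-- The vertices of the chains, other than the ends of the base, are below the base. -/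
theorem Stair.below_base {X Y : List (Fin n)} {T : List (Fin n × Fin n)} (h : Stair P π X Y T)
    {m : ℝ} (hX : DecX P X) (hY : IncX P Y) (hm : ∀ a ∈ X, (P a).1 < m)
    (hm' : ∀ a ∈ Y, m < (P a).1) :
    ∀ p ∈ X.getLast?, ∀ q ∈ Y.getLast?, ∀ z, z ∈ X ∨ z ∈ Y → z ≠ p → z ≠ q →
      orient (P p) (P q) (P z) < 0 := by
  induction h with
  | base p q => simp +contextual
  | @left x x' y X Y T h1 h2 hs ih =>
    intro p hp q hq z hz hzp hzq
    have hxx : (P x').1 < (P x).1 := List.rel_of_pairwise_cons hX (by simp)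
    have hxy : (P x).1 < (P y).1 := (hm x (by simp)).trans (hm' y (by simp))
    have hmt : ∀ a ∈ x' :: X, (P a).1 < m := fun a ha => hm a (List.mem_cons_of_mem _ ha)
    rw [List.getLast?_cons_cons] at hp
    rw [List.mem_cons, or_assoc] at hz
    rcases hz with rfl | hz
    · exact ((hs.below_first hX.tail hY hmt hm' x' rfl y rfl (P z) hxx.le hxy.le).2
        (orient_raise_left_lt hxx hxy.le hxy h1 (orient_self_left _ _).le (.inr hxy))).2 p hp q hq
    · exact ih hX.tail hY hmt hm' p hp q hq z hz hzp hzq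
  | @right x y y' X Y T h1 h2 hs ih =>
    intro p hp q hq z hz hzp hzq
    have hyy : (P y).1 < (P y').1 := List.rel_of_pairwise_cons hY (by simp)
    have hxy : (P x).1 < (P y).1 := (hm x (by simp)).trans (hm' y (by simp))
    have hmt : ∀ a ∈ y' :: Y, m < (P a).1 := fun a ha => hm' a (List.mem_cons_of_mem _ ha)
    rw [List.getLast?_cons_cons] at hq
    rw [List.mem_cons (b := y), or_left_comm] at hz
    rcases hz with rfl | hz
    · exact ((hs.below_first hX hY.tail hm hmt x rfl y' rfl (P z) hxy.le hyy.le).2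
        (orient_raise_right_lt hyy hxy.le hxy h1 (orient_self_right _ _).le (.inr hxy))).2 p hp q hq
    · exact ih hX hY.tail hm hmt p hp q hq z hz hzp hzq

/-- Each chord is below the later ones. -/
theorem Stair.pairwise {X Y : List (Fin n)} {T : List (Fin n × Fin n)} (h : Stair P π X Y T)
    {m : ℝ} (hX : DecX P X) (hY : IncX P Y) (hm : ∀ a ∈ X, (P a).1 < m)
    (hm' : ∀ a ∈ Y, m < (P a).1) :
    T.Pairwise fun e f =>
      orient (P f.1) (P f.2) (P e.1) ≤ 0 ∧ orient (P f.1) (P f.2) (P e.2) ≤ 0 := by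
  induction h with
  | base p q => simp
  | @left x x' y X Y T h1 h2 hs ih =>
    have hxx : (P x').1 < (P x).1 := List.rel_of_pairwise_cons hX (by simp)
    have hxy : (P x).1 < (P y).1 := (hm x (by simp)).trans (hm' y (by simp))
    have hmt : ∀ a ∈ x' :: X, (P a).1 < m := fun a ha => hm a (List.mem_cons_of_mem _ ha)
    refine List.pairwise_cons.2 ⟨fun f hf => ⟨?_, ?_⟩, ih hX.tail hY hmt hm'⟩
    · exact (hs.below_first hX.tail hY hmt hm' x' rfl y rfl (P x) hxx.le hxy.le).1
        (orient_raise_left hxx hxy.le hxy h1 (orient_self_left _ _).le) f hf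
    · exact (hs.below_first hX.tail hY hmt hm' x' rfl y rfl (P y) (hxx.trans hxy).le le_rfl).1
        (orient_self_right _ _).le f hf
  | @right x y y' X Y T h1 h2 hs ih =>
    have hyy : (P y).1 < (P y').1 := List.rel_of_pairwise_cons hY (by simp)
    have hxy : (P x).1 < (P y).1 := (hm x (by simp)).trans (hm' y (by simp))
    have hmt : ∀ a ∈ y' :: Y, m < (P a).1 := fun a ha => hm' a (List.mem_cons_of_mem _ ha)
    refine List.pairwise_cons.2 ⟨fun f hf => ⟨?_, ?_⟩, ih hX hY.tail hm hmt⟩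
    · exact (hs.below_first hX hY.tail hm hmt x rfl y' rfl (P x) le_rfl (hxy.trans hyy).le).1
        (orient_self_left _ _).le f hf
    · exact (hs.below_first hX hY.tail hm hmt x rfl y' rfl (P y) hxy.le hyy.le).1
        (orient_raise_right hyy hxy.le hxy h1 (orient_self_right _ _).le) f hf

/-- A vertex of the left chain of least priority splits the sequence of chords. -/
theorem Stair.split {X Y : List (Fin n)} {T : List (Fin n × Fin n)} (h : Stair P π X Y T) :
    ∀ {A B : List (Fin n)} {q b : Fin n}, X = A ++ q :: b :: B →
      (∀ y ∈ Y.dropLast, π q < π y) →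
      ∃ C w D T₁ T₂, Y = C ++ w :: D ∧ T = T₁ ++ (q, w) :: T₂ ∧
        Stair P π (A ++ [q]) (C ++ [w]) T₁ ∧ Stair P π (b :: B) (w :: D) T₂ ∧
        0 < orient (P q) (P w) (P b) ∧ ∀ d ∈ D.head?, orient (P q) (P w) (P d) ≤ 0 := by
  induction h with
  | base p q =>
    intro A B q b h
    have := congrArg List.length h
    simp at this
    omega
  | @left x x' y X Y T h1 h2 hs ih =>
    intro A B q b h hπ
    cases A with
    | nil =>
      obtain ⟨rfl, rfl, rfl⟩ : x = q ∧ x' = b ∧ X = B := by simpa using h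
      -- This is the move with which the left end leaves `q`. Since `q` has smaller priority than
      -- `y`, the rule for ties would have moved the right end had this been possible; so the next
      -- vertex is not above the chord, and `y` is the point of tangency.
      refine ⟨[], y, Y, [], T, rfl, rfl, .base _ _, hs, h1, fun d hd => ?_⟩
      refine (h2 d hd).resolve_right (not_le.2 (hπ y ?_))
      cases Y <;> simp_all
    | cons a A =>
      obtain ⟨rfl, h'⟩ : x = a ∧ x' :: X = A ++ q :: b :: B := by simpa using h
      obtain ⟨C, w, D, T₁, T₂, hY, hT, s1, s2, ho, hd⟩ := ih h' hπ
      refine ⟨C, w, D, (x, y) :: T₁, T₂, hY, by simp [hT], ?_, s2, ho, hd⟩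
      obtain ⟨A', hA'⟩ : ∃ A', A ++ [q] = x' :: A' := by
        cases A with
        | nil => exact ⟨[], by simp_all⟩
        | cons a A => exact ⟨A ++ [q], by simp_all⟩
      obtain ⟨C', hC', hh⟩ : ∃ C', C ++ [w] = y :: C' ∧ ∀ d ∈ C'.head?, d ∈ Y.head? := by
        cases C with
        | nil => exact ⟨[], by simp_all⟩
        | cons c C =>
          refine ⟨C ++ [w], by simp_all, ?_⟩
          obtain ⟨-, rfl⟩ : y = c ∧ Y = C ++ w :: D := by simpa using hY
          cases C <;> simp
      rw [hA', hC'] at s1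
      rw [List.cons_append, hA', hC']
      exact .left h1 (fun d hd => h2 d (hh d hd)) s1
  | @right x y y' X Y T h1 h2 hs ih =>
    intro A B q b h hπ
    obtain ⟨C, w, D, T₁, T₂, hY, hT, s1, s2, ho, hd⟩ := ih h fun z hz => hπ z (by
      rw [List.dropLast_cons_cons]; exact List.mem_cons_of_mem _ hz)
    refine ⟨y :: C, w, D, (x, y) :: T₁, T₂, by simp [hY], by simp [hT], ?_, s2, ho, hd⟩
    obtain ⟨A', hA', hh⟩ : ∃ A', A ++ [q] = x :: A' ∧ ∀ d ∈ A'.head?, d ∈ X.head? := by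
      cases A with
      | nil => exact ⟨[], by simp_all⟩
      | cons a A =>
        refine ⟨A ++ [q], by simp_all, ?_⟩
        obtain ⟨-, rfl⟩ : x = a ∧ X = A ++ q :: b :: B := by simpa using h
        cases A <;> simp
    obtain ⟨C', hC'⟩ : ∃ C', C ++ [w] = y' :: C' := by
      cases C with
      | nil => exact ⟨[], by simp_all⟩
      | cons c C => exact ⟨C ++ [w], by simp_all⟩
    rw [hA', hC'] at s1
    rw [List.cons_append, hA', hC']
    exact .right h1 (fun d hd => h2 d (hh d hd)) s1

end PseudoTri

/-! ### The chords of a funnel -/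

namespace PseudoTri

variable {n : ℕ} {P : Fin n → ℝ × ℝ} {π : Equiv.Perm (Fin n)}

theorem infix_pair_split {α : Type} {a b q : α} {U V : List α} (h : [a, b] <:+: U ++ q :: V) :
    [a, b] <:+: U ++ [q] ∨ [a, b] <:+: q :: V := by
  induction U with
  | nil => exact .inr h
  | cons u U ih =>
    rw [List.cons_append, List.infix_cons_iff] at h
    rcases h with h | h
    · left
      rw [List.cons_append, List.infix_cons_iff]
      left
      rw [List.cons_prefix_cons] at h ⊢
      refine ⟨h.1, ?_⟩
      cases U with
      | nil => simpa [List.cons_prefix_cons] using h.2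
      | cons u' U => simpa [List.cons_prefix_cons] using h.2
    · exact (ih h).imp_left fun h => List.infix_cons_iff.2 (.inr h)

theorem exists_sign_change {α : Type} (f : α → ℝ) {l : List α} {w : α} :
    ∀ {a : α}, f a < 0 → 0 ≤ f w → ∃ c d, [c, d] <:+: a :: (l ++ [w]) ∧ f c < 0 ∧ 0 ≤ f d := by
  induction l with
  | nil => exact fun {a} ha hw => ⟨a, w, List.infix_rfl, ha, hw⟩
  | cons b l ih =>
    intro a ha hw
    rcases lt_or_ge (f b) 0 with hb | hb
    · obtain ⟨c, d, h, h'⟩ := ih hb hw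
      exact ⟨c, d, List.infix_cons_iff.2 (.inr h), h'⟩
    · exact ⟨a, b, ⟨[], l ++ [w], by simp⟩, ha, hb⟩

/-- The funnel with apex `m`, chains `X` and `Y` (from the apex outwards, the apex excluded) and
chords `T`. -/
structure Funnel (P : Fin n → ℝ × ℝ) (π : Equiv.Perm (Fin n)) (m : Fin n) (X Y : List (Fin n))
    (T : List (Fin n × Fin n)) : Prop where
  stair : Stair P π X Y T
  decX : DecX P (m :: X)
  incX : IncX P (m :: Y)
  concX : ∀ a ∈ m :: X, ∀ b ∈ m :: X, ∀ c ∈ m :: X, (P a).1 < (P b).1 → (P b).1 < (P c).1 →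
    orient (P a) (P b) (P c) ≤ 0
  concY : ∀ a ∈ m :: Y, ∀ b ∈ m :: Y, ∀ c ∈ m :: Y, (P a).1 < (P b).1 → (P b).1 < (P c).1 →
    orient (P a) (P b) (P c) ≤ 0
  first : ∀ x ∈ X.head?, ∀ y ∈ Y.head?, orient (P x) (P y) (P m) < 0

variable {m : Fin n} {X Y : List (Fin n)} {T : List (Fin n × Fin n)}

theorem Funnel.mirror (h : Funnel P π m X Y T) :
    Funnel (fun i => mirrorPt (P i)) π m Y X (T.map Prod.swap) where
  stair := h.stair.mirror
  decX := h.incX.imp fun h => by simpa [mirror_fst] using h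
  incX := h.decX.imp fun h => by simpa [mirror_fst] using h
  concX a ha b hb c hc h1 h2 := by
    rw [orient_mirror, orient_rotate]
    simp only [mirror_fst] at h1 h2
    exact h.concY c hc b hb a ha (by linarith) (by linarith)
  concY a ha b hb c hc h1 h2 := by
    rw [orient_mirror, orient_rotate]
    simp only [mirror_fst] at h1 h2
    exact h.concX c hc b hb a ha (by linarith) (by linarith)
  first x hx y hy := by rw [orient_mirror]; exact h.first y hy x hx

theorem Funnel.lt_apex (h : Funnel P π m X Y T) : ∀ a ∈ X, (P a).1 < (P m).1 :=
  fun _ ha => List.rel_of_pairwise_cons h.decX ha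

theorem Funnel.apex_lt (h : Funnel P π m X Y T) : ∀ a ∈ Y, (P m).1 < (P a).1 :=
  fun _ ha => List.rel_of_pairwise_cons h.incX ha

/-- The vertices other than the ends of the base are below the base. -/
theorem Funnel.below_base (h : Funnel P π m X Y T) {p q : Fin n} (hp : p ∈ X.getLast?)
    (hq : q ∈ Y.getLast?) {z : Fin n} (hz : z ∈ m :: X ∨ z ∈ m :: Y) (hzp : z ≠ p) (hzq : z ≠ q) :
    orient (P p) (P q) (P z) < 0 := by
  by_cases hm : z = m
  · subst hm
    obtain ⟨hX, hY⟩ := h.stair.ne_nil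
    obtain ⟨x, hx⟩ := List.exists_mem_of_ne_nil X hX
    obtain ⟨x, X', rfl⟩ := List.exists_cons_of_ne_nil hX
    obtain ⟨y, Y', rfl⟩ := List.exists_cons_of_ne_nil hY
    exact ((h.stair.below_first h.decX.tail h.incX.tail h.lt_apex h.apex_lt x rfl y rfl (P z)
      (h.lt_apex x (by simp)).le (h.apex_lt y (by simp)).le).2 (h.first x rfl y rfl)).2 p hp q hq
  · refine h.stair.below_base h.decX.tail h.incX.tail h.lt_apex h.apex_lt p hp q hq z ?_ hzp hzq
    simpa [hm] using hz

/-! ### Segments, half-planes and visibility -/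

theorem segment_fst {a b z : ℝ × ℝ} (h : z ∈ segment ℝ a b) {c : ℝ} (ha : a.1 ≤ c) (hb : b.1 ≤ c) :
    z.1 ≤ c := by
  obtain ⟨s, t, hs, ht, hst, rfl⟩ := h
  simp only [Prod.fst_add, Prod.smul_fst, smul_eq_mul]
  calc s * a.1 + t * b.1 ≤ s * c + t * c := by gcongr
    _ = c := by rw [← add_mul, hst, one_mul]

theorem segment_fst' {a b z : ℝ × ℝ} (h : z ∈ segment ℝ a b) {c : ℝ} (ha : c ≤ a.1) (hb : c ≤ b.1) :
    c ≤ z.1 := by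
  obtain ⟨s, t, hs, ht, hst, rfl⟩ := h
  simp only [Prod.fst_add, Prod.smul_fst, smul_eq_mul]
  calc c = s * c + t * c := by rw [← add_mul, hst, one_mul]
    _ ≤ s * a.1 + t * b.1 := by gcongr

theorem eq_left_of_fst_le {a b z : ℝ × ℝ} (h : z ∈ segment ℝ a b) (hab : a.1 < b.1)
    (hz : z.1 ≤ a.1) : z = a := by
  obtain ⟨s, t, hs, ht, hst, rfl⟩ := h
  obtain rfl : s = 1 - t := by linarith
  simp only [Prod.fst_add, Prod.smul_fst, smul_eq_mul] at hz
  obtain rfl : t = 0 := by nlinarith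
  simp

theorem eq_right_of_le_fst {a b z : ℝ × ℝ} (h : z ∈ segment ℝ a b) (hab : a.1 < b.1)
    (hz : b.1 ≤ z.1) : z = b := by
  obtain ⟨s, t, hs, ht, hst, rfl⟩ := h
  obtain rfl : t = 1 - s := by linarith
  simp only [Prod.fst_add, Prod.smul_fst, smul_eq_mul] at hz
  obtain rfl : s = 0 := by nlinarith
  simp

/-- A segment below the line `pq`, with at most one end on the line, meets it at most there. -/
theorem eq_end_of_orient {p q a b z : ℝ × ℝ} (h : z ∈ segment ℝ a b) (hz : orient p q z = 0)
    (ha : orient p q a < 0) (hb : orient p q b ≤ 0) : z = b := by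
  obtain ⟨s, t, hs, ht, hst, rfl⟩ := h
  rw [orient_combo _ _ _ _ hst] at hz
  obtain rfl : s = 0 := by nlinarith
  obtain rfl : t = 1 := by linarith
  simp

theorem orient_of_mem_segment {a b z : ℝ × ℝ} (h : z ∈ segment ℝ a b) : orient a b z = 0 := by
  obtain ⟨s, t, hs, ht, hst, rfl⟩ := h
  rw [orient_combo _ _ _ _ hst, orient_self_left, orient_self_right]; ring

/-- A segment with ends in `S` meets the chord `qw` only in its ends, if the points of `S` other
than a single one are below the chord. -/
theorem mem_ends_of_below {q w z : ℝ × ℝ} {S : Set (Fin n)} {e a b : Fin n}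
    (hS : ∀ i ∈ S, i ≠ e → orient q w (P i) < 0) (he : P e = q ∨ P e = w) (ha : a ∈ S) (hb : b ∈ S)
    (hab : a ≠ b) (hz : z ∈ segment ℝ (P a) (P b)) (hz' : z ∈ segment ℝ q w) : z = q ∨ z = w := by
  have h0 := orient_of_mem_segment hz'
  have hle : orient q w (P e) ≤ 0 := by
    rcases he with h | h <;> rw [h]
    exacts [(orient_self_left _ _).le, (orient_self_right _ _).le]
  by_cases hae : a = e
  · subst hae
    rw [segment_symm] at hz
    rw [eq_end_of_orient hz h0 (hS b hb hab.symm) hle]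
    exact he
  · by_cases hbe : b = e
    · subst hbe
      rw [eq_end_of_orient hz h0 (hS a ha hae) hle]
      exact he
    · have h1 := hS a ha hae
      rw [eq_end_of_orient hz h0 h1 (hS b hb hbe).le] at h0
      exact absurd h0 (hS b hb hbe).ne

theorem infix_pair_ne {l : List (Fin n)} (h : l.Nodup) {a b : Fin n} (hi : [a, b] <:+: l) :
    a ≠ b := by
  have := hi.sublist.nodup h
  simpa using this

theorem IncX.lt_getLast {l : List (Fin n)} (h : IncX P l) {e r : Fin n} (he : e ∈ l.getLast?)
    (hr : r ∈ l) (hne : r ≠ e) : (P r).1 < (P e).1 := by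
  obtain ⟨l', rfl⟩ := List.getLast?_eq_some_iff.1 he
  rcases List.mem_append.1 hr with hr | hr
  · exact (List.pairwise_append.1 h).2.2 r hr e (by simp)
  · simp_all

theorem IncX.nodup {l : List (Fin n)} (h : IncX P l) : l.Nodup :=
  List.Pairwise.imp (fun hab e => by rw [e] at hab; exact lt_irrefl _ hab) h

theorem DecX.nodup {l : List (Fin n)} (h : DecX P l) : l.Nodup :=
  List.Pairwise.imp (fun hab e => by rw [e] at hab; exact lt_irrefl _ hab) h

/-- Visibility is invariant under linear bijections of the plane. -/
theorem visible_map (M : (ℝ × ℝ) ≃ₗ[ℝ] ℝ × ℝ) {L R : List (Fin n)} {p q : Fin n} :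
    Visible (fun i => M (P i)) L R p q ↔ Visible P L R p q := by
  have hseg : ∀ a b z, M z ∈ segment ℝ (M a) (M b) ↔ z ∈ segment ℝ a b := fun a b z => by
    have := image_segment ℝ M.toLinearMap.toAffineMap a b
    simp only [LinearMap.coe_toAffineMap, LinearEquiv.coe_coe] at this
    rw [← this]
    exact M.injective.mem_set_image
  have hbd : ∀ z, M z ∈ boundary (fun i => M (P i)) L R ↔ z ∈ boundary P L R := by
    intro z
    simp only [boundary, chainSet, Set.mem_union, Set.mem_ofPred_eq, hseg]
  constructor
  · rintro h z ⟨hz, hz'⟩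
    simpa using h ⟨(hseg _ _ z).2 hz, (hbd z).2 hz'⟩
  · rintro h z ⟨hz, hz'⟩
    obtain ⟨z, rfl⟩ := M.surjective z
    simpa using h ⟨(hseg _ _ z).1 hz, (hbd z).1 hz'⟩

theorem chainSet_reverse (l : List (Fin n)) : chainSet P l.reverse = chainSet P l := by
  have hrev : ∀ (a b : Fin n), [a, b] <:+: l.reverse ↔ [b, a] <:+: l := fun a b => by
    rw [← List.reverse_infix]; simp
  ext z
  simp only [chainSet, Set.mem_ofPred_eq, hrev]
  constructor <;>
  · rintro ⟨a, b, h, h'⟩; exact ⟨b, a, h, by rwa [segment_symm]⟩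

theorem boundary_reverse (L R : List (Fin n)) :
    boundary P R.reverse L.reverse = boundary P L R := by
  simp only [boundary, chainSet_reverse, List.head?_reverse, List.getLast?_reverse]
  rw [Set.union_comm (chainSet P R)]
  congr 1
  ext z
  constructor <;>
  · rintro ⟨a, ha, b, hb, h⟩; exact ⟨b, hb, a, ha, by rwa [segment_symm]⟩

theorem visible_mirror {L R : List (Fin n)} {p q : Fin n} :
    Visible (fun i => mirrorPt (P i)) R.reverse L.reverse p q ↔ Visible P L R p q := by
  have := visible_map (P := P) (L := R.reverse) (R := L.reverse) (p := p) (q := q)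
    ((LinearEquiv.neg ℝ).prodCongr (LinearEquiv.refl ℝ ℝ))
  rw [Visible, Visible, boundary_reverse (P := P)] at this
  exact this

/-- A chord that separates a vertex of the left chain of least priority from those farther from
the apex, with the two funnels below and above it. -/
theorem Funnel.split (h : Funnel P π m X Y T) {A B : List (Fin n)} {q b : Fin n}
    (hX : X = A ++ q :: b :: B) (hπ : ∀ y ∈ Y.dropLast, π q < π y) :
    ∃ C w D T₁ T₂, Y = C ++ w :: D ∧ T = T₁ ++ (q, w) :: T₂ ∧
      Funnel P π m (A ++ [q]) (C ++ [w]) T₁ ∧ Funnel P π q (b :: B) (w :: D) T₂ ∧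
      Visible P (m :: X).reverse (m :: Y) q w ∧
      ∀ r ∈ D, ¬ Visible P (m :: X).reverse (m :: Y) q r := by
  obtain ⟨C, w, D, T₁, T₂, hY, hT, s1, s2, ho, hd⟩ := h.stair.split hX hπ
  subst hX hY
  have decX := h.decX
  have incX := h.incX
  have hqm : (P q).1 < (P m).1 := h.lt_apex q (by simp)
  have hmw : (P m).1 < (P w).1 := h.apex_lt w (by simp)
  have hqw := hqm.trans hmw
  have hwD : ∀ r ∈ D, (P w).1 < (P r).1 := fun r hr =>
    (List.pairwise_cons.1 (List.pairwise_append.1 incX.tail).2.1).1 r hr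
  -- The vertex after `w` is not above the line `qw`; by concavity of the right chain neither are
  -- the later ones.
  have htan : ∀ r ∈ D, orient (P q) (P w) (P r) ≤ 0 := by
    cases D with
    | nil => simp
    | cons d D =>
      have hwd := hwD d (by simp)
      intro r hr
      rcases List.mem_cons.1 hr with rfl | hr'
      · exact hd r rfl
      · have hdr : (P d).1 < (P r).1 :=
          (List.pairwise_cons.1 (List.pairwise_cons.1 (List.pairwise_append.1 incX.tail).2.1).2).1 r hr'
        exact orient_trans_left hqw hwd hdr (hd d rfl)
          (h.concY w (by simp) d (by simp) r (by simp [hr']) hwd hdr)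
  have F1 : Funnel P π m (A ++ [q]) (C ++ [w]) T₁ := by
    have hsX : (A ++ [q]).Sublist (A ++ q :: b :: B) :=
      List.Sublist.append_left (by simp) _
    have hsY : (C ++ [w]).Sublist (C ++ w :: D) := List.Sublist.append_left (by simp) _
    have hsX' : ∀ a ∈ m :: (A ++ [q]), a ∈ m :: (A ++ q :: b :: B) :=
      fun a ha => (hsX.cons_cons m).subset ha
    have hsY' : ∀ a ∈ m :: (C ++ [w]), a ∈ m :: (C ++ w :: D) :=
      fun a ha => (hsY.cons_cons m).subset ha
    refine ⟨s1, decX.sublist (hsX.cons_cons m), incX.sublist (hsY.cons_cons m),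
      fun a ha b hb c hc => h.concX a (hsX' a ha) b (hsX' b hb) c (hsX' c hc),
      fun a ha b hb c hc => h.concY a (hsY' a ha) b (hsY' b hb) c (hsY' c hc),
      fun x hx y hy => h.first x ?_ y ?_⟩
    · cases A <;> simpa using hx
    · cases C <;> simpa using hy
  -- The upper funnel has apex `q`, and its right chain begins with the chord `qw`. Concavity of the
  -- lengthened chain at `w` is the tangency `htan`, and the chord `bw` passes above `q` because `b`
  -- is above `qw`.
  have F2 : Funnel P π q (b :: B) (w :: D) T₂ := by
    refine ⟨s2, (List.pairwise_append.1 decX.tail).2.1, ?_, fun a ha b' hb c hc =>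
      h.concX a (by simp_all) b' (by simp_all) c (by simp_all), ?_, ?_⟩
    · refine List.pairwise_cons.2 ⟨fun r hr => ?_, (List.pairwise_append.1 incX.tail).2.1⟩
      exact hqm.trans (h.apex_lt r (by simp_all))
    · have hlow : ∀ r ∈ w :: D, (P q).1 < (P r).1 := fun r hr =>
        hqm.trans (h.apex_lt r (by simp_all))
      have hlow' : ∀ r ∈ w :: D, (P w).1 ≤ (P r).1 := fun r hr => by
        rcases List.mem_cons.1 hr with rfl | hr
        exacts [le_rfl, (hwD r hr).le]
      intro a ha b' hb c hc hab hbc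
      have hb' : b' ∈ w :: D := by
        rcases List.mem_cons.1 hb with rfl | hb
        · rcases List.mem_cons.1 ha with rfl | ha
          · exact absurd hab (lt_irrefl _)
          · exact absurd hab (hlow a ha).le.not_gt
        · exact hb
      have hc' : c ∈ D := by
        rcases List.mem_cons.1 hc with rfl | hc
        · exact absurd hbc (hlow b' hb').le.not_gt
        · rcases List.mem_cons.1 hc with rfl | hc
          · exact absurd hbc (hlow' b' hb').not_gt
          · exact hc
      rcases List.mem_cons.1 ha with rfl | ha
      · rcases List.mem_cons.1 hb' with rfl | hb''
        · exact htan c hc'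
        · exact orient_trans_right hqw (hwD b' hb'') hbc (htan b' hb'')
            (h.concY w (by simp) b' (by simp [hb'']) c (by simp [hc']) (hwD b' hb'') hbc)
      · exact h.concY a (by simp_all) b' (by simp_all) c (by simp_all) hab hbc
    · rintro x hx y hy
      obtain rfl := Option.some.inj hx
      obtain rfl := Option.some.inj hy
      have : orient (P b) (P w) (P q) = -orient (P q) (P w) (P b) := by simp only [orient]; ring
      linarith
  obtain ⟨p, hp⟩ : ∃ p, p ∈ (b :: B).getLast? := ⟨_, List.getLast?_eq_getLast_of_ne_nil (by simp)⟩
  obtain ⟨e, he⟩ : ∃ e, e ∈ (w :: D).getLast? := ⟨_, List.getLast?_eq_getLast_of_ne_nil (by simp)⟩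
  have hp' : p ∈ (A ++ q :: b :: B).getLast? := by
    rw [List.getLast?_append_cons, List.getLast?_cons_cons]; exact hp
  have he' : e ∈ (C ++ w :: D).getLast? := by rw [List.getLast?_append_cons]; exact he
  have hpB : p ∈ b :: B := List.mem_of_mem_getLast? hp
  have heD : e ∈ w :: D := List.mem_of_mem_getLast? he
  have hpq : (P p).1 < (P q).1 :=
    (List.pairwise_cons.1 (List.pairwise_append.1 decX.tail).2.1).1 p hpB
  have hme : (P m).1 < (P e).1 := h.apex_lt e (List.mem_append_right _ heD)
  have hq0 : orient (P p) (P e) (P q) < 0 := h.below_base hp' he' (.inl (by simp))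
    (fun h => by rw [h] at hpq; exact lt_irrefl _ hpq)
    (fun h => by rw [h] at hqm; exact lt_irrefl _ (hqm.trans hme))
  have hw0 : w ≠ e → orient (P p) (P e) (P w) < 0 := h.below_base hp' he' (.inr (by simp))
    (fun h => by rw [h] at hqw; exact lt_irrefl _ (hqw.trans hpq))
  refine ⟨C, w, D, T₁, T₂, rfl, hT, F1, F2, ?_, ?_⟩
  · rintro z ⟨hz, hzb⟩
    rw [Set.mem_insert_iff, Set.mem_singleton_iff]
    rcases hzb with (⟨a, c, hi, hz'⟩ | ⟨a, c, hi, hz'⟩) | ⟨a, ha, c, hc, hz'⟩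
    · have hrev : (m :: (A ++ q :: b :: B)).reverse = (b :: B).reverse ++ q :: (A.reverse ++ [m]) := by
        simp
      rw [hrev] at hi
      rcases infix_pair_split hi with hi | hi
      -- Beyond `q` the left chain lies weakly to the left of `q`, whereas the segment `qw` starts
      -- there and goes right.
      · left
        have hmem : ∀ i ∈ (b :: B).reverse ++ [q], (P i).1 ≤ (P q).1 := fun i hi => by
          rcases List.mem_append.1 hi with hi | hi
          · exact ((List.pairwise_cons.1 (List.pairwise_append.1 decX.tail).2.1).1 i
              (List.mem_reverse.1 hi)).le
          · rw [List.mem_singleton.1 hi]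
        exact eq_left_of_fst_le hz hqw
          (segment_fst hz' (hmem a (hi.subset (by simp))) (hmem c (hi.subset (by simp))))
      -- Between `q` and the apex, the left chain belongs to the lower funnel, whose base is `qw`;
      -- apart from `q` its vertices are strictly below this base.
      · have hmem : ∀ i ∈ q :: (A.reverse ++ [m]), i ∈ m :: (A ++ [q]) := fun i hi => by
          simp only [List.mem_cons, List.mem_append, List.mem_reverse] at hi ⊢; tauto
        refine mem_ends_of_below (P := P) (S := {i | i ∈ m :: (A ++ [q])}) (e := q)
          (fun i hi hne => F1.below_base (by simp) (by simp) (.inl hi) hne ?_) (.inl rfl)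
          (hmem a (hi.subset (by simp))) (hmem c (hi.subset (by simp))) ?_ hz' hz
        · rintro rfl
          rcases List.mem_cons.1 hi with rfl | hi
          · exact lt_irrefl _ hmw
          · exact lt_irrefl _ (hmw.trans (F1.lt_apex _ hi))
        · refine infix_pair_ne ?_ hi
          have := List.nodup_reverse.2 F1.decX.nodup
          rwa [show (m :: (A ++ [q])).reverse = q :: (A.reverse ++ [m]) by simp] at this
    · rw [show m :: (C ++ w :: D) = (m :: C) ++ w :: D by simp] at hi
      rcases infix_pair_split hi with hi | hi
      · have hmem : ∀ i ∈ (m :: C) ++ [w], i ∈ m :: (C ++ [w]) := fun i hi => by simpa using hi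
        refine mem_ends_of_below (P := P) (S := {i | i ∈ m :: (C ++ [w])}) (e := w)
          (fun i hi hne => F1.below_base (by simp) (by simp) (.inr hi) ?_ hne) (.inr rfl)
          (hmem a (hi.subset (by simp))) (hmem c (hi.subset (by simp))) ?_ hz' hz
        · rintro rfl
          rcases List.mem_cons.1 hi with rfl | hi
          · exact lt_irrefl _ hqm
          · exact lt_irrefl _ (hqm.trans (F1.apex_lt _ hi))
        · exact infix_pair_ne (by simpa using F1.incX.nodup) hi
      · right
        have hmem : ∀ i ∈ w :: D, (P w).1 ≤ (P i).1 := fun i hi => by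
          rcases List.mem_cons.1 hi with rfl | hi
          exacts [le_rfl, (hwD i hi).le]
        exact eq_right_of_le_fst hz hqw
          (segment_fst' hz' (hmem a (hi.subset (by simp))) (hmem c (hi.subset (by simp))))
    -- The base can be met only in `w`, because `q` is strictly below it and `w` is not above it.
    · right
      have hap : a = p := by
        rw [List.head?_reverse, ← List.singleton_append, List.getLast?_append_of_ne_nil _ (by simp)]
          at ha
        exact Option.mem_unique ha hp'
      have hce : c = e := by
        rw [← List.singleton_append, List.getLast?_append_of_ne_nil _ (by simp)] at hc
        exact Option.mem_unique hc he'
      subst hap hce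
      refine eq_end_of_orient hz (orient_of_mem_segment hz') hq0 ?_
      by_cases hw : w = c
      · rw [hw, orient_self_right]
      · exact (hw0 hw).le
  -- For `r` beyond the point of tangency, the apex is strictly below the segment `qr` and `w` is
  -- not, so some edge of the right chain between them crosses the segment away from its ends.
  · intro r hr hv
    have hwr := hwD r hr
    have hrD : r ∈ w :: D := List.mem_cons_of_mem _ hr
    have incD : IncX P (w :: D) := (List.pairwise_append.1 incX.tail).2.1
    have hre : r = e ∨ (P r).1 < (P e).1 := or_iff_not_imp_left.2 (incD.lt_getLast he hrD)
    have hwe : w ≠ e := by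
      rintro rfl
      rcases hre with rfl | hre
      exacts [lt_irrefl _ hwr, lt_irrefl _ (hwr.trans hre)]
    have hneg : orient (P q) (P r) (P m) < 0 := by
      refine orient_apex_neg hpq hqm hmw hwr (hre.imp (fun h => by rw [h]) fun h' => ⟨h', ?_⟩) hq0
        (hw0 hwe) (h.concX p ?_ q (by simp) m (by simp) hpq hqm) (htan r hr)
      · exact h.concY w (by simp) r (by simp [hr]) e
          (List.mem_cons_of_mem _ (List.mem_append_right _ heD)) hwr h'
      · exact List.mem_cons_of_mem _ (List.mem_append_right _ (List.mem_cons_of_mem _ hpB))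
    obtain ⟨c, d, hi, hc, hd⟩ := exists_sign_change (fun i => orient (P q) (P r) (P i)) (l := C)
      (a := m) (w := w) hneg (by
        have := htan r hr
        rw [orient_swap_right] at this
        linarith)
    have hmc : ∀ i ∈ m :: (C ++ [w]), (P m).1 ≤ (P i).1 := fun i hi => by
      rcases List.mem_cons.1 hi with rfl | hi
      exacts [le_rfl, (F1.apex_lt i hi).le]
    have hcd : (P c).1 < (P d).1 := by
      have := F1.incX.sublist hi.sublist
      simpa using this
    have hdw : (P d).1 ≤ (P w).1 := by
      by_cases h : d = w
      · rw [h]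
      · exact (F1.incX.lt_getLast (e := w) (by
          rw [← List.cons_append, List.getLast?_append_cons]; rfl) (hi.subset (by simp)) h).le
    obtain ⟨z, hz1, hz2, hzq, hzr⟩ := exists_crossing (q := P q) (r := P r) (a := P c) (b := P d)
      (hqm.trans_le (hmc c (hi.subset (by simp)))) hcd (hdw.trans_lt hwr) hc hd
    have := hv ⟨hz2, .inl (.inr ⟨c, d, hi.trans ⟨[], D, by simp⟩, hz1⟩)⟩
    rcases this with h | h
    exacts [hzq h, hzr h]

theorem nonCorners_eq (m : Fin n) {X : List (Fin n)} (hX : X ≠ []) (Y : List (Fin n)) :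
    nonCorners (m :: X).reverse (m :: Y) = X.dropLast.reverse ++ Y.dropLast := by
  obtain ⟨X', p, rfl⟩ := (List.eq_nil_or_concat' X).resolve_left hX
  simp [nonCorners]

theorem exists_split_of_mem_dropLast {α : Type} {l : List α} {q : α} (h : q ∈ l.dropLast) :
    ∃ A b B, l = A ++ q :: b :: B := by
  obtain ⟨A, A', hA⟩ := List.append_of_mem h
  have hl : l ≠ [] := by rintro rfl; simp at h
  refine ⟨A, (A' ++ [l.getLast hl]).head (by simp), (A' ++ [l.getLast hl]).tail, ?_⟩
  rw [List.cons_head_tail]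
  conv_lhs => rw [← List.dropLast_append_getLast hl, hA]
  simp

/-- The chords found by merging the chains triangulate the funnel. -/
theorem Funnel.chords (h : Funnel P π m X Y T) :
    Chords P π (m :: X).reverse (m :: Y) (T : Multiset (Fin n × Fin n)) := by
  -- The points are generalized too, because a vertex `q` on the right chain is treated by passing
  -- to the mirror image.
  induction hk : T.length using Nat.strong_induction_on generalizing P m X Y T with
  | _ k ih =>
  obtain ⟨hX, hY⟩ := h.stair.ne_nil
  have hlen := h.stair.length
  by_cases hN : nonCorners (m :: X).reverse (m :: Y) = []
  · have hN' := hN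
    rw [nonCorners_eq m hX] at hN'
    have : T = [] := by
      have := congrArg List.length hN'
      simp at this
      rw [← List.length_eq_zero_iff]
      omega
    subst this
    exact .done hN
  obtain ⟨q, hq, hmin⟩ : ∃ q ∈ nonCorners (m :: X).reverse (m :: Y),
      ∀ r ∈ nonCorners (m :: X).reverse (m :: Y), π q ≤ π r := by
    obtain ⟨q, hq, h⟩ := Finset.exists_min_image (nonCorners (m :: X).reverse (m :: Y)).toFinset π
      (by rwa [List.toFinset_nonempty_iff])
    exact ⟨q, by simpa using hq, by simpa using h⟩
  have hq' := hq
  have hmin' := hmin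
  rw [nonCorners_eq m hX] at hq' hmin'
  rcases List.mem_append.1 hq' with hq' | hq'
  · obtain ⟨A, b, B, hXe⟩ := exists_split_of_mem_dropLast (List.mem_reverse.1 hq')
    obtain ⟨C, w, D, T₁, T₂, hYe, hT, F1, F2, hv, hnv⟩ := h.split hXe fun y hy =>
      lt_of_le_of_ne (hmin' y (by simp [hy])) fun he => by
        have h1 := h.lt_apex q (List.mem_of_mem_dropLast (List.mem_reverse.1 hq'))
        have h2 := h.apex_lt y (List.mem_of_mem_dropLast hy)
        rw [π.injective he] at h1
        exact lt_irrefl _ (h1.trans h2)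
    have c1 := ih _ (by rw [← hk, hT]; simp) F1 rfl
    have c2 := ih _ (by rw [← hk, hT]; simp; omega) F2 rfl
    have eL : (m :: X).reverse = (b :: B).reverse ++ q :: (A.reverse ++ [m]) := by simp [hXe]
    have eR : m :: Y = (m :: C) ++ w :: D := by simp [hYe]
    have eT : (T : Multiset (Fin n × Fin n)) = (q, w) ::ₘ ((T₂ : Multiset _) + (T₁ : Multiset _)) := by
      rw [hT, Multiset.coe_add, Multiset.cons_coe, Multiset.coe_eq_coe]
      exact List.perm_middle.trans (List.Perm.cons _ List.perm_append_comm)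
    rw [eL, eR] at hv hnv hmin ⊢
    rw [eT]
    refine .left (by simp) (by simp) hmin hv hnv ?_ ?_
    · simpa using c2
    · simpa using c1
  -- The funnel is split in the mirror image; reflecting the two parts once more gives funnels of
  -- the original points, to which the induction hypothesis applies.
  · have hmm : (fun i => mirrorPt ((fun i => mirrorPt (P i)) i)) = P := by
      funext i; simp [mirrorPt]
    obtain ⟨A, b, B, hYe⟩ := exists_split_of_mem_dropLast hq'
    obtain ⟨C, w, D, T₁, T₂, hXe, hT, F1, F2, hv, hnv⟩ := h.mirror.split hYe fun y hy =>
      lt_of_le_of_ne (hmin' y (by simp [hy])) fun he => by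
        have h1 := h.apex_lt q (List.mem_of_mem_dropLast hq')
        have h2 := h.lt_apex y (List.mem_of_mem_dropLast hy)
        rw [π.injective he] at h1
        exact lt_irrefl _ (h1.trans h2)
    replace F1 := F1.mirror
    replace F2 := F2.mirror
    rw [hmm] at F1 F2
    have hTl := congrArg List.length hT
    have c1 := ih _ (by simp at hTl; simp; omega) F1 rfl
    have c2 := ih _ (by simp at hTl; simp; omega) F2 rfl
    have hv' : ∀ r, Visible (fun i => mirrorPt (P i)) (m :: Y).reverse (m :: X) q r ↔
        Visible P (m :: X).reverse (m :: Y) q r := fun r => by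
      have := visible_mirror (P := P) (L := (m :: X).reverse) (R := m :: Y) (p := q) (q := r)
      rwa [List.reverse_reverse] at this
    simp only [hv'] at hv hnv
    have eL : (m :: X).reverse = D.reverse ++ w :: (C.reverse ++ [m]) := by simp [hXe]
    have eR : m :: Y = (m :: A) ++ q :: b :: B := by simp [hYe]
    have eT : (T : Multiset (Fin n × Fin n)) =
        (w, q) ::ₘ (Multiset.ofList (T₂.map Prod.swap) + Multiset.ofList (T₁.map Prod.swap)) := by
      have : T = T₁.map Prod.swap ++ (w, q) :: T₂.map Prod.swap := by
        have := congrArg (List.map Prod.swap) hT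
        simpa using this
      rw [this, Multiset.coe_add, Multiset.cons_coe, Multiset.coe_eq_coe]
      exact List.perm_middle.trans (List.Perm.cons _ List.perm_append_comm)
    rw [eL, eR] at hv hnv hmin ⊢
    rw [eT]
    refine .right (by simp) (by simp) hmin hv (fun r hr => hnv r (List.mem_reverse.1 hr)) ?_ ?_
    · simpa using c2
    · simpa using c1

end PseudoTri

/-! ### Merging two upper hulls -/

namespace PseudoTri

variable {n : ℕ} {P : Fin n → ℝ × ℝ} {π : Equiv.Perm (Fin n)}

/-- `b` is a vertex of the upper hull of `S`. -/
def OnHull (P : Fin n → ℝ × ℝ) (S : Set (Fin n)) (b : Fin n) : Prop :=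
  b ∈ S ∧ ∀ a ∈ S, ∀ c ∈ S, LtX P a b → LtX P b c → 0 ≤ orient (P a) (P c) (P b)

theorem mem_upperHull {Q : Set (APt n)} {b : Fin n} :
    APt.pt b ∈ upperHull P Q ↔ OnHull P {i | APt.pt i ∈ Q} b :=
  ⟨fun h => ⟨h.1, fun a ha c hc => h.2 a b c rfl ha hc⟩,
    fun h => ⟨h.1, fun a b' c hb ha hc => by cases hb; exact h.2 a ha c hc⟩⟩

theorem OnHull.mono {S S' : Set (Fin n)} {b : Fin n} (h : OnHull P S' b) (hs : S ⊆ S')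
    (hb : b ∈ S) : OnHull P S b :=
  ⟨hb, fun a ha c hc => h.2 a (hs ha) c (hs hc)⟩

theorem ltX_iff (hx : Function.Injective fun i => (P i).1) {i j : Fin n} : LtX P i j ↔ (P i).1 < (P j).1 := by
  refine ⟨fun h => h.resolve_right fun h' => ?_, .inl⟩
  rw [hx h'.1] at h'
  exact lt_irrefl _ h'.2

/-- A point of greatest height above the line `pe` cannot be strictly below a chord of `S`, since
the height on a chord is at most that of one of its ends. -/
theorem onHull_of_max (hx : Function.Injective fun i => (P i).1) {S : Set (Fin n)} {p e z : Fin n} (hpe : (P p).1 < (P e).1) (hz : z ∈ S)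
    (hmax : ∀ s ∈ S, orient (P p) (P e) (P s) ≤ orient (P p) (P e) (P z)) : OnHull P S z := by
  refine ⟨hz, fun a ha c hc h1 h2 => ?_⟩
  rw [ltX_iff hx] at h1 h2
  have key := orient_heights (P p) (P e) (P a) (P c) (P z)
  by_contra hcon
  push Not at hcon
  nlinarith [mul_pos (sub_pos.2 hpe) (neg_pos.2 hcon),
    mul_nonneg (sub_pos.2 h1).le (sub_nonneg.2 (hmax c hc)),
    mul_nonneg (sub_pos.2 h2).le (sub_nonneg.2 (hmax a ha))]

/-- The hull vertices determine on which side of a line the points are. -/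
theorem orient_le_of_onHull (hx : Function.Injective fun i => (P i).1) {S : Set (Fin n)} {p e : Fin n} (hpe : (P p).1 < (P e).1)
    (h : ∀ b, OnHull P S b → orient (P p) (P e) (P b) ≤ 0) :
    ∀ z ∈ S, orient (P p) (P e) (P z) ≤ 0 := by
  intro z hz
  obtain ⟨w, hw, hmax⟩ := Set.exists_max_image S (fun i => orient (P p) (P e) (P i)) S.toFinite
    ⟨z, hz⟩
  exact (hmax z hz).trans (h w (onHull_of_max hx hpe hw hmax))

theorem OnHull.orient_le (hx : Function.Injective fun i => (P i).1) {S : Set (Fin n)} {a b c : Fin n} (h : OnHull P S b) (ha : a ∈ S)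
    (hc : c ∈ S) (h1 : (P a).1 < (P b).1) (h2 : (P b).1 < (P c).1) :
    orient (P a) (P b) (P c) ≤ 0 := by
  have := h.2 a ha c hc ((ltX_iff hx).2 h1) ((ltX_iff hx).2 h2)
  rw [orient_swap_right] at this
  linarith

/-- Only a chord `ac` that ends to the right of the apex needs an argument. It passes no higher than
the common hull vertex `p`, hence over `b` no higher than the chord `ap`, and `b` is not below that
one, being on the hull of the left part. -/
theorem onHull_left (hx : Function.Injective fun i => (P i).1) {SL SR : Set (Fin n)} {m p b : Fin n}
    (hL : ∀ z ∈ SL, z = m ∨ (P z).1 < (P m).1) (hR : ∀ z ∈ SR, z = m ∨ (P m).1 < (P z).1)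
    (hm : m ∈ SL) (hp : p ∈ SL) (hpH : OnHull P (SL ∪ SR) p) (hb : OnHull P SL b)
    (hbp : (P b).1 < (P p).1) : OnHull P (SL ∪ SR) b := by
  have hpm : (P p).1 ≤ (P m).1 := by rcases hL p hp with rfl | h; exacts [le_rfl, h.le]
  refine ⟨.inl hb.1, fun a ha c hc h1 h2 => ?_⟩
  have h1' := (ltX_iff hx).1 h1
  have h2' := (ltX_iff hx).1 h2
  have ha' : a ∈ SL := by
    rcases ha with ha | ha
    · exact ha
    · rcases hR a ha with rfl | h
      · exact hm
      · linarith
  by_cases hc' : c ∈ SL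
  · exact hb.2 a ha' c hc' h1 h2
  have hmc : (P m).1 < (P c).1 := by
    rcases hR c (hc.resolve_left hc') with rfl | h
    · exact absurd hm hc'
    · exact h
  have e1 := hb.2 a ha' p hp h1 ((ltX_iff hx).2 hbp)
  have e2 := hpH.orient_le hx ha hc (h1'.trans hbp) (hpm.trans_lt hmc)
  have key := orient_heights (P a) (P p) (P a) (P c) (P b)
  rw [orient_self_left] at key
  by_contra hcon
  push Not at hcon
  nlinarith [mul_pos (sub_pos.2 (h1'.trans hbp)) (neg_pos.2 hcon),
    mul_nonneg (sub_pos.2 (h1'.trans h2')).le e1, mul_nonneg (sub_pos.2 h1').le (neg_nonneg.2 e2)]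

theorem OnHull.mirror (hx : Function.Injective fun i => (P i).1) {S : Set (Fin n)} {b : Fin n} (h : OnHull P S b) :
    OnHull (fun i => mirrorPt (P i)) S b := by
  have hx' : Function.Injective fun i => (mirrorPt (P i)).1 := fun i j h => hx (neg_injective h)
  refine ⟨h.1, fun a ha c hc h1 h2 => ?_⟩
  rw [ltX_iff hx', mirror_fst, mirror_fst, neg_lt_neg_iff] at h1 h2
  rw [orient_mirror]
  exact h.2 c hc a ha ((ltX_iff hx).2 h2) ((ltX_iff hx).2 h1)

theorem onHull_mirror (hx : Function.Injective fun i => (P i).1) {S : Set (Fin n)} {b : Fin n} :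
    OnHull (fun i => mirrorPt (P i)) S b ↔ OnHull P S b := by
  refine ⟨fun h => ?_, OnHull.mirror hx⟩
  have := OnHull.mirror (fun i j h => hx (neg_injective h)) h
  rwa [show (fun i => mirrorPt (mirrorPt (P i))) = P by funext i; simp [mirrorPt]] at this

theorem onHull_right (hx : Function.Injective fun i => (P i).1) {SL SR : Set (Fin n)} {m q b : Fin n}
    (hL : ∀ z ∈ SL, z = m ∨ (P z).1 < (P m).1) (hR : ∀ z ∈ SR, z = m ∨ (P m).1 < (P z).1)
    (hm : m ∈ SR) (hq : q ∈ SR) (hqH : OnHull P (SL ∪ SR) q) (hb : OnHull P SR b)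
    (hbq : (P q).1 < (P b).1) : OnHull P (SL ∪ SR) b := by
  rw [← onHull_mirror hx, Set.union_comm] at hqH ⊢
  exact onHull_left (P := fun i => mirrorPt (P i)) (fun i j h => hx (neg_injective h))
    (fun z hz => (hR z hz).imp_right neg_lt_neg) (fun z hz => (hL z hz).imp_right neg_lt_neg) hm hq
    hqH (hb.mirror hx) (neg_lt_neg hbq)

/-! ### The hulls on the two sides of an apex -/

/-- `XA` and `YA` list, from `m` outwards and excluding `m`, the vertices of the upper hulls of the
point sets `SL` to the left and `SR` to the right of `m`. -/
structure HullPair (P : Fin n → ℝ × ℝ) (SL SR : Set (Fin n)) (m : Fin n) (XA YA : List (Fin n)) :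
    Prop where
  leftOf : ∀ z ∈ SL, z = m ∨ (P z).1 < (P m).1
  rightOf : ∀ z ∈ SR, z = m ∨ (P m).1 < (P z).1
  decX : DecX P (m :: XA)
  incX : IncX P (m :: YA)
  memX : ∀ b, b ∈ m :: XA ↔ OnHull P SL b
  memY : ∀ b, b ∈ m :: YA ↔ OnHull P SR b

variable {SL SR : Set (Fin n)} {m : Fin n} {XA YA : List (Fin n)}

theorem HullPair.mem_left (h : HullPair P SL SR m XA YA) : m ∈ SL := ((h.memX m).1 (by simp)).1

theorem HullPair.mem_right (h : HullPair P SL SR m XA YA) : m ∈ SR := ((h.memY m).1 (by simp)).1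

theorem HullPair.mirror (hx : Function.Injective fun i => (P i).1) (h : HullPair P SL SR m XA YA) :
    HullPair (fun i => mirrorPt (P i)) SR SL m YA XA where
  leftOf z hz := (h.rightOf z hz).imp_right neg_lt_neg
  rightOf z hz := (h.leftOf z hz).imp_right neg_lt_neg
  decX := h.incX.imp neg_lt_neg
  incX := h.decX.imp neg_lt_neg
  memX b := by rw [onHull_mirror hx]; exact h.memY b
  memY b := by rw [onHull_mirror hx]; exact h.memX b

/-- The line through the hull edge at `m` bounds all points of the left part from above. There is
such an edge because the leftmost point is a hull vertex: it would be `m` if the list were empty. -/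
theorem HullPair.head_left (hx : Function.Injective fun i => (P i).1)
    (h : HullPair P SL SR m XA YA) {a : Fin n} (ha : a ∈ SL) (ham : (P a).1 < (P m).1) :
    ∃ u ∈ XA.head?, (P u).1 < (P m).1 ∧ orient (P u) (P m) (P a) ≤ 0 := by
  cases XA with
  | nil =>
    obtain ⟨w, hw, hmin⟩ := Set.exists_min_image SL (fun i => (P i).1) SL.toFinite ⟨a, ha⟩
    have : w ∈ [m] := (h.memX w).2 ⟨hw, fun a ha c _ h1 _ =>
      absurd ((ltX_iff hx).1 h1) (hmin a ha).not_gt⟩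
    rw [List.mem_singleton.1 this] at hmin
    exact absurd ham (hmin a ha).not_gt
  | cons u XA =>
    have hum : (P u).1 < (P m).1 := List.rel_of_pairwise_cons h.decX (by simp)
    refine ⟨u, rfl, hum, orient_le_of_onHull hx hum (fun b hb => ?_) a ha⟩
    rcases List.mem_cons.1 ((h.memX b).2 hb) with rfl | hb'
    · rw [orient_self_right]
    · rcases List.mem_cons.1 hb' with rfl | hb''
      · rw [orient_self_left]
      · rw [orient_rotate]
        exact ((h.memX u).1 (by simp)).orient_le hx hb.1 h.mem_left
          (List.rel_of_pairwise_cons h.decX.tail hb'') hum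

/-- If the apex is locally convex, it is on the common hull, which is the union of the hulls. -/
theorem HullPair.apex_onHull (hx : Function.Injective fun i => (P i).1)
    (h : HullPair P SL SR m XA YA)
    (hf : ∀ u ∈ XA.head?, ∀ v ∈ YA.head?, 0 ≤ orient (P u) (P v) (P m)) :
    OnHull P (SL ∪ SR) m ∧ ∀ b, OnHull P (SL ∪ SR) b ↔ OnHull P SL b ∨ OnHull P SR b := by
  have hm : OnHull P (SL ∪ SR) m := by
    refine ⟨.inl h.mem_left, fun a ha c hc h1 h2 => ?_⟩
    rw [ltX_iff hx] at h1 h2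
    have ha' : a ∈ SL := ha.resolve_right fun h' => by
      rcases h.rightOf a h' with rfl | h' <;> linarith
    have hc' : c ∈ SR := hc.resolve_left fun h' => by
      rcases h.leftOf c h' with rfl | h' <;> linarith
    obtain ⟨u, hu, hum, hua⟩ := h.head_left hx ha' h1
    obtain ⟨v, hv, hmv, hvc⟩ := (h.mirror hx).head_left (fun i j h => hx (neg_injective h)) hc'
      (neg_lt_neg h2)
    rw [orient_mirror] at hvc
    simp only [mirror_fst, neg_lt_neg_iff] at hmv
    have huv := hf u hu v hv
    rw [orient_swap_right] at huv
    have k1 := orient_heights (P u) (P m) (P m) (P v) (P c)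
    have k2 := orient_heights (P u) (P m) (P a) (P m) (P c)
    rw [orient_self_right] at k1 k2
    -- The line `um` passes above `v` by assumption, and `c` is below the line `mv`; hence `c`, like
    -- `a`, is below the line `um`, and the chord `ac` cannot pass above `m`.
    have hc0 : orient (P u) (P m) (P c) ≤ 0 := by
      by_contra hcon
      push Not at hcon
      nlinarith [mul_pos (sub_pos.2 hmv) hcon, mul_nonneg (sub_pos.2 hum).le (neg_nonneg.2 hvc),
        mul_nonneg (sub_pos.2 h2).le huv]
    rw [orient_swap_right]
    by_contra hcon
    push Not at hcon
    nlinarith [mul_pos (sub_pos.2 hum) (neg_lt_zero.1 hcon),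
      mul_nonneg (sub_pos.2 h1).le (neg_nonneg.2 hc0), mul_nonneg (sub_pos.2 h2).le (neg_nonneg.2 hua)]
  refine ⟨hm, fun b => ⟨fun hb => ?_, ?_⟩⟩
  · rcases hb.1 with hb' | hb'
    · exact .inl (hb.mono Set.subset_union_left hb')
    · exact .inr (hb.mono Set.subset_union_right hb')
  · rintro (hb | hb)
    · rcases h.leftOf b hb.1 with rfl | hbm
      · exact hm
      · exact onHull_left hx h.leftOf h.rightOf h.mem_left h.mem_left hm hb hbm
    · rcases h.rightOf b hb.1 with rfl | hbm
      · exact hm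
      · exact onHull_right hx h.leftOf h.rightOf h.mem_right h.mem_right hm hb hbm

variable {X X' Y Y' : List (Fin n)} {T : List (Fin n × Fin n)}

theorem HullPair.funnel (hx : Function.Injective fun i => (P i).1)
    (h : HullPair P SL SR m (X ++ X') (Y ++ Y')) (hs : Stair P π X Y T)
    (hf : ∀ u ∈ X.head?, ∀ v ∈ Y.head?, orient (P u) (P v) (P m) < 0) : Funnel P π m X Y T := by
  have hX : (m :: X).Sublist (m :: (X ++ X')) := (List.sublist_append_left _ _).cons_cons m
  have hY : (m :: Y).Sublist (m :: (Y ++ Y')) := (List.sublist_append_left _ _).cons_cons m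
  refine ⟨hs, h.decX.sublist hX, h.incX.sublist hY, fun a ha b hb c hc => ?_, fun a ha b hb c hc => ?_, hf⟩
  · exact ((h.memX b).1 (hX.subset hb)).orient_le hx ((h.memX a).1 (hX.subset ha)).1
      ((h.memX c).1 (hX.subset hc)).1
  · exact ((h.memY b).1 (hY.subset hb)).orient_le hx ((h.memY a).1 (hY.subset ha)).1
      ((h.memY c).1 (hY.subset hc)).1

/-- All points to the left of the apex are below the bridge. -/
theorem HullPair.below_left (hx : Function.Injective fun i => (P i).1)
    (h : HullPair P SL SR m (X ++ X') (Y ++ Y')) (hF : Funnel P π m X Y T) {p q : Fin n}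
    (hp : p ∈ X.getLast?) (hq : q ∈ Y.getLast?)
    (hend : ∀ x ∈ X'.head?, orient (P p) (P q) (P x) ≤ 0) :
    (∀ z ∈ SL, orient (P p) (P q) (P z) ≤ 0) ∧
      ∀ z ∈ SL, (P p).1 < (P z).1 → orient (P p) (P q) (P z) < 0 := by
  have hpX := List.mem_of_mem_getLast? hp
  have hqY := List.mem_of_mem_getLast? hq
  have hpm := hF.lt_apex p hpX
  have hmq := hF.apex_lt q hqY
  have hpq := hpm.trans hmq
  have hne : ∀ z ∈ m :: X, z ≠ q := fun z hz hzq => by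
    subst hzq
    rcases List.mem_cons.1 hz with rfl | hz
    · exact lt_irrefl _ hmq
    · exact lt_irrefl _ (hmq.trans (hF.lt_apex _ hz))
  have hXX : ∀ a ∈ X, ∀ b ∈ X', (P b).1 < (P a).1 := (List.pairwise_append.1 h.decX.tail).2.2
  -- Only hull vertices need to be checked. Those on the chain are below the base of the funnel;
  -- beyond `p` the first vertex is not above the line, and concavity extends this to the others.
  have hall : ∀ z ∈ SL, orient (P p) (P q) (P z) ≤ 0 := by
    refine orient_le_of_onHull hx hpq fun b hb => ?_
    have hb' := (h.memX b).2 hb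
    rw [← List.cons_append, List.mem_append] at hb'
    rcases hb' with hb' | hb'
    · by_cases hbp : b = p
      · rw [hbp, orient_self_left]
      · exact (hF.below_base hp hq (.inl hb') hbp (hne b hb')).le
    · cases X' with
      | nil => simp at hb'
      | cons x X' =>
        have h0 := hend x rfl
        rcases List.mem_cons.1 hb' with rfl | hb'
        · exact h0
        · have hbx : (P b).1 < (P x).1 :=
            List.rel_of_pairwise_cons (List.pairwise_append.1 h.decX.tail).2.1 hb'
          have hxp := hXX p hpX x (by simp)
          rw [orient_rotate] at h0 ⊢
          refine orient_trans_right hbx hxp hpq ?_ h0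
          exact ((h.memX x).1 (by simp)).orient_le hx hb.1
            ((h.memX p).1 (by simp [hpX])).1 hbx hxp
  -- A point on the line `pq` would be of greatest height, hence a hull vertex. But vertices of the
  -- chain other than `p` are strictly below the line, and the remaining ones are to the left of
  -- `p`.
  refine ⟨hall, fun z hz hpz => lt_of_le_of_ne (hall z hz) fun h0 => ?_⟩
  have hz' := (h.memX z).2 (onHull_of_max hx hpq hz fun s hs => (hall s hs).trans_eq h0.symm)
  rw [← List.cons_append, List.mem_append] at hz'
  rcases hz' with hz' | hz'
  · refine (hF.below_base hp hq (.inl hz') ?_ (hne z hz')).ne h0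
    rintro rfl
    exact lt_irrefl _ hpz
  · exact lt_irrefl _ (hpz.trans (hXX p hpX z hz'))

theorem HullPair.below_right (hx : Function.Injective fun i => (P i).1)
    (h : HullPair P SL SR m (X ++ X') (Y ++ Y')) (hF : Funnel P π m X Y T) {p q : Fin n}
    (hp : p ∈ X.getLast?) (hq : q ∈ Y.getLast?)
    (hend : ∀ y ∈ Y'.head?, orient (P p) (P q) (P y) ≤ 0) :
    (∀ z ∈ SR, orient (P p) (P q) (P z) ≤ 0) ∧
      ∀ z ∈ SR, (P z).1 < (P q).1 → orient (P p) (P q) (P z) < 0 := by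
  obtain ⟨h1, h2⟩ := (h.mirror hx).below_left (fun i j h => hx (neg_injective h)) hF.mirror hq hp
    (by simpa only [orient_mirror] using hend)
  simp only [orient_mirror] at h1 h2
  exact ⟨h1, fun z hz hzq => h2 z hz (neg_lt_neg hzq)⟩

/-- The final chord is the bridge, and determines the common hull. -/
theorem HullPair.bridge (hx : Function.Injective fun i => (P i).1)
    (h : HullPair P SL SR m (X ++ X') (Y ++ Y')) (hF : Funnel P π m X Y T) {p q : Fin n}
    (hp : p ∈ X.getLast?) (hq : q ∈ Y.getLast?)
    (hend : ∀ x ∈ X'.head?, orient (P p) (P q) (P x) ≤ 0)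
    (hend' : ∀ y ∈ Y'.head?, orient (P p) (P q) (P y) ≤ 0) :
    (∀ z ∈ SL ∪ SR, orient (P p) (P q) (P z) ≤ 0) ∧
    (∀ z ∈ SL ∪ SR, LtX P p z → LtX P z q → orient (P p) (P q) (P z) < 0) ∧
    ¬ OnHull P (SL ∪ SR) m ∧
    ∀ b, OnHull P (SL ∪ SR) b ↔ OnHull P SL b ∧ (b = p ∨ LtX P b p) ∨
      OnHull P SR b ∧ (b = q ∨ LtX P q b) := by
  obtain ⟨l1, l2⟩ := h.below_left hx hF hp hq hend
  obtain ⟨r1, r2⟩ := h.below_right hx hF hp hq hend'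
  have hpX := List.mem_of_mem_getLast? hp
  have hqY := List.mem_of_mem_getLast? hq
  have hpm := hF.lt_apex p hpX
  have hmq := hF.apex_lt q hqY
  have hpq := hpm.trans hmq
  have hpS : OnHull P SL p := (h.memX p).1 (by simp [hpX])
  have hqS : OnHull P SR q := (h.memY q).1 (by simp [hqY])
  have hall : ∀ z ∈ SL ∪ SR, orient (P p) (P q) (P z) ≤ 0 := fun z hz => hz.elim (l1 z) (r1 z)
  have hpH : OnHull P (SL ∪ SR) p :=
    onHull_of_max hx hpq (.inl hpS.1) fun s hs => (hall s hs).trans_eq (orient_self_left _ _).symm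
  have hqH : OnHull P (SL ∪ SR) q :=
    onHull_of_max hx hpq (.inr hqS.1) fun s hs => (hall s hs).trans_eq (orient_self_right _ _).symm
  have hlt : ∀ z ∈ SL ∪ SR, (P p).1 < (P z).1 → (P z).1 < (P q).1 →
      orient (P p) (P q) (P z) < 0 := by
    rintro z (hz | hz) h1 h2
    exacts [l2 z hz h1, r2 z hz h2]
  have hnot : ∀ z, (P p).1 < (P z).1 → (P z).1 < (P q).1 → ¬ OnHull P (SL ∪ SR) z :=
    fun z h1 h2 hz => (hlt z hz.1 h1 h2).not_ge
      (hz.2 p hpH.1 q hqH.1 ((ltX_iff hx).2 h1) ((ltX_iff hx).2 h2))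
  simp only [ltX_iff hx]
  refine ⟨hall, hlt, hnot m hpm hmq, fun b => ⟨fun hb => ?_, ?_⟩⟩
  · rcases hb.1 with hb' | hb'
    · refine .inl ⟨hb.mono Set.subset_union_left hb', ?_⟩
      by_contra hcon
      push Not at hcon
      refine hnot b (lt_of_le_of_ne hcon.2 fun e => hcon.1 (hx e).symm) ?_ hb
      rcases h.leftOf b hb' with rfl | h'
      exacts [hmq, h'.trans hmq]
    · refine .inr ⟨hb.mono Set.subset_union_right hb', ?_⟩
      by_contra hcon
      push Not at hcon
      refine hnot b ?_ (lt_of_le_of_ne hcon.2 fun e => hcon.1 (hx e)) hb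
      rcases h.rightOf b hb' with rfl | h'
      exacts [hpm, hpm.trans h']
  · rintro (⟨hb, rfl | hbp⟩ | ⟨hb, rfl | hbp⟩)
    · exact hpH
    · exact onHull_left hx h.leftOf h.rightOf h.mem_left hpS.1 hpH hb hbp
    · exact hqH
    · exact onHull_right hx h.leftOf h.rightOf h.mem_right hqS.1 hqH hb hbp

/-- A shear of the plane makes the order by `x`-coordinate strict. -/
theorem exists_shear (hP : Function.Injective P) :
    ∃ M : (ℝ × ℝ) ≃ₗ[ℝ] ℝ × ℝ, (∀ a b c, orient (M a) (M b) (M c) = orient a b c) ∧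
      ∀ i j, LtX P i j ↔ (M (P i)).1 < (M (P j)).1 := by
  -- For the shear `x + ε y`: a strict inequality between `x`-coordinates survives for small `ε`,
  -- and a tie is decided by `y` for every positive `ε`. There are finitely many pairs, so one `ε`
  -- serves all.
  have h1 : ∀ i j : Fin n, ∀ᶠ ε in nhdsWithin (0 : ℝ) (Set.Ioi 0),
      LtX P i j → (P i).1 + ε * (P i).2 < (P j).1 + ε * (P j).2 := by
    intro i j
    by_cases h : LtX P i j
    · rcases h with h | ⟨h, h'⟩
      · have hc : Filter.Tendsto (fun ε : ℝ => (P j).1 + ε * (P j).2 - ((P i).1 + ε * (P i).2))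
            (nhdsWithin 0 (Set.Ioi 0)) (nhds ((P j).1 + 0 * (P j).2 - ((P i).1 + 0 * (P i).2))) :=
          (Continuous.tendsto (by fun_prop) 0).mono_left nhdsWithin_le_nhds
        filter_upwards [hc.eventually (lt_mem_nhds (a := 0) (by linarith))] with ε hε _
        linarith
      · filter_upwards [self_mem_nhdsWithin] with ε hε _
        have := mul_lt_mul_of_pos_left h' (Set.mem_Ioi.1 hε)
        linarith
    · exact Filter.Eventually.of_forall fun _ h' => absurd h' h
  obtain ⟨ε, hε⟩ := (Filter.eventually_all.2 fun i => Filter.eventually_all.2 (h1 i)).exists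
  let M : (ℝ × ℝ) ≃ₗ[ℝ] ℝ × ℝ :=
    { toFun := fun z => (z.1 + ε * z.2, z.2)
      invFun := fun z => (z.1 - ε * z.2, z.2)
      map_add' := fun a b => by ext <;> simp; ring
      map_smul' := fun c a => by ext <;> simp; ring
      left_inv := fun z => by ext <;> simp
      right_inv := fun z => by ext <;> simp }
  refine ⟨M, fun a b c => ?_, fun i j => ⟨hε i j, fun h => ?_⟩⟩
  · change orient (a.1 + ε * a.2, a.2) (b.1 + ε * b.2, b.2) (c.1 + ε * c.2, c.2) = _
    simp only [orient]; ring
  · by_contra hn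
    rcases eq_or_ne i j with rfl | hij
    · exact lt_irrefl _ h
    · have hji : LtX P j i := by
        simp only [LtX, not_or, not_and, not_lt] at hn ⊢
        rcases hn.1.lt_or_eq with h' | h'
        · exact .inl h'
        · refine .inr ⟨h', lt_of_le_of_ne (hn.2 h'.symm) fun h'' => hij (hP (Prod.ext h'.symm h''.symm))⟩
      exact lt_asymm h (hε j i hji)

end PseudoTri

/-! ### Gaps between separators, and the node data of a gap -/

namespace PseudoTri

variable {n : ℕ} {P : Fin n → ℝ × ℝ} {π : Equiv.Perm (Fin n)}

theorem LtX.irrefl (i : Fin n) : ¬ LtX P i i := by simp [LtX]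

theorem LtX.trans {i j k : Fin n} (h : LtX P i j) (h' : LtX P j k) : LtX P i k := by
  rcases h with h | ⟨h, h1⟩ <;> rcases h' with h' | ⟨h', h1'⟩
  · exact .inl (h.trans h')
  · exact .inl (h' ▸ h)
  · exact .inl (h ▸ h')
  · exact .inr ⟨h.trans h', h1.trans h1'⟩

theorem LtX.total (hP : Function.Injective P) {i j : Fin n} (h : i ≠ j) :
    LtX P i j ∨ LtX P j i := by
  rcases lt_trichotomy (P i).1 (P j).1 with h1 | h1 | h1
  · exact .inl (.inl h1)
  · rcases lt_trichotomy (P i).2 (P j).2 with h2 | h2 | h2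
    · exact .inl (.inr ⟨h1, h2⟩)
    · exact absurd (hP (Prod.ext h1 h2)) h
    · exact .inr (.inr ⟨h1.symm, h2⟩)
  · exact .inr (.inl h1)

theorem ALtX.irrefl : ∀ z : APt n, ¬ ALtX P z z
  | .negInf => id
  | .pt i => LtX.irrefl i
  | .posInf => id

theorem ALtX.trans {x y z : APt n} (h : ALtX P x y) (h' : ALtX P y z) : ALtX P x z := by
  cases x <;> cases y <;> cases z <;> simp_all [ALtX]
  exact h.trans h'

theorem ALtX.total (hP : Function.Injective P) {x y : APt n} (h : x ≠ y) :
    ALtX P x y ∨ ALtX P y x := by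
  cases x <;> cases y <;> simp_all [ALtX]
  exact LtX.total hP h

theorem ALtX.asymm {x y : APt n} (h : ALtX P x y) (h' : ALtX P y x) : False :=
  ALtX.irrefl x (h.trans h')

/-- The points from `a` to `b`. -/
def gap (P : Fin n → ℝ × ℝ) (a b : APt n) : Set (APt n) :=
  {z | z = a ∨ z = b ∨ ALtX P a z ∧ ALtX P z b}

theorem gap_univ : gap P .negInf .posInf = Set.univ := by
  ext z
  cases z <;> simp [gap, ALtX]

/-- With `rightPart_gap` this shows that the recursion never leaves the sets of the form `gap P a
b`, so pairs of separators can stand for the sets `Q` of the definition. -/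
theorem leftPart_gap {a b : APt n} {m : Fin n} (h1 : ALtX P a (.pt m)) (h2 : ALtX P (.pt m) b) :
    leftPart P (gap P a b) m = gap P a (.pt m) := by
  ext z
  constructor
  · rintro ⟨rfl | rfl | ⟨hz1, hz2⟩, rfl | hz⟩
    · exact .inl rfl
    · exact .inl rfl
    · exact .inr (.inl rfl)
    · exact (hz.asymm h2).elim
    · exact .inr (.inl rfl)
    · exact .inr (.inr ⟨hz1, hz⟩)
  · rintro (rfl | rfl | ⟨hz1, hz2⟩)
    · exact ⟨.inl rfl, .inr h1⟩
    · exact ⟨.inr (.inr ⟨h1, h2⟩), .inl rfl⟩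
    · exact ⟨.inr (.inr ⟨hz1, hz2.trans h2⟩), .inr hz2⟩

theorem rightPart_gap {a b : APt n} {m : Fin n} (h1 : ALtX P a (.pt m)) (h2 : ALtX P (.pt m) b) :
    rightPart P (gap P a b) m = gap P (.pt m) b := by
  ext z
  constructor
  · rintro ⟨rfl | rfl | ⟨hz1, hz2⟩, rfl | hz⟩
    · exact .inl rfl
    · exact (hz.asymm h1).elim
    · exact .inl rfl
    · exact .inr (.inl rfl)
    · exact .inl rfl
    · exact .inr (.inr ⟨hz, hz2⟩)
  · rintro (rfl | rfl | ⟨hz1, hz2⟩)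
    · exact ⟨.inr (.inr ⟨h1, h2⟩), .inl rfl⟩
    · exact ⟨.inr (.inl rfl), .inr h2⟩
    · exact ⟨.inr (.inr ⟨h1.trans hz1, hz2⟩), .inr hz1⟩

theorem gap_union (hP : Function.Injective P) {a b : APt n} {m : Fin n} (h1 : ALtX P a (.pt m))
    (h2 : ALtX P (.pt m) b) : gap P a (.pt m) ∪ gap P (.pt m) b = gap P a b := by
  rw [← leftPart_gap h1 h2, ← rightPart_gap h1 h2]
  ext z
  constructor
  · rintro (h | h) <;> exact h.1
  · intro h
    by_cases hz : z = .pt m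
    · exact .inl ⟨h, .inl hz⟩
    · rcases ALtX.total hP hz with h' | h'
      exacts [.inl ⟨h, .inr h'⟩, .inr ⟨h, .inr h'⟩]

theorem isLeft_gap {a b : APt n} (h : ALtX P a b) : IsLeft P (gap P a b) a := by
  refine ⟨.inl rfl, ?_⟩
  rintro p (rfl | rfl | hp) hne
  exacts [absurd rfl hne, h, hp.1]

theorem isRight_gap {a b : APt n} (h : ALtX P a b) : IsRight P (gap P a b) b := by
  refine ⟨.inr (.inl rfl), ?_⟩
  rintro p (rfl | rfl | hp) hne
  exacts [h, absurd rfl hne, hp.2]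

theorem isMid_gap {a b : APt n} {m : Fin n} (h1 : ALtX P a (.pt m)) (h2 : ALtX P (.pt m) b)
    (hmin : ∀ i, ALtX P a (.pt i) → ALtX P (.pt i) b → π m ≤ π i) :
    IsMid π (gap P a b) a b m := by
  refine ⟨.inr (.inr ⟨h1, h2⟩), fun h => ALtX.irrefl _ (h ▸ h1), fun h => ALtX.irrefl _ (h ▸ h2), ?_⟩
  rintro p (rfl | rfl | hp) hpa hpb
  · exact absurd rfl hpa
  · exact absurd rfl hpb
  · cases p with
    | negInf => cases a <;> simp [ALtX] at hp
    | posInf => cases b <;> simp [ALtX] at hp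
    | pt i =>
      have := hmin i hp.1 hp.2
      simpa [priority] using this

section transfer

variable {M : (ℝ × ℝ) ≃ₗ[ℝ] ℝ × ℝ}

/-- Besides priorities, the recursive triangulation depends on the geometry only through visibility,
which is linearly invariant. This brings the result obtained after the shear back to the original
points. -/
theorem Chords.of_map {L R : List (Fin n)} {T : Multiset (Fin n × Fin n)}
    (h : Chords (fun i => M (P i)) π L R T) : Chords P π L R T := by
  induction h with
  | done h => exact .done h
  | left hA hB hq hv hnv _ _ ih1 ih2 =>
    simp only [visible_map] at hv hnv
    exact .left hA hB hq hv hnv ih1 ih2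
  | right hA hB hq hv hnv _ _ ih1 ih2 =>
    simp only [visible_map] at hv hnv
    exact .right hA hB hq hv hnv ih1 ih2

theorem Stair.map (hM : ∀ a b c, orient (M a) (M b) (M c) = orient a b c)
    {X Y : List (Fin n)} {T : List (Fin n × Fin n)} (h : Stair P π X Y T) :
    Stair (fun i => M (P i)) π X Y T := by
  induction h with
  | base p q => exact .base p q
  | left h1 h2 _ ih => exact .left (by rwa [hM]) (by simpa only [hM] using h2) ih
  | right h1 h2 _ ih => exact .right (by rwa [hM]) (by simpa only [hM] using h2) ih

theorem injective_fst_of_ltX (hP : Function.Injective P)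
    (hM : ∀ i j, LtX P i j ↔ (M (P i)).1 < (M (P j)).1) :
    Function.Injective fun i => (M (P i)).1 := by
  intro i j h
  by_contra hne
  rcases LtX.total hP hne with h' | h'
  · exact ((hM i j).1 h').ne h
  · exact ((hM j i).1 h').ne h.symm

theorem ltX_map (hP : Function.Injective P) (hM : ∀ i j, LtX P i j ↔ (M (P i)).1 < (M (P j)).1) :
    LtX (fun i => M (P i)) = LtX P := by
  funext i j
  exact propext ((ltX_iff (injective_fst_of_ltX hP hM)).trans (hM i j).symm)

end transfer

/-- A chord above the apex ends strictly to the left of it. -/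
theorem fst_lt_of_orient_neg {u v m : Fin n} (h : orient (P u) (P v) (P m) < 0) (h1 : LtX P u m)
    (h2 : LtX P m v) : (P u).1 < (P m).1 := by
  refine h1.resolve_right fun ⟨e, h1⟩ => h.not_ge ?_
  have hv : (P m).1 ≤ (P v).1 := by rcases h2 with h2 | h2; exacts [h2.le, h2.1.le]
  simp only [orient, e, sub_self, mul_zero, sub_zero]
  exact mul_nonneg (by linarith) (by linarith)

theorem belowAt_of_orient {m : Fin n} {e f : Fin n × Fin n}
    (h1 : orient (P f.1) (P f.2) (P e.1) ≤ 0) (h2 : orient (P f.1) (P f.2) (P e.2) ≤ 0)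
    (hf : (P f.1).1 < (P f.2).1) : BelowAt P m e f := by
  rintro y y' ⟨s, t, hs, ht, hst, h⟩ hy'
  have e1 : orient (P f.1) (P f.2) ((P m).1, y) ≤ 0 := by
    rw [← h, orient_combo _ _ _ _ hst]
    nlinarith
  have e2 := orient_of_mem_segment hy'
  simp only [orient] at e1 e2
  have : ((P f.2).1 - (P f.1).1) * (y - y') ≤ 0 := by linarith
  by_contra hcon
  push Not at hcon
  nlinarith [mul_pos (sub_pos.2 hf) (sub_pos.2 hcon)]

/-! ### Node data for the gap fused at an apex -/

/-- The vertices of the hulls of the gaps to the left and to the right of `m`, listed from `m`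
outwards and without `m`. -/
structure GapPair (P : Fin n → ℝ × ℝ) (π : Equiv.Perm (Fin n)) (a b : APt n) (m : Fin n)
    (XA YA : List (Fin n)) : Prop where
  left_lt : ALtX P a (.pt m)
  lt_right : ALtX P (.pt m) b
  min : ∀ i, ALtX P a (.pt i) → ALtX P (.pt i) b → π m ≤ π i
  sortX : (m :: XA).Pairwise fun i j => LtX P j i
  sortY : (m :: YA).Pairwise (LtX P)
  memX : ∀ i, i ∈ m :: XA ↔ APt.pt i ∈ upperHull P (gap P a (.pt m))
  memY : ∀ i, i ∈ m :: YA ↔ APt.pt i ∈ upperHull P (gap P (.pt m) b)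

variable {a b : APt n} {m : Fin n} {XA YA : List (Fin n)}

theorem GapPair.hullPair (h : GapPair P π a b m XA YA) (hP : Function.Injective P)
    {M : (ℝ × ℝ) ≃ₗ[ℝ] ℝ × ℝ} (ho : ∀ a b c, orient (M a) (M b) (M c) = orient a b c)
    (hM : ∀ i j, LtX P i j ↔ (M (P i)).1 < (M (P j)).1) :
    HullPair (fun i => M (P i)) {i | APt.pt i ∈ gap P a (.pt m)} {i | APt.pt i ∈ gap P (.pt m) b} m
      XA YA where
  leftOf z hz := by
    rcases hz with h' | h' | h'
    · subst h'; exact .inr ((hM _ _).1 h.left_lt)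
    · cases h'; exact .inl rfl
    · exact .inr ((hM _ _).1 h'.2)
  rightOf z hz := by
    rcases hz with h' | h' | h'
    · cases h'; exact .inl rfl
    · subst h'; exact .inr ((hM _ _).1 h.lt_right)
    · exact .inr ((hM _ _).1 h'.1)
  decX := h.sortX.imp fun h => (hM _ _).1 h
  incX := h.sortY.imp fun h => (hM _ _).1 h
  memX i := by rw [h.memX, mem_upperHull, OnHull, OnHull, ltX_map hP hM]; simp only [ho]
  memY i := by rw [h.memY, mem_upperHull, OnHull, OnHull, ltX_map hP hM]; simp only [ho]

theorem onHull_map (hP : Function.Injective P) {M : (ℝ × ℝ) ≃ₗ[ℝ] ℝ × ℝ}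
    (ho : ∀ a b c, orient (M a) (M b) (M c) = orient a b c)
    (hM : ∀ i j, LtX P i j ↔ (M (P i)).1 < (M (P j)).1) {S : Set (Fin n)} {i : Fin n} :
    OnHull (fun i => M (P i)) S i ↔ OnHull P S i := by
  rw [OnHull, OnHull, ltX_map hP hM]; simp only [ho]

theorem GapPair.union (h : GapPair P π a b m XA YA) (hP : Function.Injective P) :
    {i | APt.pt i ∈ gap P a (.pt m)} ∪ {i | APt.pt i ∈ gap P (.pt m) b} =
      {i | APt.pt i ∈ gap P a b} := by
  rw [← gap_union hP h.left_lt h.lt_right]; rfl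

/-- The node of a pseudo-triangle with a single point as its funnel. -/
theorem GapPair.nodeSpec_of_convex (h : GapPair P π a b m XA YA) (hP : Function.Injective P)
    (hf : ∀ u ∈ XA.head?, ∀ v ∈ YA.head?, 0 ≤ orient (P u) (P v) (P m)) :
    NodeSpec P π (gap P a b) ⟨m, a, b, none, balTree [m], balTree [m], .nil⟩ ∧
      ∀ i, APt.pt i ∈ upperHull P (gap P a b) ↔ i ∈ m :: XA ∨ i ∈ m :: YA := by
  obtain ⟨M, ho, hM⟩ := exists_shear hP
  obtain ⟨h1, h2⟩ := (h.hullPair hP ho hM).apex_onHull (injective_fst_of_ltX hP hM)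
    (by simpa only [ho] using hf)
  simp only [onHull_map hP ho hM, h.union hP] at h1 h2
  refine ⟨⟨isLeft_gap (h.left_lt.trans h.lt_right), isRight_gap (h.left_lt.trans h.lt_right),
    isMid_gap h.left_lt h.lt_right h.min, .inl ⟨mem_upperHull.2 h1, rfl, ?_, ?_⟩, ?_, ?_,
    balanced_balTree [m], balanced_balTree [m], trivial⟩, fun i => ?_⟩
  · exact inorder_balTree [m]
  · exact inorder_balTree [m]
  · simp only [inorder_balTree]; exact .done rfl
  · exact List.Pairwise.nil
  · rw [mem_upperHull, h2, h.memX, h.memY, mem_upperHull, mem_upperHull]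

variable {X X' Y Y' : List (Fin n)} {T : List (Fin n × Fin n)}

/-- The node of a pseudo-triangle with a bridge. -/
theorem GapPair.nodeSpec_of_stair (h : GapPair P π a b m (X ++ X') (Y ++ Y'))
    (hP : Function.Injective P) (hs : Stair P π X Y T)
    (hf : ∀ u ∈ X.head?, ∀ v ∈ Y.head?, orient (P u) (P v) (P m) < 0) {p q : Fin n}
    (hp : p ∈ X.getLast?) (hq : q ∈ Y.getLast?)
    (hend : ∀ x ∈ X'.head?, orient (P p) (P q) (P x) ≤ 0)
    (hend' : ∀ y ∈ Y'.head?, orient (P p) (P q) (P y) ≤ 0) :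
    NodeSpec P π (gap P a b)
      ⟨m, a, b, some (p, q), balTree (m :: X).reverse, balTree (m :: Y), balTree T⟩ ∧
      ∀ i, APt.pt i ∈ upperHull P (gap P a b) ↔ i = p ∨ i ∈ X' ∨ i = q ∨ i ∈ Y' := by
  obtain ⟨M, ho, hM⟩ := exists_shear hP
  have hx := injective_fst_of_ltX hP hM
  have hH := h.hullPair hP ho hM
  have hF := hH.funnel hx (hs.map ho) (by simpa only [ho] using hf)
  obtain ⟨h1, h2, h3, h4⟩ := hH.bridge hx hF hp hq (by simpa only [ho] using hend)
    (by simpa only [ho] using hend')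
  simp only [onHull_map hP ho hM, ho, ltX_map hP hM, h.union hP, ← mem_upperHull] at h1 h2 h3 h4
  have hpX := List.mem_of_mem_getLast? hp
  have hqY := List.mem_of_mem_getLast? hq
  have sX : X.Pairwise fun i j => LtX P j i := (List.pairwise_append.1 h.sortX.tail).1
  have sY : Y.Pairwise (LtX P) := (List.pairwise_append.1 h.sortY.tail).1
  have ltm : ∀ i ∈ X, LtX P i m := fun i hi => List.rel_of_pairwise_cons h.sortX (by simp [hi])
  have mlt : ∀ i ∈ Y, LtX P m i := fun i hi => List.rel_of_pairwise_cons h.sortY (by simp [hi])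
  have hpX' : ∀ i ∈ X', LtX P i p := fun i hi =>
    (List.pairwise_append.1 h.sortX.tail).2.2 p hpX i hi
  have hqY' : ∀ i ∈ Y', LtX P q i := fun i hi =>
    (List.pairwise_append.1 h.sortY.tail).2.2 q hqY i hi
  have hplast : ∀ i ∈ X, i = p ∨ LtX P p i := fun i hi => by
    obtain ⟨l, rfl⟩ := List.getLast?_eq_some_iff.1 hp
    rcases List.mem_append.1 hi with hi | hi
    · exact .inr ((List.pairwise_append.1 sX).2.2 i hi p (by simp))
    · exact .inl (List.mem_singleton.1 hi)
  have hqlast : ∀ i ∈ Y, i = q ∨ LtX P i q := fun i hi => by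
    obtain ⟨l, rfl⟩ := List.getLast?_eq_some_iff.1 hq
    rcases List.mem_append.1 hi with hi | hi
    · exact .inr ((List.pairwise_append.1 sY).2.2 i hi q (by simp))
    · exact .inl (List.mem_singleton.1 hi)
  have hmX : ∀ i, i ∈ m :: X ↔
      APt.pt i ∈ upperHull P (gap P a (.pt m)) ∧ (i = p ∨ LtX P p i) := by
    intro i
    rw [← h.memX, ← List.cons_append, List.mem_append]
    constructor
    · intro hi
      refine ⟨.inl hi, ?_⟩
      rcases List.mem_cons.1 hi with rfl | hi
      exacts [.inr (ltm p hpX), hplast i hi]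
    · rintro ⟨hi | hi, hi'⟩
      · exact hi
      · rcases hi' with rfl | hi'
        · exact List.mem_cons_of_mem _ hpX
        · exact absurd (hi'.trans (hpX' i hi)) (LtX.irrefl _)
  have hmY : ∀ i, i ∈ m :: Y ↔
      APt.pt i ∈ upperHull P (gap P (.pt m) b) ∧ (i = q ∨ LtX P i q) := by
    intro i
    rw [← h.memY, ← List.cons_append, List.mem_append]
    constructor
    · intro hi
      refine ⟨.inl hi, ?_⟩
      rcases List.mem_cons.1 hi with rfl | hi
      exacts [.inr (mlt q hqY), hqlast i hi]
    · rintro ⟨hi | hi, hi'⟩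
      · exact hi
      · rcases hi' with rfl | hi'
        · exact List.mem_cons_of_mem _ hqY
        · exact absurd ((hqY' i hi).trans hi') (LtX.irrefl _)
  have hgL := leftPart_gap h.left_lt h.lt_right
  have hgR := rightPart_gap h.left_lt h.lt_right
  refine ⟨⟨isLeft_gap (h.left_lt.trans h.lt_right), isRight_gap (h.left_lt.trans h.lt_right),
    isMid_gap h.left_lt h.lt_right h.min, .inr ⟨h3, p, q, rfl, ?_, ⟨?_, ?_⟩, ?_, ?_⟩, ?_, ?_,
    balanced_balTree (m :: X).reverse, balanced_balTree (m :: Y), balanced_balTree T⟩, fun i => ?_⟩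
  · simp only [hgL, hgR]
    refine ⟨((h.memX p).1 (by simp [hpX])).1, ((h.memY q).1 (by simp [hqY])).1,
      (ltm p hpX).trans (mlt q hqY), fun r hr => h1 r ?_, fun r hr => h2 r ?_⟩ <;>
    · rwa [gap_union hP h.left_lt h.lt_right] at hr
  · rw [inorder_balTree, List.pairwise_reverse]
    exact h.sortX.sublist ((List.sublist_append_left _ _).cons_cons m)
  · intro i
    simp only [inorder_balTree, List.mem_reverse, hgL]
    rw [hmX]
    exact and_congr_right fun _ => or_congr_left (by rw [APt.pt.injEq])
  · rw [inorder_balTree]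
    exact h.sortY.sublist ((List.sublist_append_left _ _).cons_cons m)
  · intro i
    simp only [inorder_balTree, hgR]
    rw [hmY]
    exact and_congr_right fun _ => or_congr_left (by rw [APt.pt.injEq])
  · simp only [inorder_balTree]
    exact hF.chords.of_map
  · simp only [inorder_balTree]
    have hpw := hF.stair.pairwise hF.decX.tail hF.incX.tail hF.lt_apex hF.apex_lt
    simp only [ho] at hpw
    -- Verticals are not preserved by the shear, so only orientations are carried back. The height
    -- comparison then needs chords that are not vertical in the original plane: the apex is
    -- strictly below each chord, which therefore starts strictly to the left of it.
    refine hpw.imp_of_mem fun {e f} _ hfT hef => belowAt_of_orient hef.1 hef.2 ?_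
    obtain ⟨hf1, hf2⟩ := hs.mem f hfT
    have hl := ltm _ hf1
    have hr := mlt _ hf2
    obtain ⟨hXn, hYn⟩ := hs.ne_nil
    have hneg := ((hF.stair.below_first hF.decX.tail hF.incX.tail hF.lt_apex hF.apex_lt
      _ (List.head?_eq_some_head hXn) _ (List.head?_eq_some_head hYn) (M (P m))
      (hF.lt_apex _ (List.head_mem _)).le (hF.apex_lt _ (List.head_mem _)).le).2
      (hF.first _ (List.head?_eq_some_head hXn) _ (List.head?_eq_some_head hYn))).1 f hfT
    rw [ho] at hneg
    have := fst_lt_of_orient_neg hneg hl hr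
    rcases hr with hr | hr
    exacts [this.trans hr, this.trans_eq hr.1]
  · rw [h4, ← h.memX, ← h.memY]
    simp only [← List.cons_append, List.mem_append]
    constructor
    · rintro (⟨hi | hi, hi'⟩ | ⟨hi | hi, hi'⟩)
      · refine .inl (hi'.resolve_right fun hi' => ?_)
        rcases ((hmX i).1 hi).2 with rfl | h'
        exacts [LtX.irrefl _ hi', LtX.irrefl _ (hi'.trans h')]
      · exact .inr (.inl hi)
      · refine .inr (.inr (.inl (hi'.resolve_right fun hi' => ?_)))
        rcases ((hmY i).1 hi).2 with rfl | h'
        exacts [LtX.irrefl _ hi', LtX.irrefl _ (hi'.trans h')]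
      · exact .inr (.inr (.inr hi))
    · rintro (rfl | hi | rfl | hi)
      · exact .inl ⟨.inl (List.mem_cons_of_mem _ hpX), .inl rfl⟩
      · exact .inl ⟨.inr hi, .inr (hpX' i hi)⟩
      · exact .inr ⟨.inl (List.mem_cons_of_mem _ hqY), .inl rfl⟩
      · exact .inr ⟨.inr hi, .inr (hqY' i hi)⟩

end PseudoTri

/-! ### The size of the structure -/

namespace PseudoTri

variable {n : ℕ} {P : Fin n → ℝ × ℝ} {π : Equiv.Perm (Fin n)}

theorem numNodes_eq_length {α : Type} : ∀ t : BinaryTree α, t.numNodes = (inorder t).length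
  | .nil => rfl
  | .node v l r => by
    simp only [BinaryTree.numNodes, inorder, List.length_append, List.length_cons,
      numNodes_eq_length l, numNodes_eq_length r]
    omega

/-- The midpoint of an edge is on the boundary but is no endpoint. -/
theorem not_visible_of_edge (hP : Function.Injective P) {L R : List (Fin n)} {q w : Fin n}
    (hqw : q ≠ w) (h : [q, w] <:+: L ∨ [w, q] <:+: R) : ¬ Visible P L R q w := by
  intro hv
  have hmid : midpoint ℝ (P q) (P w) ∈ segment ℝ (P q) (P w) := midpoint_mem_segment _ _
  have hne : P q ≠ P w := hP.ne hqw
  have hb : midpoint ℝ (P q) (P w) ∈ boundary P L R := by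
    rcases h with h | h
    · exact .inl (.inl ⟨q, w, h, hmid⟩)
    · exact .inl (.inr ⟨w, q, h, by rwa [segment_symm]⟩)
  rcases hv ⟨hmid, hb⟩ with h | h
  · exact hne (by simpa using h)
  · exact hne (by simpa using h)

/-- The bound is the number of non-corners. A chord splits the funnel into two whose bounds add up
to one less than the bound of the whole, provided that the truncated subtractions are genuine. -/
theorem Chords.card_le (hP : Function.Injective P) {L R : List (Fin n)}
    {T : Multiset (Fin n × Fin n)} (h : Chords P π L R T) (hm : L.getLast? = R.head?)
    (hn : (L ++ R.tail).Nodup) : Multiset.card T ≤ L.length + R.length - 4 := by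
  induction h with
  | done => simp
  | @left A B C D q w T₁ T₂ hA hB _ hv _ _ _ ih1 ih2 =>
    have hBl := List.length_pos_iff.2 hB
    have hAl := List.length_pos_iff.2 hA
    have i1 := ih1 (by simp) (by
      refine hn.sublist ?_
      cases C with
      | nil =>
        have hw : w ∈ B := by
          rw [List.getLast?_append_cons, List.getLast?_cons_of_ne_nil hB] at hm
          exact List.mem_of_mem_getLast? hm
        simpa using (List.singleton_sublist.2 hw).append_right D
      | cons c C =>
        refine List.Sublist.append (List.Sublist.append_left (by simp) _) ?_
        simp)
    have i2 := ih2 (by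
      rw [List.getLast?_append_cons] at hm
      rw [hm]; cases C <;> simp) (by
      refine hn.sublist (List.Sublist.append (List.sublist_append_right _ _) ?_)
      cases C with
      | nil => simp
      | cons c C => exact List.Sublist.append_left (by simp) _)
    -- Otherwise `w` would be the apex and the neighbour of `q` on the left chain, so that the chord
    -- would be an edge.
    have : 2 ≤ B.length + C.length := by
      by_contra hcon
      obtain rfl : C = [] := List.length_eq_zero_iff.1 (by omega)
      obtain ⟨x, rfl⟩ := List.length_eq_one_iff.1 (show B.length = 1 by simp at hcon; omega)
      obtain rfl : x = w := by
        rw [List.getLast?_append_cons] at hm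
        simpa using hm
      refine not_visible_of_edge hP ?_ (.inl ⟨A, [], by simp⟩) hv
      rintro rfl
      simp [List.nodup_append] at hn
    simp only [List.length_append, List.length_cons, List.length_nil, Multiset.card_cons,
      Multiset.card_add] at i1 i2 ⊢
    omega
  | @right A B C D q w T₁ T₂ hA hB _ hv _ _ _ ih1 ih2 =>
    have hBl := List.length_pos_iff.2 hB
    have hAl := List.length_pos_iff.2 hA
    obtain ⟨a, A, rfl⟩ := List.exists_cons_of_ne_nil hA
    have i1 := ih1 (by simp) (by
      refine hn.sublist ?_
      have e : (C ++ w :: D) ++ (a :: A ++ q :: B).tail = C ++ ([w] ++ (D ++ A) ++ q :: B) := by simp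
      rw [e]
      simp only [List.tail_cons, List.append_assoc]
      refine List.Sublist.append_left ?_ _
      simp)
    have i2 := ih2 (by
      rw [List.getLast?_append_cons] at hm
      rw [hm]; simp) (by
      refine hn.sublist (List.Sublist.append (List.sublist_append_right _ _) ?_)
      exact List.Sublist.append_left (by simp) _)
    have : 1 ≤ A.length + D.length := by
      by_contra hcon
      obtain rfl : A = [] := List.length_eq_zero_iff.1 (by omega)
      obtain rfl : D = [] := List.length_eq_zero_iff.1 (by omega)
      obtain rfl : w = a := by
        rw [List.getLast?_append_cons] at hm
        simpa using hm
      refine not_visible_of_edge hP ?_ (.inr ⟨[], B, by simp⟩) hv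
      rintro rfl
      simp [List.nodup_append] at hn
    simp only [List.length_append, List.length_cons, List.length_nil, Multiset.card_cons,
      Multiset.card_add] at i1 i2 ⊢
    omega

instance : Finite (APt n) :=
  Finite.of_injective (fun z : APt n => match z with
    | .negInf => (none : Option (Option (Fin n)))
    | .posInf => some none
    | .pt i => some (some i)) (by
      intro x y h
      cases x <;> cases y <;> simp_all)

/-! ### The hull size as a potential for memory -/

/-- The number of vertices of the upper hull. -/
noncomputable def hullSize (P : Fin n → ℝ × ℝ) (Q : Set (APt n)) : ℕ :=
  {i : Fin n | APt.pt i ∈ upperHull P Q}.ncard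

theorem upperHull_leftPart {Q : Set (APt n)} {m i : Fin n} (h : APt.pt i ∈ upperHull P Q)
    (hi : i = m ∨ LtX P i m) : APt.pt i ∈ upperHull P (leftPart P Q m) :=
  ⟨⟨h.1, hi.imp_left (congrArg _)⟩, fun a b c e ha hc => h.2 a b c e ha.1 hc.1⟩

theorem upperHull_rightPart {Q : Set (APt n)} {m i : Fin n} (h : APt.pt i ∈ upperHull P Q)
    (hi : i = m ∨ LtX P m i) : APt.pt i ∈ upperHull P (rightPart P Q m) :=
  ⟨⟨h.1, hi.imp_left (congrArg _)⟩, fun a b c e ha hc => h.2 a b c e ha.1 hc.1⟩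

theorem nodup_of_ltX {l : List (Fin n)} (h : l.Pairwise (LtX P)) : l.Nodup :=
  List.Pairwise.imp (fun hab e => by rw [e] at hab; exact LtX.irrefl _ hab) h

theorem Enumerates.nodup {l : List (Fin n)} {S : Set (APt n)} (h : Enumerates P l S) : l.Nodup :=
  nodup_of_ltX h.1

theorem getLast?_of_max {l : List (Fin n)} {m : Fin n} (h : l.Pairwise (LtX P)) (hm : m ∈ l)
    (hmax : ∀ i ∈ l, i = m ∨ LtX P i m) : l.getLast? = some m := by
  obtain ⟨l', x, rfl⟩ := (List.eq_nil_or_concat' l).resolve_left (List.ne_nil_of_mem hm)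
  rw [List.getLast?_concat]
  rcases List.mem_append.1 hm with hm | hm
  · have h1 := (List.pairwise_append.1 h).2.2 m hm x (by simp)
    rcases hmax x (by simp) with rfl | h2
    · rfl
    · exact absurd (h1.trans h2) (LtX.irrefl _)
  · rw [List.mem_singleton.1 hm]

theorem head?_of_min {l : List (Fin n)} {m : Fin n} (h : l.Pairwise (LtX P)) (hm : m ∈ l)
    (hmin : ∀ i ∈ l, i = m ∨ LtX P m i) : l.head? = some m := by
  cases l with
  | nil => simp at hm
  | cons x l =>
    rcases List.mem_cons.1 hm with rfl | hm
    · rfl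
    · have h1 := List.rel_of_pairwise_cons h hm
      rcases hmin x (by simp) with rfl | h2
      · rfl
      · exact absurd (h1.trans h2) (LtX.irrefl _)

theorem pt_mem_leftPart {Q : Set (APt n)} {m i : Fin n} (h : APt.pt i ∈ leftPart P Q m) :
    i = m ∨ LtX P i m :=
  h.2.imp_left APt.pt.inj

theorem pt_mem_rightPart {Q : Set (APt n)} {m i : Fin n} (h : APt.pt i ∈ rightPart P Q m) :
    i = m ∨ LtX P m i :=
  h.2.imp_left APt.pt.inj

/-- The chains of a node are paid for by the vertices that leave the hull, and there are at most as
many chords as chain vertices. -/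
theorem NodeSpec.size_le (hP : Function.Injective P) {Q : Set (APt n)} {d : NodeData n}
    (h : NodeSpec P π Q d) :
    d.chainL.numNodes + d.chainR.numNodes + hullSize P Q ≤
        hullSize P (leftPart P Q d.apex) + hullSize P (rightPart P Q d.apex) + 4 ∧
      d.chords.numNodes ≤ d.chainL.numNodes + d.chainR.numNodes := by
  obtain ⟨-, -, hmid, hF, hC, -, -, -, -⟩ := h
  set m := d.apex with hm
  have hmQ : APt.pt m ∈ Q := hmid.1
  have hside : ∀ i : Fin n, i = m ∨ LtX P i m ∨ LtX P m i := fun i =>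
    or_iff_not_imp_left.2 (LtX.total hP)
  simp only [numNodes_eq_length]
  have hchords : ∀ L R : List (Fin n), (L ++ R.tail).Pairwise (LtX P) → L.getLast? = R.head? →
      Chords P π L R (inorder d.chords : Multiset _) →
      (inorder d.chords).length ≤ L.length + R.length := fun L R hs hlast hc => by
    have := hc.card_le hP hlast (nodup_of_ltX hs)
    simp only [Multiset.coe_card] at this
    omega
  rcases hF with ⟨-, -, hL, hR⟩ | ⟨hmH, p, q, -, ⟨hp, hq, hpq, -, hlt⟩, hL, hR⟩
  · refine ⟨?_, hchords _ _ ?_ ?_ hC⟩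
    · rw [hL, hR]
      have : hullSize P Q ≤ hullSize P (leftPart P Q m) + hullSize P (rightPart P Q m) := by
        refine (Set.ncard_le_ncard (fun i hi => ?_) (Set.toFinite _)).trans (Set.ncard_union_le _ _)
        rcases hside i with h | h | h
        · exact .inl (upperHull_leftPart hi (.inl h))
        · exact .inl (upperHull_leftPart hi (.inr h))
        · exact .inr (upperHull_rightPart hi (.inr h))
      simp only [List.length_singleton]
      omega
    · rw [hL, hR]; simp
    · rw [hL, hR]; rfl
  · set L := inorder d.chainL
    set R := inorder d.chainR
    have hpm := pt_mem_leftPart hp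
    have hqm := pt_mem_rightPart hq
    have hmL : m ∈ L := by
      refine (hL.2 m).2 ⟨⟨⟨hmQ, .inl rfl⟩, fun a b c e ha hc h1 h2 => ?_⟩,
        hpm.imp (fun h => by rw [h]) id⟩
      cases e
      rcases pt_mem_leftPart hc with rfl | h
      exacts [absurd h2 (LtX.irrefl _), absurd (h2.trans h) (LtX.irrefl _)]
    have hmR : m ∈ R := by
      refine (hR.2 m).2 ⟨⟨⟨hmQ, .inl rfl⟩, fun a b c e ha hc h1 h2 => ?_⟩,
        hqm.imp (fun h => by rw [h]) id⟩
      cases e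
      rcases pt_mem_rightPart ha with rfl | h
      exacts [absurd h1 (LtX.irrefl _), absurd (h.trans h1) (LtX.irrefl _)]
    have hLm : ∀ i ∈ L, i = m ∨ LtX P i m := fun i hi => pt_mem_leftPart ((hL.2 i).1 hi).1.1
    have hRm : ∀ i ∈ R, i = m ∨ LtX P m i := fun i hi => pt_mem_rightPart ((hR.2 i).1 hi).1.1
    have hlast := getLast?_of_max hL.1 hmL hLm
    have hhead := head?_of_min hR.1 hmR hRm
    refine ⟨?_, hchords _ _ ?_ (hlast.trans hhead.symm) hC⟩
    · classical
      -- A hull vertex of `Q` is a hull vertex of its half. It is not strictly between the ends of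
      -- the bridge, so the only vertices of the chains that it can be are `p` and `q`.
      have hsub : {i : Fin n | APt.pt i ∈ upperHull P Q} ⊆
          ({i | APt.pt i ∈ upperHull P (leftPart P Q m)} \ L.toFinset) ∪
          ({i | APt.pt i ∈ upperHull P (rightPart P Q m)} \ R.toFinset) ∪ ({p, q} : Set (Fin n)) := by
        intro i hi
        have hnot : LtX P p i → LtX P i q → False := fun h1 h2 =>
          (hlt i (by
            rcases hside i with h | h | h
            · exact .inl ⟨hi.1, .inl (congrArg _ h)⟩
            · exact .inl ⟨hi.1, .inr h⟩
            · exact .inr ⟨hi.1, .inr h⟩) h1 h2).not_ge (hi.2 p i q rfl hp.1 hq.1 h1 h2)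
        rcases hside i with rfl | h | h
        · exact absurd hi hmH
        · by_cases hiL : i ∈ L
          · refine .inr (.inl ?_)
            rcases ((hL.2 i).1 hiL).2 with h' | h'
            · exact APt.pt.inj h'
            · refine (hnot h' ?_).elim
              rcases hqm with rfl | hqm
              exacts [h, h.trans hqm]
          · exact .inl (.inl ⟨upperHull_leftPart hi (.inr h), by simpa using hiL⟩)
        · by_cases hiR : i ∈ R
          · refine .inr (.inr ?_)
            rcases ((hR.2 i).1 hiR).2 with h' | h'
            · exact APt.pt.inj h'
            · refine (hnot ?_ h').elim
              rcases hpm with rfl | hpm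
              exacts [h, hpm.trans h]
          · exact .inl (.inr ⟨upperHull_rightPart hi (.inr h), by simpa using hiR⟩)
      have h1 := (Set.ncard_le_ncard hsub (Set.toFinite _)).trans (Set.ncard_union_le _ _)
      have h2 := Set.ncard_union_le
        ({i | APt.pt i ∈ upperHull P (leftPart P Q m)} \ (L.toFinset : Set (Fin n)))
        ({i | APt.pt i ∈ upperHull P (rightPart P Q m)} \ (R.toFinset : Set (Fin n)))
      have h3 : ({p, q} : Set (Fin n)).ncard ≤ 2 := Set.ncard_insert_le p {q}|>.trans (by rw [Set.ncard_singleton])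
      have hLs : (L.toFinset : Set (Fin n)) ⊆ {i | APt.pt i ∈ upperHull P (leftPart P Q m)} :=
        fun i hi => ((hL.2 i).1 (by simpa using hi)).1
      have hRs : (R.toFinset : Set (Fin n)) ⊆ {i | APt.pt i ∈ upperHull P (rightPart P Q m)} :=
        fun i hi => ((hR.2 i).1 (by simpa using hi)).1
      have h4 := Set.ncard_sdiff_add_ncard_of_subset hLs (Set.toFinite _)
      have h5 := Set.ncard_sdiff_add_ncard_of_subset hRs (Set.toFinite _)
      rw [Set.ncard_coe_finset, List.toFinset_card_of_nodup hL.nodup] at h4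
      rw [Set.ncard_coe_finset, List.toFinset_card_of_nodup hR.nodup] at h5
      simp only [hullSize]
      omega
    · refine List.pairwise_append.2 ⟨hL.1, hR.1.tail, fun i hi j hj => ?_⟩
      have hj' : LtX P m j := by
        obtain ⟨R', hR'⟩ : ∃ R', R = m :: R' := by
          cases hRe : R with
          | nil => rw [hRe] at hmR; simp at hmR
          | cons x R' => rw [hRe] at hhead; exact ⟨R', by simpa using hhead⟩
        have := hR.1
        rw [hR'] at this hj
        exact List.rel_of_pairwise_cons this hj
      rcases hLm i hi with rfl | h
      exacts [hj', h.trans hj']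

/-- Weighted by 9, the hull size pays for a node: a chain vertex takes 4 words, and the chords, at
most as many, 5 words each. The constant 18 is 9 times the two points of a leaf; 64 is 10 words of
the record, plus 9 times the additive 4 of `NodeSpec.size_le`, plus one 18, because two subtrees
contribute it and one is kept. The halves share only the apex. -/
theorem IsPTTree.words_le (hP : Function.Injective P) {Q : Set (APt n)}
    {t : BinaryTree (NodeData n)} (h : IsPTTree P π Q t) :
    2 ≤ Q.ncard ∧ treeWords t + 9 * hullSize P Q ≤ 64 * (Q.ncard - 2) + 18 := by
  induction h with
  | @nil Q a b hab hQ =>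
    have h2 : Q.ncard = 2 := by rw [hQ]; exact Set.ncard_pair hab
    refine ⟨h2.ge, ?_⟩
    have : hullSize P Q ≤ Q.ncard := by
      refine Set.ncard_le_ncard_of_injOn APt.pt (fun i hi => hi.1) ?_ (Set.toFinite _)
      intro i _ j _ h
      exact APt.pt.inj h
    simp only [treeWords]
    omega
  | @node Q d l r hd _ _ ihl ihr =>
    obtain ⟨h1, h2⟩ := hd.size_le hP
    have hu : leftPart P Q d.apex ∪ rightPart P Q d.apex ⊆ Q := by rintro z (h | h) <;> exact h.1
    have hi : leftPart P Q d.apex ∩ rightPart P Q d.apex ⊆ {.pt d.apex} := by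
      rintro z ⟨⟨-, h | h⟩, ⟨-, h' | h'⟩⟩
      · exact h
      · exact h
      · exact h'
      · exact (h.asymm h').elim
    have e1 := Set.ncard_union_add_ncard_inter (leftPart P Q d.apex) (rightPart P Q d.apex)
    have e2 := Set.ncard_le_ncard hu (Set.toFinite _)
    have e3 := Set.ncard_le_ncard hi (Set.toFinite _)
    have e4 : ({.pt d.apex} : Set (APt n)).ncard = 1 := Set.ncard_singleton _
    simp only [treeWords]
    omega

theorem IsAugTree.words_le (hP : Function.Injective P) {S : AugTree n} (h : IsAugTree P π S) :
    S.words ≤ 86 * n := by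
  obtain ⟨ht, hh, -⟩ := h
  have hn : (Set.univ : Set (APt n)).ncard ≤ n + 2 := by
    have hs : (Set.univ : Set (APt n)) ⊆
        APt.pt '' (Set.univ : Set (Fin n)) ∪ {.negInf, .posInf} := fun z _ => by
      cases z <;> simp
    refine (Set.ncard_le_ncard hs (Set.toFinite _)).trans ((Set.ncard_union_le _ _).trans ?_)
    refine add_le_add ((Set.ncard_image_le (Set.toFinite _)).trans ?_) ?_
    · simp [Set.ncard_univ]
    · exact (Set.ncard_insert_le _ _).trans (by rw [Set.ncard_singleton])
  have hw := (ht.words_le hP).2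
  have hl : S.hull.numNodes ≤ n := by
    rw [numNodes_eq_length]
    simpa using hh.nodup.length_le_card
  rw [AugTree.words]
  -- The additive 18 is absorbed when there is a point; otherwise the tree is empty, because a node
  -- would have an apex in `Fin 0`.
  rcases Nat.eq_zero_or_pos n with rfl | hpos
  · cases hS : S.tree with
    | nil => simp only [treeWords]; omega
    | node d l r => exact d.apex.elim0
  · omega

end PseudoTri

/-! ### The program that finds the bridge and the chords of a funnel -/

namespace PseudoTri

open RealRAM

variable {n : ℕ} {P : Fin n → ℝ × ℝ} {π : Equiv.Perm (Fin n)}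

/-- Put the orientation of the points named in three registers into real register 0. -/
def orientInto (i j k : ℕ) : Prog :=
  blk [.rload 1 0 i, .rload 2 1 i, .rload 3 0 j, .rload 4 1 j, .rload 5 0 k, .rload 6 1 k,
    .rsub 3 3 1, .rsub 6 6 2, .rmul 3 3 6, .rsub 4 4 2, .rsub 5 5 1, .rmul 4 4 5, .rsub 0 3 4]

section orientInto

variable (i j k : ℕ) (σ : State)

@[simp] theorem orientInto_safe (W : ℕ) : (orientInto i j k).Safe W σ := by
  simp [orientInto, blk, Prog.Safe, Instr.Safe]

@[simp] theorem orientInto_reg : ((orientInto i j k).eff σ).reg = σ.reg := by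
  simp [orientInto, blk, Prog.eff, Instr.eff]

@[simp] theorem orientInto_rreg_nine : ((orientInto i j k).eff σ).rreg 9 = σ.rreg 9 := by
  simp [orientInto, blk, Prog.eff, Instr.eff]

@[simp] theorem orientInto_rreg_zero : ((orientInto i j k).eff σ).rreg 0 =
    orient (σ.rmem 0 (σ.reg i), σ.rmem 1 (σ.reg i)) (σ.rmem 0 (σ.reg j), σ.rmem 1 (σ.reg j))
      (σ.rmem 0 (σ.reg k), σ.rmem 1 (σ.reg k)) := by
  simp [orientInto, blk, Prog.eff, Instr.eff, orient]

end orientInto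

/-- The input, the constant registers, and zero in real register 9. -/
structure Base (P : Fin n → ℝ × ℝ) (π : Equiv.Perm (Fin n)) (σ : State) : Prop where
  points : HoldsPoints P π σ
  consts : Consts n σ
  zero : σ.rreg 9 = 0

theorem Base.frame {p : Prog} {σ σ' : State} (h : Base P π σ) (hF : Frame p σ σ')
    (hp : (List.range 5).all (fun r => !p.anyInstr (·.wReg r)) = true)
    (h10 : p.anyInstr (·.wMem 10) = false) (h9 : p.anyInstr (·.wRReg 9) = false)
    (hr : p.anyInstr (·.wRMem) = false) : Base P π σ' := by
  have hreg : ∀ r < 5, σ'.reg r = σ.reg r := fun r hr => hF.reg r (by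
    have := List.all_eq_true.1 hp r (List.mem_range.2 hr)
    simpa using this)
  refine ⟨fun i => ?_, ⟨?_, ?_, ?_, ?_, ?_⟩, (hF.rreg 9 h9).trans h.zero⟩
  · rw [hF.rmem hr, hF.mem 10 h10]; exact h.points i
  · exact (hreg 0 (by omega)).trans h.consts.r0
  · exact (hreg 1 (by omega)).trans h.consts.r1
  · exact (hreg 2 (by omega)).trans h.consts.r2
  · exact (hreg 3 (by omega)).trans h.consts.r3
  · exact (hreg 4 (by omega)).trans h.consts.r4

theorem HoldsPoints.pair {σ : State} (h : HoldsPoints P π σ) (i : Fin n) :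
    (σ.rmem 0 i, σ.rmem 1 i) = P i :=
  Prod.ext (h i).1 (h i).2.1

/-- Can the left end of the chord (registers 15 and 16) move? The answer is put into register 22, the
next vertex into register 27. -/
def probeLeft : Prog :=
  .seq (.instr (.const 22 0)) (.branch (.eq 15 12) .skip
    (.seq (.instr (.load 27 14 15)) (.branch (.eq 27 0) .skip
      (.seq (orientInto 15 16 27) (.branch (.rlt 9 0) (.instr (.const 22 1)) .skip)))))

/-- Can the right end of the chord (registers 15 and 16) move? The answer is put into register 23,
the next vertex into register 28. -/
def probeRight : Prog :=
  .seq (.instr (.const 23 0)) (.branch (.eq 16 13) .skip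
    (.seq (.instr (.load 28 13 16)) (.branch (.eq 28 1) .skip
      (.seq (orientInto 15 16 28) (.branch (.rlt 9 0) (.instr (.const 23 1)) .skip)))))

/-- Segment `k` links each vertex of `l` to the next one. The last vertex is `e` or is linked to
`f`, the others are different from `e`. -/
structure Linked (σ : State) (k : ℕ) (l : List (Fin n)) (e f : ℕ) : Prop where
  next : ∀ x y : Fin n, [x, y] <:+: l → σ.mem k x = y ∧ (x : ℕ) ≠ e
  last : ∀ x ∈ l.getLast?, (x : ℕ) = e ∨ σ.mem k x = f

theorem Linked.suffix {σ : State} {k e f : ℕ} {l l' : List (Fin n)} (h : Linked σ k l e f)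
    (hs : l' <:+ l) : Linked σ k l' e f := by
  obtain ⟨t, rfl⟩ := hs
  refine ⟨fun x y hxy => h.next x y (hxy.trans (List.suffix_append t l').isInfix), fun x hx => ?_⟩
  refine h.last x ?_
  rw [List.getLast?_append]
  simp_all

theorem Linked.congr {σ σ' : State} {k e f : ℕ} {l : List (Fin n)} (h : Linked σ k l e f)
    (hm : σ'.mem k = σ.mem k) : Linked σ' k l e f :=
  ⟨by rw [hm]; exact h.next, by rw [hm]; exact h.last⟩

/-- The hull list runs through all gaps. The movement must therefore stop when the left end is the
separator stored in register 12, or when the next item is the left dummy, whose code is `n`. -/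
theorem runs_probeLeft {W : ℕ} {σ : State} (hW : 2 ≤ W) (hB : Base P π σ) {x y : Fin n}
    {l : List (Fin n)} (h15 : σ.reg 15 = x) (h16 : σ.reg 16 = y)
    (hl : Linked σ 14 (x :: l) (σ.reg 12) n) :
    Runs W probeLeft σ 19 fun σ' => (∀ x' ∈ l.head?, σ'.reg 27 = x' ∧
      σ'.reg 22 = if 0 < orient (P x) (P y) (P x') then 1 else 0) ∧ (l = [] → σ'.reg 22 = 0) := by
  have h0 := hB.consts.r0
  have h9 := hB.zero
  cases l with
  | nil =>
    rcases hl.last x rfl with h | h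
    · refine Runs.free ?_ (by decide) ?_ <;>
        simp [probeLeft, Prog.Safe, Instr.Safe, Prog.eff, Instr.eff, Test.Holds, ← h, h15]
      omega
    · refine Runs.free ?_ (by decide) ?_ <;>
        simp [probeLeft, Prog.Safe, Instr.Safe, Prog.eff, Instr.eff, Test.Holds, h, h15, h0]
      omega
      split_ifs <;> simp
  | cons x' l =>
    obtain ⟨h, hne⟩ := hl.next x x' ⟨[], l, rfl⟩
    have hx' : (x' : ℕ) ≠ n := x'.isLt.ne
    by_cases ho : 0 < orient (P x) (P y) (P x') <;> refine Runs.free ?_ (by decide) ?_ <;>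
      simp [probeLeft, Prog.Safe, Instr.Safe, Prog.eff, Instr.eff, Test.Holds, h, h15, h0, hne, h16,
        hx', h9, hB.points.pair, ho, show 0 < W by omega, show 1 < W by omega]
    exact not_lt.1 ho

theorem runs_probeRight {W : ℕ} {σ : State} (hW : 2 ≤ W) (hB : Base P π σ) {x y : Fin n}
    {l : List (Fin n)} (h15 : σ.reg 15 = x) (h16 : σ.reg 16 = y)
    (hl : Linked σ 13 (y :: l) (σ.reg 13) (n + 1)) :
    Runs W probeRight σ 19 fun σ' => (∀ y' ∈ l.head?, σ'.reg 28 = y' ∧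
      σ'.reg 23 = if 0 < orient (P x) (P y) (P y') then 1 else 0) ∧ (l = [] → σ'.reg 23 = 0) := by
  have h1 := hB.consts.r1
  have h9 := hB.zero
  cases l with
  | nil =>
    rcases hl.last y rfl with h | h
    · refine Runs.free ?_ (by decide) ?_ <;>
        simp [probeRight, Prog.Safe, Instr.Safe, Prog.eff, Instr.eff, Test.Holds, ← h, h16]
      omega
    · refine Runs.free ?_ (by decide) ?_ <;>
        simp [probeRight, Prog.Safe, Instr.Safe, Prog.eff, Instr.eff, Test.Holds, h, h16, h1]
      omega
      split_ifs <;> simp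
  | cons y' l =>
    obtain ⟨h, hne⟩ := hl.next y y' ⟨[], l, rfl⟩
    have hy' : (y' : ℕ) ≠ n + 1 := by omega
    by_cases ho : 0 < orient (P x) (P y) (P y') <;> refine Runs.free ?_ (by decide) ?_ <;>
      simp [probeRight, Prog.Safe, Instr.Safe, Prog.eff, Instr.eff, Test.Holds, h, h15, h1, hne, h16,
        hy', h9, hB.points.pair, ho, show 0 < W by omega, show 1 < W by omega]
    exact not_lt.1 ho

/-! ### The movement of the chord to the bridge -/

/-- The chords found while the chord between the first vertices of two chains moves up to the
bridge, and the rests of the chains from the bridge on. -/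
inductive Merge (P : Fin n → ℝ × ℝ) (π : Equiv.Perm (Fin n)) :
    List (Fin n) → List (Fin n) → List (Fin n × Fin n) → List (Fin n) → List (Fin n) → Prop
  | base {x y : Fin n} {X Y : List (Fin n)} :
      (∀ x' ∈ X.head?, orient (P x) (P y) (P x') ≤ 0) →
      (∀ y' ∈ Y.head?, orient (P x) (P y) (P y') ≤ 0) →
      Merge P π (x :: X) (y :: Y) [] (x :: X) (y :: Y)
  | left {x x' y : Fin n} {X Y X₁ Y₁ : List (Fin n)} {T : List (Fin n × Fin n)} :
      0 < orient (P x) (P y) (P x') →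
      (∀ y' ∈ Y.head?, orient (P x) (P y) (P y') ≤ 0 ∨ π y ≤ π x) →
      Merge P π (x' :: X) (y :: Y) T X₁ Y₁ → Merge P π (x :: x' :: X) (y :: Y) ((x, y) :: T) X₁ Y₁
  | right {x y y' : Fin n} {X Y X₁ Y₁ : List (Fin n)} {T : List (Fin n × Fin n)} :
      0 < orient (P x) (P y) (P y') →
      (∀ x' ∈ X.head?, orient (P x) (P y) (P x') ≤ 0 ∨ π x < π y) →
      Merge P π (x :: X) (y' :: Y) T X₁ Y₁ → Merge P π (x :: X) (y :: y' :: Y) ((x, y) :: T) X₁ Y₁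

/-- Every move shortens one of the two lists. If both ends can move, the comparison of the
priorities selects one of the two rules. -/
theorem Merge.exists (P : Fin n → ℝ × ℝ) (π : Equiv.Perm (Fin n)) : ∀ (x y : Fin n)
    (X Y : List (Fin n)), ∃ T X₁ Y₁, Merge P π (x :: X) (y :: Y) T X₁ Y₁ := by
  suffices H : ∀ (k : ℕ) (x y : Fin n) (X Y : List (Fin n)), X.length + Y.length = k →
      ∃ T X₁ Y₁, Merge P π (x :: X) (y :: Y) T X₁ Y₁ from fun x y X Y => H _ x y X Y rfl
  intro k
  induction k with
  | zero =>
    intro x y X Y h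
    obtain rfl : X = [] := List.length_eq_zero_iff.1 (by omega)
    obtain rfl : Y = [] := List.length_eq_zero_iff.1 (by omega)
    exact ⟨_, _, _, .base (by simp) (by simp)⟩
  | succ k ih =>
    intro x y X Y h
    by_cases hl : (∃ x' ∈ X.head?, 0 < orient (P x) (P y) (P x')) ∧
        ∀ y' ∈ Y.head?, orient (P x) (P y) (P y') ≤ 0 ∨ π y ≤ π x
    · obtain ⟨⟨x', hx', ho⟩, h'⟩ := hl
      cases X with
      | nil => simp at hx'
      | cons x'' X =>
        obtain rfl : x'' = x' := by simpa using hx'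
        obtain ⟨T, X₁, Y₁, hm⟩ := ih x'' y X Y (by simp at h; omega)
        exact ⟨_, _, _, .left ho h' hm⟩
    by_cases hr : ∃ y' ∈ Y.head?, 0 < orient (P x) (P y) (P y')
    · obtain ⟨y', hy', ho⟩ := hr
      cases Y with
      | nil => simp at hy'
      | cons y'' Y =>
        obtain rfl : y'' = y' := by simpa using hy'
        obtain ⟨T, X₁, Y₁, hm⟩ := ih x y'' X Y (by simp at h; omega)
        refine ⟨_, _, _, .right ho (fun x' hx' => ?_) hm⟩
        by_contra! hc
        exact hl ⟨⟨x', hx', hc.1⟩, fun _ _ => .inr hc.2⟩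
    · push Not at hr
      refine ⟨_, _, _, .base (fun x' hx' => ?_) hr⟩
      by_contra! hc
      exact hl ⟨⟨x', hx', hc⟩, fun y' hy' => .inl (hr y' hy')⟩

/-- The visited prefixes, up to and including the ends of the bridge, form a staircase with the
bridge as base. The bridge ends occur both as last vertices of the prefixes and as first vertices of
the remaining lists. -/
theorem Merge.stair {XA YA X₁ Y₁ : List (Fin n)} {T : List (Fin n × Fin n)}
    (h : Merge P π XA YA T X₁ Y₁) : ∃ X Y X' Y' p q, X₁ = p :: X' ∧ Y₁ = q :: Y' ∧
      XA = X ++ X' ∧ YA = Y ++ Y' ∧ Stair P π X Y T ∧ p ∈ X.getLast? ∧ q ∈ Y.getLast? ∧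
      (∀ x ∈ X'.head?, orient (P p) (P q) (P x) ≤ 0) ∧
      ∀ y ∈ Y'.head?, orient (P p) (P q) (P y) ≤ 0 := by
  induction h with
  | @base x y X Y h1 h2 =>
    exact ⟨[x], [y], X, Y, x, y, rfl, rfl, rfl, rfl, .base x y, rfl, rfl, h1, h2⟩
  | @left x x' y _ _ _ _ _ h1 h2 _ ih =>
    obtain ⟨X, Y, X', Y', p, q, e1, e2, e3, e4, hs, hp, hq, h3, h4⟩ := ih
    cases X with
    | nil => simp at hp
    | cons u X =>
      cases Y with
      | nil => simp at hq
      | cons v Y =>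
        simp only [List.cons_append, List.cons.injEq] at e3 e4
        obtain ⟨rfl, rfl⟩ := e3
        obtain ⟨rfl, rfl⟩ := e4
        refine ⟨x :: x' :: X, y :: Y, X', Y', p, q, e1, e2, rfl, rfl, .left h1 ?_ hs, ?_, hq, h3, h4⟩
        · intro y' hy'
          refine h2 y' ?_
          cases Y <;> simp_all
        · simpa using hp
  | @right x y y' _ _ _ _ _ h1 h2 _ ih =>
    obtain ⟨X, Y, X', Y', p, q, e1, e2, e3, e4, hs, hp, hq, h3, h4⟩ := ih
    cases X with
    | nil => simp at hp
    | cons u X =>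
      cases Y with
      | nil => simp at hq
      | cons v Y =>
        simp only [List.cons_append, List.cons.injEq] at e3 e4
        obtain ⟨rfl, rfl⟩ := e3
        obtain ⟨rfl, rfl⟩ := e4
        refine ⟨x :: X, y :: y' :: Y, X', Y', p, q, e1, e2, rfl, rfl, .right h1 ?_ hs, hp, ?_, h3, h4⟩
        · intro x' hx'
          refine (h2 x' ?_).imp id le_of_lt
          cases X <;> simp_all
        · simpa using hq

/-- Append the chord in registers 15 and 16 to the list in segments 18 and 19. -/
def emitChord : Prog := blk [.store 18 17 15, .store 19 17 16, .add 17 17 2]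

/-- Move the chord, if register 22 or 23 says that its left or right end can move. -/
def moveChord : Prog :=
  .branch (.lt 4 22)
    (.seq emitChord (.branch (.lt 4 23)
      (.seq (blk [.load 29 10 15, .load 30 10 16])
        (.branch (.lt 29 30) (.instr (.move 16 28)) (.instr (.move 15 27))))
      (.instr (.move 15 27))))
    (.branch (.lt 4 23) (.seq emitChord (.instr (.move 16 28))) (.instr (.const 21 0)))

/-- Move the chord from its initial position in registers 15 and 16 up to the bridge. -/
def findBridge : Prog :=
  .seq (blk [.const 17 0, .const 21 1])
    (.loop (.lt 4 21) (.seq probeLeft (.seq probeRight moveChord)))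

/-- The chords of `T` are listed in segments 18 and 19. -/
structure HoldsChords (T : List (Fin n × Fin n)) (σ : State) : Prop where
  len : σ.reg 17 = T.length
  fst : ∀ i (hi : i < T.length), σ.mem 18 i = T[i].1
  snd : ∀ i (hi : i < T.length), σ.mem 19 i = T[i].2

theorem HoldsChords.append {T : List (Fin n × Fin n)} {σ σ' : State} (h : HoldsChords T σ)
    {x y : Fin n} (h17 : σ'.reg 17 = T.length + 1)
    (h18 : ∀ i, σ'.mem 18 i = if i = T.length then (x : ℕ) else σ.mem 18 i)
    (h19 : ∀ i, σ'.mem 19 i = if i = T.length then (y : ℕ) else σ.mem 19 i) :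
    HoldsChords (T ++ [(x, y)]) σ' := by
  refine ⟨by simpa using h17, fun i hi => ?_, fun i hi => ?_⟩
  · rw [h18]
    split_ifs with hc
    · simp [hc]
    · have : i < T.length := by simp at hi; omega
      rw [h.fst i this, List.getElem_append_left this]
  · rw [h19]
    split_ifs with hc
    · simp [hc]
    · have : i < T.length := by simp at hi; omega
      rw [h.snd i this, List.getElem_append_left this]

theorem runs_moveChord {W : ℕ} {σ : State} (hB : Base P π σ) {x y : Fin n}
    {X Y X₁ Y₁ : List (Fin n)} {T T₀ : List (Fin n × Fin n)} (hW : T₀.length + 2 < W)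
    (hm : Merge P π (x :: X) (y :: Y) T X₁ Y₁) (hT : HoldsChords T₀ σ)
    (h15 : σ.reg 15 = x) (h16 : σ.reg 16 = y) (h21 : σ.reg 21 = 1)
    (hx : ∀ x' ∈ X.head?, σ.reg 27 = x' ∧ σ.reg 22 = if 0 < orient (P x) (P y) (P x') then 1 else 0)
    (hy : ∀ y' ∈ Y.head?, σ.reg 28 = y' ∧ σ.reg 23 = if 0 < orient (P x) (P y) (P y') then 1 else 0)
    (hx' : X = [] → σ.reg 22 = 0) (hy' : Y = [] → σ.reg 23 = 0) :
    Runs W moveChord σ 9 fun σ' =>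
      (σ'.reg 21 = 0 ∧ T = [] ∧ x :: X = X₁ ∧ y :: Y = Y₁ ∧ HoldsChords T₀ σ' ∧
        σ'.reg 15 = x ∧ σ'.reg 16 = y) ∨
      σ'.reg 21 = 1 ∧ ∃ x' y' X' Y' c T', T = c :: T' ∧ Merge P π (x' :: X') (y' :: Y') T' X₁ Y₁ ∧
        x' :: X' <:+ x :: X ∧ y' :: Y' <:+ y :: Y ∧ HoldsChords (T₀ ++ [c]) σ' ∧
        σ'.reg 15 = x' ∧ σ'.reg 16 = y' := by
  have h4 := hB.consts.r4
  have h2 := hB.consts.r2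
  have h17 := hT.len
  have px := (hB.points x).2.2
  have py := (hB.points y).2.2
  cases hm with
  | base h1 h2 =>
    have e22 : σ.reg 22 = 0 := by
      cases X with
      | nil => exact hx' rfl
      | cons x' X => rw [(hx x' rfl).2, if_neg (h1 x' rfl).not_gt]
    have e23 : σ.reg 23 = 0 := by
      cases Y with
      | nil => exact hy' rfl
      | cons y' Y => rw [(hy y' rfl).2, if_neg (h2 y' rfl).not_gt]
    refine Runs.free ?_ (by decide) (.inl ⟨?_, rfl, rfl, rfl, ⟨?_, ?_, ?_⟩, ?_, ?_⟩)
    · simp [moveChord, Prog.Safe, Instr.Safe, Test.Holds, e22, e23, h4]; omega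
    all_goals simp [moveChord, Prog.eff, Instr.eff, Test.Holds, *]
    · exact hT.fst
    · exact hT.snd
  | @left _ u _ X' _ _ _ T' h1 h3 hm =>
    obtain ⟨e27, e22⟩ := hx u rfl
    rw [if_pos h1] at e22
    by_cases e23 : 0 < σ.reg 23
    · have hπ : ¬ (π x : ℕ) < π y := by
        cases Y with
        | nil => exact absurd (hy' rfl) (by omega)
        | cons y' Y =>
          have := (hy y' rfl).2
          rcases h3 y' rfl with h | h
          · rw [if_neg h.not_gt] at this; omega
          · exact not_lt.2 h
      refine Runs.free ?_ (by decide) (.inr ⟨?_, u, y, X', Y, _, T', rfl, hm,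
        List.suffix_cons _ _, List.suffix_refl _, hT.append ?_ ?_ ?_, ?_, ?_⟩)
      · simp [moveChord, emitChord, blk, Prog.Safe, Instr.Safe, Prog.eff, Instr.eff, Test.Holds,
          e22, e23, h4, h2, h17]; omega
      all_goals simp [moveChord, emitChord, blk, Prog.eff, Instr.eff, Test.Holds, *]
    · refine Runs.free ?_ (by decide) (.inr ⟨?_, u, y, X', Y, _, T', rfl, hm,
        List.suffix_cons _ _, List.suffix_refl _, hT.append ?_ ?_ ?_, ?_, ?_⟩)
      · simp [moveChord, emitChord, blk, Prog.Safe, Instr.Safe, Prog.eff, Instr.eff, Test.Holds,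
          e22, e23, h4, h2, h17]; omega
      all_goals simp [moveChord, emitChord, blk, Prog.eff, Instr.eff, Test.Holds, *]
  | @right _ _ v _ Y' _ _ T' h1 h3 hm =>
    obtain ⟨e28, e23⟩ := hy v rfl
    rw [if_pos h1] at e23
    by_cases e22 : 0 < σ.reg 22
    · have hπ : (π x : ℕ) < π y := by
        cases X with
        | nil => exact absurd (hx' rfl) (by omega)
        | cons x' X =>
          have := (hx x' rfl).2
          rcases h3 x' rfl with h | h
          · rw [if_neg h.not_gt] at this; omega
          · exact h
      refine Runs.free ?_ (by decide) (.inr ⟨?_, x, v, X, Y', _, T', rfl, hm,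
        List.suffix_refl _, List.suffix_cons _ _, hT.append ?_ ?_ ?_, ?_, ?_⟩)
      · simp [moveChord, emitChord, blk, Prog.Safe, Instr.Safe, Prog.eff, Instr.eff, Test.Holds,
          e22, e23, h4, h2, h17]; omega
      all_goals simp [moveChord, emitChord, blk, Prog.eff, Instr.eff, Test.Holds, *]
    · refine Runs.free ?_ (by decide) (.inr ⟨?_, x, v, X, Y', _, T', rfl, hm,
        List.suffix_refl _, List.suffix_cons _ _, hT.append ?_ ?_ ?_, ?_, ?_⟩)
      · simp [moveChord, emitChord, blk, Prog.Safe, Instr.Safe, Prog.eff, Instr.eff, Test.Holds,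
          e22, e23, h4, h2, h17]; omega
      all_goals simp [moveChord, emitChord, blk, Prog.eff, Instr.eff, Test.Holds, *]

/-- A round costs 48 steps: 19 for each probe, 9 for the move and 1 for the loop test. There is one
round for each chord and a last one that clears the flag in register 21. -/
theorem runs_findBridge {W : ℕ} {σ : State} (hB : Base P π σ) {x y : Fin n}
    {X Y X₁ Y₁ : List (Fin n)} {T : List (Fin n × Fin n)} (hW : T.length + 2 < W)
    (hm : Merge P π (x :: X) (y :: Y) T X₁ Y₁) (h15 : σ.reg 15 = x) (h16 : σ.reg 16 = y)
    (hl : Linked σ 14 (x :: X) (σ.reg 12) n) (hr : Linked σ 13 (y :: Y) (σ.reg 13) (n + 1)) :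
    Runs W findBridge σ (48 * T.length + 51) fun σ' => HoldsChords T σ' ∧
      ∃ p q X' Y', X₁ = p :: X' ∧ Y₁ = q :: Y' ∧ σ'.reg 15 = p ∧ σ'.reg 16 = q := by
  refine Runs.seq (a := 2) (b := 48 * T.length + 49)
    (R := fun s => s.reg 17 = 0 ∧ s.reg 21 = 1) (Runs.free ?_ (by decide) ?_)
    ?_ (by omega)
  · simp [blk, Prog.Safe, Instr.Safe]; omega
  · simp [blk, Prog.eff, Instr.eff]
  rintro s1 f1 ⟨a17, a21⟩
  refine (Runs.loop s1 (fun b s => ∃ T₀ T₁ x' y' X' Y', T = T₀ ++ T₁ ∧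
    Merge P π (x' :: X') (y' :: Y') T₁ X₁ Y₁ ∧ x' :: X' <:+ x :: X ∧ y' :: Y' <:+ y :: Y ∧
    HoldsChords T₀ s ∧ s.reg 15 = x' ∧ s.reg 16 = y' ∧
    (s.reg 21 = 1 ∧ b = 48 * (T₁.length + 1) ∨
      s.reg 21 = 0 ∧ T₁ = [] ∧ x' :: X' = X₁ ∧ y' :: Y' = Y₁)) ?_ (b := 48 * (T.length + 1)) ?_).mono le_rfl ?_
  · rintro b s ⟨T₀, T₁, x', y', X', Y', rfl, hm', sX, sY, hT, e15, e16, hb⟩ hF hc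
    have hBs : Base P π s := (hB.frame f1 rfl rfl rfl rfl).frame hF rfl rfl rfl rfl
    have e4 := hBs.consts.r4
    have e21 : s.reg 21 = 1 ∧ b = 48 * (T₁.length + 1) := by
      rcases hb with hb | hb
      · exact hb
      · simp [Test.Holds, e4, hb.1] at hc
    have hlen : T₀.length ≤ (T₀ ++ T₁).length := by simp
    have hl' : Linked s 14 (x' :: X') (s.reg 12) n := by
      rw [(hF.reg 12 rfl).trans (f1.reg 12 rfl)]
      exact (hl.suffix sX).congr ((hF.mem 14 rfl).trans (f1.mem 14 rfl))
    have hr' : Linked s 13 (y' :: Y') (s.reg 13) (n + 1) := by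
      rw [(hF.reg 13 rfl).trans (f1.reg 13 rfl)]
      exact (hr.suffix sY).congr ((hF.mem 13 rfl).trans (f1.mem 13 rfl))
    refine ⟨47, Runs.seq (a := 19) (b := 28) (runs_probeLeft (by omega) hBs e15 e16 hl') ?_ le_rfl⟩
    rintro s2 f2 ⟨c1, c2⟩
    have hB2 := hBs.frame f2 rfl rfl rfl rfl
    refine Runs.seq (a := 19) (b := 9) (runs_probeRight (by omega) hB2 ((f2.reg 15 rfl).trans e15)
      ((f2.reg 16 rfl).trans e16) (l := Y') ?_) ?_ le_rfl
    · rw [f2.reg 13 rfl]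
      exact hr'.congr (f2.mem 13 rfl)
    rintro s3 f3 ⟨c3, c4⟩
    have hB3 := hB2.frame f3 rfl rfl rfl rfl
    refine (runs_moveChord hB3 (T₀ := T₀) (by omega) hm' ⟨?_, ?_, ?_⟩ ?_ ?_ ?_ ?_ c3 ?_ c4).mono
      le_rfl ?_
    · rw [f3.reg 17 rfl, f2.reg 17 rfl, hT.len]
    · rw [f3.mem 18 rfl, f2.mem 18 rfl]; exact hT.fst
    · rw [f3.mem 19 rfl, f2.mem 19 rfl]; exact hT.snd
    · rw [f3.reg 15 rfl, f2.reg 15 rfl, e15]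
    · rw [f3.reg 16 rfl, f2.reg 16 rfl, e16]
    · rw [f3.reg 21 rfl, f2.reg 21 rfl, e21.1]
    · rw [f3.reg 27 rfl, f3.reg 22 rfl]; exact c1
    · rw [f3.reg 22 rfl]; exact c2
    rintro s4 - (⟨d21, rfl, d1, d2, hT4, d15, d16⟩ |
      ⟨d21, x'', y'', X'', Y'', c, T', rfl, hm'', sX', sY', hT4, d15, d16⟩)
    · exact ⟨0, by rw [e21.2]; simp, T₀, [], x', y', X', Y', rfl, hm', sX, sY, hT4, d15, d16,
        .inr ⟨d21, rfl, d1, d2⟩⟩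
    · exact ⟨48 * (T'.length + 1), by rw [e21.2]; simp; omega, T₀ ++ [c], T', x'', y'', X'', Y'',
        by simp, hm'', sX'.trans sX, sY'.trans sY, hT4, d15, d16, .inl ⟨d21, rfl⟩⟩
  · exact ⟨[], T, x, y, X, Y, rfl, hm, List.suffix_refl _, List.suffix_refl _,
      ⟨a17, by simp, by simp⟩, (f1.reg 15 rfl).trans h15, (f1.reg 16 rfl).trans h16,
      .inl ⟨a21, rfl⟩⟩
  · rintro s - ⟨⟨b, T₀, T₁, x', y', X', Y', rfl, hm', sX, sY, hT, e15, e16, hb⟩, hF, hc⟩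
    have e4 : s.reg 4 = 0 := (hF.reg 4 rfl).trans ((f1.reg 4 rfl).trans hB.consts.r4)
    rcases hb with hb | ⟨-, rfl, h1, h2⟩
    · simp [Test.Holds, e4, hb.1] at hc
    · exact ⟨by simpa using hT, x', y', X', Y', h1.symm, h2.symm, e15, e16⟩

end PseudoTri

/-! ### Consecutive points of a set, and one step of the sweep over the priorities -/

namespace PseudoTri

variable {n : ℕ} {P : Fin n → ℝ × ℝ} {π : Equiv.Perm (Fin n)}

/-- `a` and `b` are consecutive members of `S`. -/
structure Consec (P : Fin n → ℝ × ℝ) (S : Set (APt n)) (a b : APt n) : Prop where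
  left : a ∈ S
  right : b ∈ S
  lt : ALtX P a b
  not_between : ∀ c ∈ S, ALtX P a c → ¬ ALtX P c b

theorem exists_next {S : Set (APt n)} {a b : APt n} (ha : a ∈ S) (hb : b ∈ S) (h : ALtX P a b) :
    ∃ c, Consec P S a c := by
  have : IsTrans (APt n) (ALtX P) := ⟨fun _ _ _ => ALtX.trans⟩
  have : Std.Irrefl (ALtX P) := ⟨ALtX.irrefl⟩
  have hwf : WellFounded (ALtX P) := Finite.wellFounded_of_trans_of_irrefl _
  obtain ⟨c, ⟨hc, hac⟩, hmin⟩ := hwf.has_min {c | c ∈ S ∧ ALtX P a c} ⟨b, hb, h⟩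
  exact ⟨c, ha, hc, hac, fun d hd had hdc => hmin d ⟨hd, had⟩ hdc⟩

theorem exists_prev {S : Set (APt n)} {a b : APt n} (ha : a ∈ S) (hb : b ∈ S) (h : ALtX P a b) :
    ∃ c, Consec P S c b := by
  have : IsTrans (APt n) (Function.swap (ALtX P)) := ⟨fun _ _ _ h h' => ALtX.trans h' h⟩
  have : Std.Irrefl (Function.swap (ALtX P)) := ⟨ALtX.irrefl⟩
  have hwf : WellFounded (Function.swap (ALtX P)) := Finite.wellFounded_of_trans_of_irrefl _
  obtain ⟨c, ⟨hc, hac⟩, hmin⟩ := hwf.has_min {c | c ∈ S ∧ ALtX P c b} ⟨a, ha, h⟩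
  exact ⟨c, hc, hb, hac, fun d hd had hdc => hmin d ⟨hd, hdc⟩ had⟩

theorem Consec.right_unique (hP : Function.Injective P) {S : Set (APt n)} {a b c : APt n}
    (h : Consec P S a b) (h' : Consec P S a c) : b = c := by
  by_contra hne
  rcases ALtX.total hP hne with hlt | hlt
  · exact h'.not_between b h.right h.lt hlt
  · exact h.not_between c h'.right h'.lt hlt

theorem Consec.left_unique (hP : Function.Injective P) {S : Set (APt n)} {a b c : APt n}
    (h : Consec P S a c) (h' : Consec P S b c) : a = b := by
  by_contra hne
  rcases ALtX.total hP hne with hlt | hlt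
  · exact h.not_between b h'.left hlt h'.lt
  · exact h'.not_between a h.left hlt h.lt

theorem Consec.le_or_le (hP : Function.Injective P) {S : Set (APt n)} {a b c : APt n}
    (h : Consec P S a b) (hc : c ∈ S) : (c = a ∨ ALtX P c a) ∨ (c = b ∨ ALtX P b c) := by
  by_contra! hne
  obtain ⟨⟨h1, h2⟩, h3, h4⟩ := hne
  exact h.not_between c hc ((ALtX.total hP h1).resolve_left h2)
    ((ALtX.total hP h3).resolve_right h4)

/-- What remains of `S` when the points strictly between `p` and `q` are removed. -/
def cut (P : Fin n → ℝ × ℝ) (S : Set (APt n)) (p q : APt n) : Set (APt n) :=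
  {z ∈ S | ¬ (ALtX P p z ∧ ALtX P z q)}

theorem Consec.cut_self {S : Set (APt n)} {p q : APt n} (hp : p ∈ S) (hq : q ∈ S)
    (h : ALtX P p q) : Consec P (cut P S p q) p q where
  left := ⟨hp, fun h => ALtX.irrefl _ h.1⟩
  right := ⟨hq, fun h => ALtX.irrefl _ h.2⟩
  lt := h
  not_between _ hc h1 h2 := hc.2 ⟨h1, h2⟩

/-- After the cut `p` and `q` are consecutive, so any other consecutive pair lies entirely on one
side of the removed stretch and was consecutive before. -/
theorem Consec.of_cut (hP : Function.Injective P) {S : Set (APt n)} {p q a b : APt n} (hp : p ∈ S)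
    (hq : q ∈ S) (hpq : ALtX P p q) (h : Consec P (cut P S p q) a b) :
    (a = p ∧ b = q) ∨ (a ≠ p ∧ b ≠ q ∧ Consec P S a b) := by
  have h0 := Consec.cut_self hp hq hpq
  by_cases ha : a = p
  · exact .inl ⟨ha, h.right_unique hP (ha ▸ h0)⟩
  by_cases hb : b = q
  · exact .inl ⟨h.left_unique hP (hb ▸ h0), hb⟩
  refine .inr ⟨ha, hb, h.left.1, h.right.1, h.lt, fun c hc h1 h2 => ?_⟩
  have hc' : ALtX P p c ∧ ALtX P c q := by
    by_contra hn
    exact h.not_between c ⟨hc, hn⟩ h1 h2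
  rcases ALtX.total hP ha with h3 | h3
  · exact h.not_between p h0.left h3 (hc'.1.trans h2)
  · exact h.left.2 ⟨h3, h1.trans hc'.2⟩

theorem APt.code_injective : Function.Injective (APt.code (n := n)) := by
  intro x y h
  rcases x with _ | i | _ <;> rcases y with _ | j | _ <;> simp only [APt.code] at h <;>
    first | rfl | omega | (congr 1; exact Fin.ext h)

theorem APt.code_le (z : APt n) : z.code ≤ n + 1 := by
  rcases z with _ | i | _ <;> simp [APt.code]; omega

/-! ### Separators and hull lists at a given priority -/

/-- The points that are endpoints of a pseudo-triangle when the points of priority above `t` have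
been treated. -/
def seps (π : Equiv.Perm (Fin n)) (t : ℕ) : Set (APt n) :=
  {z | ∀ i, z = .pt i → (π i : ℕ) < t}

theorem pt_mem_seps {t : ℕ} {i : Fin n} : APt.pt i ∈ seps π t ↔ (π i : ℕ) < t := by
  simp [seps]

theorem negInf_mem_seps {t : ℕ} : APt.negInf ∈ seps π t := by simp [seps]

theorem posInf_mem_seps {t : ℕ} : APt.posInf ∈ seps π t := by simp [seps]

theorem seps_zero : seps π 0 = {.negInf, .posInf} := by
  ext z
  rcases z with _ | i | _ <;> simp [seps]

theorem seps_all : seps π n = Set.univ := by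
  ext z
  simp [seps]

/-- The treated apex is the only separator strictly between its two neighbours, so the list of
separators and the hull list undergo the same kind of change. -/
theorem seps_eq_cut {t : ℕ} {m : Fin n} (hm : (π m : ℕ) = t) {a b : APt n} (hP : Function.Injective P)
    (ha : Consec P (seps π (t + 1)) a (.pt m)) (hb : Consec P (seps π (t + 1)) (.pt m) b) :
    seps π t = cut P (seps π (t + 1)) a b := by
  have hne : ∀ z, z ∈ seps π t ↔ z ∈ seps π (t + 1) ∧ z ≠ .pt m := by
    rintro (_ | i | _)
    · simp [seps]
    · simp only [pt_mem_seps, ne_eq, APt.pt.injEq]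
      constructor
      · exact fun h => ⟨by omega, by rintro rfl; omega⟩
      · rintro ⟨h, h'⟩
        rcases Nat.lt_succ_iff_lt_or_eq.1 h with h | h
        · exact h
        · exact absurd (π.injective (Fin.ext (h.trans hm.symm))) h'
    · simp [seps]
  ext z
  rw [hne]
  refine and_congr_right fun hz => ⟨fun h ⟨h1, h2⟩ => ?_, ?_⟩
  · rcases ALtX.total hP h with h' | h'
    · exact ha.not_between z hz h1 h'
    · exact hb.not_between z hz h' h2
  · rintro h rfl
    exact h ⟨ha.lt, hb.lt⟩

theorem Pairwise.not_between {α : Type} {r : α → α → Prop} (hirr : ∀ x, ¬ r x x)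
    (htr : ∀ x y z, r x y → r y z → r x z) {l : List α} (hl : l.Pairwise r) {x y z : α}
    (hxy : [x, y] <:+: l) (hz : z ∈ l) (h1 : r x z) : ¬ r z y := by
  obtain ⟨s, t, rfl⟩ := hxy
  intro h2
  simp only [List.append_assoc, List.cons_append, List.nil_append, List.pairwise_append,
    List.pairwise_cons, List.mem_append, List.mem_cons] at hl hz
  rcases hz with hz | rfl | rfl | hz
  · exact hirr _ (htr _ _ _ h1 (hl.2.2 z hz x (.inl rfl)))
  · exact hirr _ h1
  · exact hirr _ h2
  · exact hirr _ (htr _ _ _ h2 (hl.2.1.2.1 z hz))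

theorem Pairwise.rel_getLast? {α : Type} {r : α → α → Prop} {l : List α} (hl : l.Pairwise r)
    {x z : α} (hx : x ∈ l.getLast?) (hz : z ∈ l) : z = x ∨ r z x := by
  obtain ⟨l', rfl⟩ := List.getLast?_eq_some_iff.1 (Option.mem_def.1 hx)
  rw [List.pairwise_append] at hl
  rcases List.mem_append.1 hz with h | h
  · exact .inr (hl.2.2 z h x (by simp))
  · exact .inl (by simpa using h)

theorem exists_sorted (hP : Function.Injective P) (S : Set (Fin n)) :
    ∃ l : List (Fin n), l.Pairwise (LtX P) ∧ ∀ i, i ∈ l ↔ i ∈ S := by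
  classical
  have h1 := List.pairwise_mergeSort (le := fun i j : Fin n => decide (¬ LtX P j i))
    (fun a b c hab hbc => by
      simp only [decide_eq_true_eq] at hab hbc ⊢
      intro hca
      by_cases h : a = b
      · exact hbc (h ▸ hca)
      · rcases LtX.total hP h with h | h
        · exact hbc (hca.trans h)
        · exact hab h)
    (fun a b => by
      simp only [Bool.or_eq_true, decide_eq_true_eq]
      by_contra! h
      exact LtX.irrefl _ (h.1.trans h.2)) (List.finRange n)
  have h2 : ((List.finRange n).mergeSort fun i j => decide (¬ LtX P j i)).Nodup :=
    (List.mergeSort_perm _ _).nodup_iff.2 (List.nodup_finRange n)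
  refine ⟨((List.finRange n).mergeSort fun i j => decide (¬ LtX P j i)).filter (· ∈ S), ?_, ?_⟩
  · refine List.Pairwise.filter _ ((h1.and h2).imp fun {i j} h => ?_)
    simp only [decide_eq_true_eq] at h
    exact (LtX.total hP h.2).resolve_right h.1
  · simp [(List.mergeSort_perm _ _).mem_iff]

theorem mem_upperHull_left {a b : APt n} (h : ALtX P a b) : a ∈ upperHull P (gap P a b) := by
  refine ⟨(isLeft_gap h).1, ?_⟩
  rintro x y z rfl hx - hxy -
  rcases (isLeft_gap h).2 _ hx (by rintro ⟨⟩; exact LtX.irrefl _ hxy) with hc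
  exact absurd (LtX.trans hc hxy) (LtX.irrefl _)

theorem mem_upperHull_right {a b : APt n} (h : ALtX P a b) : b ∈ upperHull P (gap P a b) := by
  refine ⟨(isRight_gap h).1, ?_⟩
  rintro x y z rfl - hz - hyz
  rcases (isRight_gap h).2 _ hz (by rintro ⟨⟩; exact LtX.irrefl _ hyz) with hc
  exact absurd (LtX.trans hc hyz) (LtX.irrefl _)

theorem mem_gap_iff {a b z : APt n} (hz : z = a ∨ ALtX P a z) (hz' : z = b ∨ ALtX P z b) :
    z ∈ gap P a b := by
  rcases hz with rfl | hz
  · exact .inl rfl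
  · rcases hz' with rfl | hz'
    · exact .inr (.inl rfl)
    · exact .inr (.inr ⟨hz, hz'⟩)

theorem le_of_mem_gap {a b z : APt n} (h : ALtX P a b) (hz : z ∈ gap P a b) :
    (z = a ∨ ALtX P a z) ∧ (z = b ∨ ALtX P z b) := by
  rcases hz with rfl | rfl | hz
  · exact ⟨.inl rfl, .inr h⟩
  · exact ⟨.inr h, .inl rfl⟩
  · exact ⟨.inr hz.1, .inr hz.2⟩

theorem exists_pt_of_between {x y c : APt n} (h1 : ALtX P x c) (h2 : ALtX P c y) : ∃ i, c = .pt i := by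
  cases c with
  | negInf => cases x <;> simp [ALtX] at h1
  | posInf => simp [ALtX] at h2
  | pt i => exact ⟨i, rfl⟩

/-- The upper hulls of two adjacent gaps, as lists, together with the fact that their neighbouring
members are consecutive in `C`. -/
structure HullLists (P : Fin n → ℝ × ℝ) (π : Equiv.Perm (Fin n)) (C : Set (APt n)) (a b : APt n)
    (m : Fin n) (XA YA : List (Fin n)) : Prop extends GapPair P π a b m XA YA where
  adjX : ∀ x y, [x, y] <:+: m :: XA → Consec P C (.pt y) (.pt x) ∧ .pt x ≠ a
  lastX : ∀ x ∈ (m :: XA).getLast?, .pt x = a ∨ Consec P C .negInf (.pt x)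
  adjY : ∀ x y, [x, y] <:+: m :: YA → Consec P C (.pt x) (.pt y) ∧ .pt x ≠ b
  lastY : ∀ x ∈ (m :: YA).getLast?, .pt x = b ∨ Consec P C (.pt x) .posInf

/-- Within each gap the set `C` coincides with the hull, so sorted hull vertices are consecutive in
`C`. The lists contain proper points only: if a gap ends in a dummy, the last listed vertex is the
neighbour of that dummy. -/
theorem exists_hullLists (hP : Function.Injective P) {C : Set (APt n)} {a b : APt n} {m : Fin n}
    (hn : .negInf ∈ C) (hp : .posInf ∈ C)
    (h1 : ALtX P a (.pt m)) (h2 : ALtX P (.pt m) b)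
    (hmin : ∀ i, ALtX P a (.pt i) → ALtX P (.pt i) b → π m ≤ π i)
    (hL : ∀ z ∈ gap P a (.pt m), z ∈ C ↔ z ∈ upperHull P (gap P a (.pt m)))
    (hR : ∀ z ∈ gap P (.pt m) b, z ∈ C ↔ z ∈ upperHull P (gap P (.pt m) b)) :
    ∃ XA YA, HullLists P π C a b m XA YA := by
  have gt_trans : ∀ x y z : Fin n, LtX P y x → LtX P z y → LtX P z x := fun _ _ _ h h' => h'.trans h
  obtain ⟨l, hl, ml⟩ := exists_sorted hP {i | .pt i ∈ upperHull P (gap P a (.pt m)) ∧ i ≠ m}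
  obtain ⟨r, hr, mr⟩ := exists_sorted hP {i | .pt i ∈ upperHull P (gap P (.pt m) b) ∧ i ≠ m}
  have memX : ∀ i, i ∈ m :: l.reverse ↔ APt.pt i ∈ upperHull P (gap P a (.pt m)) := fun i => by
    rw [List.mem_cons, List.mem_reverse, ml]
    by_cases hi : i = m
    · subst hi; simp [mem_upperHull_right h1]
    · simp [hi]
  have memY : ∀ i, i ∈ m :: r ↔ APt.pt i ∈ upperHull P (gap P (.pt m) b) := fun i => by
    rw [List.mem_cons, mr]
    by_cases hi : i = m
    · subst hi; simp [mem_upperHull_left h2]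
    · simp [hi]
  have sortX : (m :: l.reverse).Pairwise fun i j => LtX P j i := by
    refine List.pairwise_cons.2 ⟨fun i hi => ?_, List.pairwise_reverse.2 hl⟩
    obtain ⟨hi, hne⟩ := (ml i).1 (List.mem_reverse.1 hi)
    exact ((le_of_mem_gap h1 hi.1).2).resolve_left (by simpa using hne)
  have sortY : (m :: r).Pairwise (LtX P) := by
    refine List.pairwise_cons.2 ⟨fun i hi => ?_, hr⟩
    obtain ⟨hi, hne⟩ := (mr i).1 hi
    exact ((le_of_mem_gap h2 hi.1).1).resolve_left (by simpa using hne)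
  have gX : ∀ i ∈ m :: l.reverse, APt.pt i ∈ gap P a (.pt m) := fun i hi => ((memX i).1 hi).1
  have gY : ∀ i ∈ m :: r, APt.pt i ∈ gap P (.pt m) b := fun i hi => ((memY i).1 hi).1
  have cX : ∀ i ∈ m :: l.reverse, APt.pt i ∈ C := fun i hi => (hL _ (gX i hi)).2 ((memX i).1 hi)
  have cY : ∀ i ∈ m :: r, APt.pt i ∈ C := fun i hi => (hR _ (gY i hi)).2 ((memY i).1 hi)
  refine ⟨l.reverse, r, ⟨h1, h2, hmin, sortX, sortY, memX, memY⟩, ?_, ?_, ?_, ?_⟩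
  · intro x y hxy
    have hx := hxy.subset (List.mem_cons_self (a := x))
    have hy := hxy.subset (show y ∈ [x, y] by simp)
    have hlt : LtX P y x := by simpa using sortX.sublist hxy.sublist
    have hay := (le_of_mem_gap h1 (gX y hy)).1
    refine ⟨⟨cX y hy, cX x hx, hlt, fun c hc h3 h4 => ?_⟩, ?_⟩
    · obtain ⟨i, rfl⟩ := exists_pt_of_between h3 h4
      have hg : APt.pt i ∈ gap P a (.pt m) := mem_gap_iff
        (.inr (by rcases hay with h | h; exacts [h ▸ h3, h.trans h3]))
        (.inr (by rcases (le_of_mem_gap h1 (gX x hx)).2 with h | h; exacts [h ▸ h4, h4.trans h]))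
      exact Pairwise.not_between (r := fun i j => LtX P j i) LtX.irrefl gt_trans sortX hxy
        ((memX i).2 ((hL _ hg).1 hc)) h4 h3
    · rintro rfl
      rcases hay with h | h
      · cases h; exact LtX.irrefl _ hlt
      · exact LtX.irrefl _ (LtX.trans hlt h)
  · intro x hx
    have hx' := List.mem_of_mem_getLast? hx
    have hax := (le_of_mem_gap h1 (gX x hx')).1
    cases a with
    | negInf =>
      refine .inr ⟨hn, cX x hx', trivial, fun c hc h3 h4 => ?_⟩
      obtain ⟨i, rfl⟩ := exists_pt_of_between h3 h4
      have hg : APt.pt i ∈ gap P .negInf (.pt m) := mem_gap_iff (.inr h3)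
        (.inr (by rcases (le_of_mem_gap h1 (gX x hx')).2 with h | h; exacts [h ▸ h4, h4.trans h]))
      rcases Pairwise.rel_getLast? sortX hx ((memX i).2 ((hL _ hg).1 hc)) with rfl | h
      · exact LtX.irrefl _ h4
      · exact LtX.irrefl _ (LtX.trans h h4)
    | posInf => simp [ALtX] at h1
    | pt i =>
      rcases Pairwise.rel_getLast? sortX hx ((memX i).2 (mem_upperHull_left h1)) with rfl | h
      · exact .inl rfl
      · exact .inl (hax.resolve_right fun h' => LtX.irrefl _ (LtX.trans h h'))
  · intro x y hxy
    have hx := hxy.subset (List.mem_cons_self (a := x))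
    have hy := hxy.subset (show y ∈ [x, y] by simp)
    have hlt : LtX P x y := by simpa using sortY.sublist hxy.sublist
    have hby := (le_of_mem_gap h2 (gY y hy)).2
    refine ⟨⟨cY x hx, cY y hy, hlt, fun c hc h3 h4 => ?_⟩, ?_⟩
    · obtain ⟨i, rfl⟩ := exists_pt_of_between h3 h4
      have hg : APt.pt i ∈ gap P (.pt m) b := mem_gap_iff
        (.inr (by rcases (le_of_mem_gap h2 (gY x hx)).1 with h | h; exacts [h ▸ h3, h.trans h3]))
        (.inr (by rcases hby with h | h; exacts [h ▸ h4, h4.trans h]))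
      exact Pairwise.not_between (fun _ => LtX.irrefl _) (fun _ _ _ => LtX.trans) sortY hxy
        ((memY i).2 ((hR _ hg).1 hc)) h3 h4
    · rintro rfl
      rcases hby with h | h
      · cases h; exact LtX.irrefl _ hlt
      · exact LtX.irrefl _ (LtX.trans h hlt)
  · intro x hx
    have hx' := List.mem_of_mem_getLast? hx
    have hxb := (le_of_mem_gap h2 (gY x hx')).2
    cases b with
    | posInf =>
      refine .inr ⟨cY x hx', hp, trivial, fun c hc h3 h4 => ?_⟩
      obtain ⟨i, rfl⟩ := exists_pt_of_between h3 h4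
      have hg : APt.pt i ∈ gap P (.pt m) .posInf := mem_gap_iff
        (.inr (by rcases (le_of_mem_gap h2 (gY x hx')).1 with h | h; exacts [h ▸ h3, h.trans h3]))
        (.inr h4)
      rcases Pairwise.rel_getLast? sortY hx ((memY i).2 ((hR _ hg).1 hc)) with rfl | h
      · exact LtX.irrefl _ h3
      · exact LtX.irrefl _ (LtX.trans h h3)
    | negInf => simp [ALtX] at h2
    | pt i =>
      rcases Pairwise.rel_getLast? sortY hx ((memY i).2 (mem_upperHull_right h2)) with rfl | h
      · exact .inl rfl
      · exact .inl (hxb.resolve_right fun h' => LtX.irrefl _ (LtX.trans h' h))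

/-- The result of the treatment of the apex `m`: the chains `L` and `R`, the chords `T` and the
bridge `br` of its pseudo-triangle; if `C` is the union of the upper hulls before the step, the
points of `C` between `p` and `q` are to be removed. -/
structure NodeStep (P : Fin n → ℝ × ℝ) (π : Equiv.Perm (Fin n)) (C : Set (APt n)) (a b : APt n)
    (m : Fin n) (L R : List (Fin n)) (T : List (Fin n × Fin n)) (br : Option (Fin n × Fin n))
    (p q : Fin n) : Prop where
  spec : NodeSpec P π (gap P a b) ⟨m, a, b, br, balTree L, balTree R, balTree T⟩
  hull : ∀ z ∈ gap P a b, z ∈ cut P C (.pt p) (.pt q) ↔ z ∈ upperHull P (gap P a b)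
  adjL : ∀ x y, [x, y] <:+: L → Consec P C (.pt x) (.pt y)
  adjR : ∀ x y, [x, y] <:+: R → Consec P C (.pt x) (.pt y)
  headL : L.head? = some p
  lastL : L.getLast? = some m
  headR : R.head? = some m
  lastR : R.getLast? = some q
  ends : p = m ∧ q = m ∨ LtX P p m ∧ LtX P m q
  left : .pt p ∈ gap P a b
  right : .pt q ∈ gap P a b
  memp : .pt p ∈ C
  memq : .pt q ∈ C
  len : T.length + L.length + R.length + 2 * (cut P C (.pt p) (.pt q)).ncard ≤ 2 * C.ncard + 2
  lenT : T.length + (cut P C (.pt p) (.pt q)).ncard ≤ C.ncard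
  lenT' : T.length ≤ n
  lenL : L.length ≤ n
  lenR : R.length ≤ n

theorem infix_reverse_pair {α : Type} {x y : α} {l : List α} (h : [x, y] <:+: l.reverse) :
    [y, x] <:+: l := by
  have := List.reverse_infix.2 h
  simpa using this

theorem length_le_ncard {l : List (Fin n)} (hl : l.Nodup) {S : Set (APt n)}
    (h : ∀ x ∈ l, APt.pt x ∈ S) : l.length ≤ S.ncard := by
  classical
  have h1 : (l.map APt.pt).Nodup := hl.map fun _ _ h => by simpa using h
  rw [← List.length_map (f := APt.pt), ← List.toFinset_card_of_nodup h1, ← Set.ncard_coe_finset]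
  refine Set.ncard_le_ncard (fun z hz => ?_) (Set.toFinite _)
  obtain ⟨x, hx, rfl⟩ := List.mem_map.1 (List.mem_toFinset.1 (Finset.mem_coe.1 hz))
  exact h x hx

theorem cut_self (S : Set (APt n)) (z : APt n) : cut P S z z = S :=
  Set.sep_eq_self_iff_mem_true.2 fun _ _ => by simpa using fun h h' => ALtX.asymm h h'

section nodeStep

variable {C : Set (APt n)} {a b : APt n} {m : Fin n} {XA YA : List (Fin n)}

theorem HullLists.mem_iff (h : HullLists P π C a b m XA YA) (hP : Function.Injective P)
    (hL : ∀ z ∈ gap P a (.pt m), z ∈ C ↔ z ∈ upperHull P (gap P a (.pt m)))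
    (hR : ∀ z ∈ gap P (.pt m) b, z ∈ C ↔ z ∈ upperHull P (gap P (.pt m) b)) {i : Fin n}
    (hi : .pt i ∈ gap P a b) : .pt i ∈ C ↔ i ∈ m :: XA ∨ i ∈ m :: YA := by
  rw [h.memX, h.memY]
  constructor
  · intro hc
    rw [← gap_union hP h.left_lt h.lt_right] at hi
    exact hi.imp (fun hg => (hL _ hg).1 hc) fun hg => (hR _ hg).1 hc
  · rintro (h' | h')
    exacts [(hL _ h'.1).2 h', (hR _ h'.1).2 h']

/-- The apex stays on the hull, so nothing is removed, which is expressed by an empty cut from `m`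
to `m`. -/
theorem HullLists.nodeStep_of_convex (h : HullLists P π C a b m XA YA) (hP : Function.Injective P)
    (hL : ∀ z ∈ gap P a (.pt m), z ∈ C ↔ z ∈ upperHull P (gap P a (.pt m)))
    (hR : ∀ z ∈ gap P (.pt m) b, z ∈ C ↔ z ∈ upperHull P (gap P (.pt m) b))
    (hf : ∀ u ∈ XA.head?, ∀ v ∈ YA.head?, 0 ≤ orient (P u) (P v) (P m)) :
    NodeStep P π C a b m [m] [m] [] none m m := by
  obtain ⟨h1, h2⟩ := h.nodeSpec_of_convex hP hf
  have hab := h.left_lt.trans h.lt_right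
  have hm : APt.pt m ∈ gap P a b := .inr (.inr ⟨h.left_lt, h.lt_right⟩)
  have hmC := (h.mem_iff hP hL hR hm).2 (by simp)
  have npair : ∀ x y : Fin n, ¬ [x, y] <:+: [m] := fun x y hxy => by simpa using hxy.length_le
  refine ⟨h1, fun z hz => ?_, fun x y hxy => absurd hxy (npair x y),
    fun x y hxy => absurd hxy (npair x y), rfl, rfl, rfl, rfl, .inl ⟨rfl, rfl⟩, hm, hm, hmC, hmC,
    by simp [cut_self]; omega, by simp [cut_self], by simp, m.pos, m.pos⟩
  rw [cut_self]
  cases z with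
  | pt i => rw [h.mem_iff hP hL hR hz, h2]
  | negInf =>
    obtain rfl | rfl : a = .negInf ∨ b = .negInf := by
      rcases hz with h | h | h
      exacts [.inl h.symm, .inr h.symm, by obtain ⟨i, h⟩ := exists_pt_of_between h.1 h.2; cases h]
    · exact iff_of_true ((hL _ (.inl rfl)).2 (mem_upperHull_left h.left_lt)) (mem_upperHull_left hab)
    · exact iff_of_true ((hR _ (.inr (.inl rfl))).2 (mem_upperHull_right h.lt_right))
        (mem_upperHull_right hab)
  | posInf =>
    obtain rfl | rfl : a = .posInf ∨ b = .posInf := by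
      rcases hz with h | h | h
      exacts [.inl h.symm, .inr h.symm, by obtain ⟨i, h⟩ := exists_pt_of_between h.1 h.2; cases h]
    · exact iff_of_true ((hL _ (.inl rfl)).2 (mem_upperHull_left h.left_lt)) (mem_upperHull_left hab)
    · exact iff_of_true ((hR _ (.inr (.inl rfl))).2 (mem_upperHull_right h.lt_right))
        (mem_upperHull_right hab)

/-- The union of both hulls without the stretch strictly between the bridge ends is the hull of the
fused gap. With `x` and `y` inner vertices on the two chains there are `x + y` chords and `x + y +
4` listed chain vertices, while at least `x + y + 1` points leave `C`; this is `NodeStep.len`. -/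
theorem HullLists.nodeStep_of_merge (h : HullLists P π C a b m XA YA) (hP : Function.Injective P)
    (hL : ∀ z ∈ gap P a (.pt m), z ∈ C ↔ z ∈ upperHull P (gap P a (.pt m)))
    (hR : ∀ z ∈ gap P (.pt m) b, z ∈ C ↔ z ∈ upperHull P (gap P (.pt m) b))
    {T : List (Fin n × Fin n)} {p q : Fin n} {X' Y' : List (Fin n)}
    (hm : Merge P π XA YA T (p :: X') (q :: Y'))
    (hf : ∀ u ∈ XA.head?, ∀ v ∈ YA.head?, orient (P u) (P v) (P m) < 0) :
    ∃ X Y, NodeStep P π C a b m (m :: X).reverse (m :: Y) T (some (p, q)) p q := by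
  obtain ⟨X, Y, X₁, Y₁, p', q', e1, e2, rfl, rfl, hs, hp, hq, hst, hst'⟩ := hm.stair
  obtain ⟨rfl, rfl⟩ := List.cons.inj e1
  obtain ⟨rfl, rfl⟩ := List.cons.inj e2
  obtain ⟨h1, h2⟩ := h.nodeSpec_of_stair hP hs
    (fun u hu v hv => hf u (by cases X <;> simp_all) v (by cases Y <;> simp_all)) hp hq hst hst'
  have hab := h.left_lt.trans h.lt_right
  have hmem := fun {i} => h.mem_iff (i := i) hP hL hR
  have hpX := List.mem_of_mem_getLast? hp
  have hqY := List.mem_of_mem_getLast? hq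
  obtain ⟨X₀, rfl⟩ := List.getLast?_eq_some_iff.1 (Option.mem_def.1 hp)
  obtain ⟨Y₀, rfl⟩ := List.getLast?_eq_some_iff.1 (Option.mem_def.1 hq)
  have sX := h.sortX
  have sY := h.sortY
  simp only [List.pairwise_cons, List.pairwise_append, List.mem_append, List.mem_cons,
    List.not_mem_nil, or_false, false_imp_iff, implies_true, List.Pairwise.nil, and_true] at sX sY
  obtain ⟨xm, ⟨x0, -, x01⟩, x1, x2⟩ := sX
  obtain ⟨ym, ⟨y0, -, y01⟩, y1, y2⟩ := sY
  have hpm : LtX P p m := xm p (.inl (.inr rfl))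
  have hmq : LtX P m q := ym q (.inl (.inr rfl))
  have gX : ∀ i ∈ m :: (X₀ ++ [p] ++ X'), APt.pt i ∈ gap P a b := fun i hi => by
    rw [← gap_union hP h.left_lt h.lt_right]
    exact .inl ((h.memX i).1 hi).1
  have gY : ∀ i ∈ m :: (Y₀ ++ [q] ++ Y'), APt.pt i ∈ gap P a b := fun i hi => by
    rw [← gap_union hP h.left_lt h.lt_right]
    exact .inr ((h.memY i).1 hi).1
  have cX : ∀ i ∈ m :: (X₀ ++ [p] ++ X'), APt.pt i ∈ C := fun i hi => (hmem (gX i hi)).2 (.inl hi)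
  have cY : ∀ i ∈ m :: (Y₀ ++ [q] ++ Y'), APt.pt i ∈ C := fun i hi => (hmem (gY i hi)).2 (.inr hi)
  have hE : (X₀.reverse ++ m :: Y₀).Pairwise (LtX P) := by
    simp only [List.pairwise_append, List.pairwise_reverse, List.pairwise_cons, List.mem_reverse,
      List.mem_cons]
    refine ⟨x0, ⟨fun i hi => ym i (.inl (.inl hi)), y0⟩, fun i hi j hj => ?_⟩
    have := xm i (.inl (.inl hi))
    rcases hj with rfl | hj
    exacts [this, this.trans (ym j (.inl (.inl hj)))]
  -- The inner vertices of both chains and the apex are distinct members of `C` strictly between the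
  -- bridge ends, so all of them are cut out.
  have hcard : (X₀.reverse ++ m :: Y₀).length + (cut P C (.pt p) (.pt q)).ncard ≤ C.ncard := by
    have : cut P C (.pt p) (.pt q) = C \ {z ∈ C | ALtX P (.pt p) z ∧ ALtX P z (.pt q)} := by
      ext z; simp only [cut, Set.mem_ofPred_eq, Set.mem_sdiff]; tauto
    rw [this, ← Set.ncard_sdiff_add_ncard_of_subset (Set.sep_subset C _) (Set.toFinite _), add_comm]
    refine Nat.add_le_add_left (length_le_ncard (nodup_of_ltX hE) fun x hx => ?_) _
    rcases List.mem_append.1 hx with hx | hx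
    · rw [List.mem_reverse] at hx
      exact ⟨cX x (by simp [hx]), x01 x hx p rfl, (xm x (.inl (.inl hx))).trans hmq⟩
    · rcases List.mem_cons.1 hx with rfl | hx
      · exact ⟨cX x (by simp), hpm, hmq⟩
      · exact ⟨cY x (by simp [hx]), hpm.trans (ym x (.inl (.inl hx))), y01 x hx q rfl⟩
  have hlen := hs.length
  simp only [List.length_append, List.length_reverse, List.length_cons, List.length_nil] at hcard hlen
  have hEn := (nodup_of_ltX hE).length_le_card
  simp only [List.length_append, List.length_reverse, List.length_cons, Fintype.card_fin] at hEn
  have hap := le_of_mem_gap hab (gX p (by simp))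
  have hbq := le_of_mem_gap hab (gY q (by simp))
  have cuta : a ∈ cut P C (.pt p) (.pt q) := by
    refine ⟨(hL _ (.inl rfl)).2 (mem_upperHull_left h.left_lt), fun hc => ?_⟩
    rcases hap.1 with h | h
    exacts [ALtX.irrefl _ (h ▸ hc.1), h.asymm hc.1]
  have cutb : b ∈ cut P C (.pt p) (.pt q) := by
    refine ⟨(hR _ (.inr (.inl rfl))).2 (mem_upperHull_right h.lt_right), fun hc => ?_⟩
    rcases hbq.2 with h | h
    exacts [ALtX.irrefl _ (h ▸ hc.2), h.asymm hc.2]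
  refine ⟨X₀ ++ [p], Y₀ ++ [q], h1, fun z hz => ?_, fun x y hxy => ?_, fun x y hxy => ?_, by simp,
    by rw [List.getLast?_reverse]; rfl, rfl, by simp [List.getLast?_cons], .inr ⟨hpm, hmq⟩, gX p (by simp), gY q (by simp),
    cX p (by simp), cY q (by simp), ?_, ?_, ?_, ?_, ?_⟩
  · have hz' := hz
    rcases hz' with rfl | rfl | hz'
    · exact iff_of_true cuta (mem_upperHull_left hab)
    · exact iff_of_true cutb (mem_upperHull_right hab)
    obtain ⟨i, rfl⟩ := exists_pt_of_between hz'.1 hz'.2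
    rw [h2, cut, Set.mem_ofPred_eq, hmem hz]
    simp only [List.mem_cons, List.mem_append, List.not_mem_nil, or_false]
    constructor
    · rintro ⟨(rfl | (hi | hi) | hi) | (rfl | (hi | hi) | hi), hn⟩
      · exact absurd ⟨hpm, hmq⟩ hn
      · exact absurd ⟨x01 i hi p rfl, (xm i (.inl (.inl hi))).trans hmq⟩ hn
      · exact .inl hi
      · exact .inr (.inl hi)
      · exact absurd ⟨hpm, hmq⟩ hn
      · exact absurd ⟨hpm.trans (ym i (.inl (.inl hi))), y01 i hi q rfl⟩ hn
      · exact .inr (.inr (.inl hi))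
      · exact .inr (.inr (.inr hi))
    · rintro (rfl | hi | rfl | hi)
      · exact ⟨.inl (.inr (.inl (.inr rfl))), fun h => ALtX.irrefl _ h.1⟩
      · exact ⟨.inl (.inr (.inr hi)), fun h => ALtX.asymm h.1 (x2 p (.inr rfl) i hi)⟩
      · exact ⟨.inr (.inr (.inl (.inr rfl))), fun h => ALtX.irrefl _ h.2⟩
      · exact ⟨.inr (.inr (.inr hi)), fun h => ALtX.asymm h.2 (y2 q (.inr rfl) i hi)⟩
  · refine (h.adjX y x ((infix_reverse_pair hxy).trans ?_)).1
    exact (List.prefix_append (m :: (X₀ ++ [p])) X').isInfix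
  · refine (h.adjY x y (hxy.trans ?_)).1
    exact (List.prefix_append (m :: (Y₀ ++ [q])) Y').isInfix
  · simp; omega
  · omega
  · omega
  · have hn : (m :: (X₀ ++ [p] ++ X')).reverse.Nodup :=
      nodup_of_ltX (P := P) (List.pairwise_reverse.2 h.sortX)
    have := (List.nodup_reverse.1 hn).length_le_card
    simp at this ⊢; omega
  · have := (nodup_of_ltX h.sortY).length_le_card
    simp at this ⊢; omega

end nodeStep

end PseudoTri

/-! ### The program that treats one apex -/

namespace PseudoTri

open RealRAM

variable {n : ℕ} {P : Fin n → ℝ × ℝ} {π : Equiv.Perm (Fin n)}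

/-- The members of `S` are doubly linked, forwards in segment `k` and backwards in segment `k'`. -/
def DLinked (P : Fin n → ℝ × ℝ) (σ : State) (k k' : ℕ) (S : Set (APt n)) : Prop :=
  ∀ a b, Consec P S a b → σ.mem k a.code = b.code ∧ σ.mem k' b.code = a.code

theorem DLinked.congr {σ σ' : State} {k k' : ℕ} {S : Set (APt n)} (h : DLinked P σ k k' S)
    (hk : σ'.mem k = σ.mem k) (hk' : σ'.mem k' = σ.mem k') : DLinked P σ' k k' S := by
  intro a b hab
  rw [hk, hk']
  exact h a b hab

/-- A whole stretch leaves a doubly linked list by two writes, one in each direction. The links of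
the removed items need not be cleared, as `DLinked` speaks of members only. -/
theorem DLinked.cut {σ σ' : State} {k k' : ℕ} {S : Set (APt n)} (h : DLinked P σ k k' S)
    (hP : Function.Injective P) {p q : APt n} (hp : p ∈ S) (hq : q ∈ S) (hpq : ALtX P p q)
    (hk : ∀ x, σ'.mem k x = if x = p.code then q.code else σ.mem k x)
    (hk' : ∀ x, σ'.mem k' x = if x = q.code then p.code else σ.mem k' x) :
    DLinked P σ' k k' (cut P S p q) := by
  intro a b hab
  rcases hab.of_cut hP hp hq hpq with ⟨rfl, rfl⟩ | ⟨ha, hb, hab⟩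
  · simp [hk, hk']
  · rw [hk, hk', if_neg fun h => ha (APt.code_injective h), if_neg fun h => hb (APt.code_injective h)]
    exact h a b hab

/-- A stored tree depends only on the cells of its own records, so later writes elsewhere do not
disturb it. -/
theorem StoresList.congr {α : Type} {σ σ' : State} {item item' : α → ℕ → Prop} :
    ∀ {t : BinaryTree α} {a : ℕ} {A : List ℕ}, StoresList σ item t a A →
      (∀ x ∈ A, ∀ j < 3, σ'.mem j x = σ.mem j x) → (∀ x ∈ A, ∀ v, item v x → item' v x) →
      StoresList σ' item' t a A
  | .nil, _, _, h, _, _ => h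
  | .node v l r, a, _, ⟨h0, hv, h2, Al, Ar, hl, hr, rfl⟩, hm, hi => by
    refine ⟨h0, hi a (by simp) v hv, ?_, Al, Ar, ?_, ?_, rfl⟩
    · rw [hm a (by simp) 2 (by omega), h2]
    · rw [hm a (by simp) 0 (by omega)]
      exact hl.congr (fun x hx => hm x (by simp [hx])) fun x hx => hi x (by simp [hx])
    · rw [hm a (by simp) 1 (by omega)]
      exact hr.congr (fun x hx => hm x (by simp [hx])) fun x hx => hi x (by simp [hx])

theorem StoresPts.congr {σ σ' : State} {t : BinaryTree (Fin n)} {a : ℕ} {A : List ℕ}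
    (h : StoresPts σ t a A) (hm : ∀ x ∈ A, ∀ j < 5, σ'.mem j x = σ.mem j x) :
    StoresPts σ' t a A :=
  StoresList.congr h (fun x hx j hj => hm x hx j (by omega)) fun x hx v hv => by
    rw [hm x hx 3 (by omega)]; exact hv

theorem StoresChords.congr {σ σ' : State} {t : BinaryTree (Fin n × Fin n)} {a : ℕ} {A : List ℕ}
    (h : StoresChords σ t a A) (hm : ∀ x ∈ A, ∀ j < 5, σ'.mem j x = σ.mem j x) :
    StoresChords σ' t a A :=
  StoresList.congr h (fun x hx j hj => hm x hx j (by omega)) fun x hx v hv => by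
    rw [hm x hx 3 (by omega), hm x hx 4 (by omega)]; exact hv

theorem StoresTree.congr {σ σ' : State} :
    ∀ {t : BinaryTree (NodeData n)} {a : ℕ} {A : List ℕ}, StoresTree σ t a A →
      (∀ x ∈ A, ∀ j < 10, σ'.mem j x = σ.mem j x) → StoresTree σ' t a A
  | .nil, _, _, h, _ => h
  | .node d l r, a, _, ⟨h0, h2, h3, h4, h5, h6, A₁, A₂, A₃, Al, Ar, s1, s2, s3, sl, sr, rfl⟩, hm => by
    have ha := hm a (by simp)
    refine ⟨h0, ?_, ?_, ?_, ?_, ?_, A₁, A₂, A₃, Al, Ar, ?_, ?_, ?_, ?_, ?_, rfl⟩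
    · rw [ha 2 (by omega), h2]
    · rw [ha 3 (by omega), h3]
    · rw [ha 4 (by omega), h4]
    · rw [ha 5 (by omega), h5]
    · rw [ha 6 (by omega), h6]
    · rw [ha 7 (by omega)]
      exact s1.congr fun x hx j hj => hm x (by simp [hx]) j (by omega)
    · rw [ha 8 (by omega)]
      exact s2.congr fun x hx j hj => hm x (by simp [hx]) j (by omega)
    · rw [ha 9 (by omega)]
      exact s3.congr fun x hx j hj => hm x (by simp [hx]) j (by omega)
    · rw [ha 0 (by omega)]
      exact sl.congr fun x hx j hj => hm x (by simp [hx]) j (by omega)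
    · rw [ha 1 (by omega)]
      exact sr.congr fun x hx j hj => hm x (by simp [hx]) j (by omega)

/-- Is there a funnel above the apex in register 11, between its neighbours in registers 15 and 16?
The answer is put into register 22. -/
def testFunnel : Prog :=
  .seq (.instr (.const 22 0)) (.branch (.eq 15 0) .skip (.branch (.eq 16 1) .skip
    (.seq (orientInto 15 16 11) (.branch (.rlt 0 9) (.instr (.const 22 1)) .skip))))

/-- Find the bridge and the chords, and store the bridge in the record named by register 14. The
ends of the bridge (or the apex twice) are put into registers 15 and 16. -/
def funnelProg : Prog :=
  .seq testFunnel (.branch (.lt 4 22)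
    (.seq findBridge (blk [.store 5 14 15, .store 6 14 16]))
    (blk [.move 15 11, .move 16 11, .const 17 0, .store 5 14 3, .store 6 14 3]))

/-- The neighbours `u` and `v` of the apex in `C` are the first vertices of the two hulls, or
dummies if a hull has no further vertex on its side. So the program starts at the right chord
without searching. -/
theorem runs_funnelProg {W rec : ℕ} {σ : State} {C : Set (APt n)} {a b u v : APt n} {m : Fin n}
    (hP : Function.Injective P) (hW : n + 2 < W) (hB : Base P π σ)
    (hn : .negInf ∈ C) (hp : .posInf ∈ C) (poly : DLinked P σ 13 14 C)
    (h1 : ALtX P a (.pt m)) (h2 : ALtX P (.pt m) b)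
    (hmin : ∀ i, ALtX P a (.pt i) → ALtX P (.pt i) b → π m ≤ π i)
    (hL : ∀ z ∈ gap P a (.pt m), z ∈ C ↔ z ∈ upperHull P (gap P a (.pt m)))
    (hR : ∀ z ∈ gap P (.pt m) b, z ∈ C ↔ z ∈ upperHull P (gap P (.pt m) b))
    (hu : Consec P C u (.pt m)) (hv : Consec P C (.pt m) v)
    (r11 : σ.reg 11 = m) (r12 : σ.reg 12 = a.code) (r13 : σ.reg 13 = b.code) (r14 : σ.reg 14 = rec)
    (r15 : σ.reg 15 = u.code) (r16 : σ.reg 16 = v.code) :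
    ∃ L R T br p q, NodeStep P π C a b m L R T br p q ∧
      Runs W funnelProg σ (48 * T.length + 80) fun σ' => HoldsChords T σ' ∧
        σ'.reg 15 = p ∧ σ'.reg 16 = q ∧
        (∀ x, σ'.mem 5 x = if x = rec then (bridgeCode br).1 else σ.mem 5 x) ∧
        ∀ x, σ'.mem 6 x = if x = rec then (bridgeCode br).2 else σ.mem 6 x := by
  obtain ⟨XA, YA, h⟩ := exists_hullLists hP hn hp h1 h2 hmin hL hR
  have r0 := hB.consts.r0
  have r1 := hB.consts.r1
  have r9 := hB.zero
  have hmb : (m : ℕ) < n := m.isLt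
  have hXnil : XA = [] → u = .negInf := by
    rintro rfl
    rcases h.lastX m rfl with rfl | hc
    · exact absurd h1 (ALtX.irrefl _)
    · exact hu.left_unique hP hc
  have hYnil : YA = [] → v = .posInf := by
    rintro rfl
    rcases h.lastY m rfl with rfl | hc
    · exact absurd h2 (ALtX.irrefl _)
    · exact hv.right_unique hP hc
  have hXcons : ∀ x X, XA = x :: X → u = .pt x := by
    rintro x X rfl
    exact hu.left_unique hP (h.adjX m x ⟨[], X, rfl⟩).1
  have hYcons : ∀ y Y, YA = y :: Y → v = .pt y := by
    rintro y Y rfl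
    exact hv.right_unique hP (h.adjY m y ⟨[], Y, rfl⟩).1
  -- If one of the lists is empty this holds vacuously; accordingly `testFunnel` answers no as soon
  -- as a neighbour is a dummy.
  by_cases hf : ∀ u ∈ XA.head?, ∀ v ∈ YA.head?, 0 ≤ orient (P u) (P v) (P m)
  · refine ⟨[m], [m], [], none, m, m, h.nodeStep_of_convex hP hL hR hf, ?_⟩
    have htest : Runs W testFunnel σ 40 fun s => s.reg 22 = 0 := by
      cases XA with
      | nil =>
        have := hXnil rfl
        refine Runs.free ?_ (by decide) ?_ <;>
          simp [testFunnel, Prog.Safe, Instr.Safe, Prog.eff, Instr.eff, Test.Holds, r15, this, r0,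
            APt.code]
        omega
      | cons x X =>
        cases YA with
        | nil =>
          have e1 := hXcons x X rfl
          have e2 := hYnil rfl
          refine Runs.free ?_ (by decide) ?_ <;>
            simp [testFunnel, Prog.Safe, Instr.Safe, Prog.eff, Instr.eff, Test.Holds, r15, r16, e1,
              e2, r0, r1, APt.code, x.isLt.ne]
          omega
        | cons y Y =>
          have e1 := hXcons x X rfl
          have e2 := hYcons y Y rfl
          have ho : ¬ orient (P x) (P y) (P m) < 0 := not_lt.2 (hf x rfl y rfl)
          have ey : (y : ℕ) ≠ n + 1 := by omega
          refine Runs.free ?_ (by decide) ?_ <;>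
            simp [testFunnel, Prog.Safe, Instr.Safe, Prog.eff, Instr.eff, Test.Holds, r15, r16, r11,
              e1, e2, r0, r1, r9, APt.code, x.isLt.ne, ey, hB.points.pair, ho]
          omega
    refine Runs.seq htest (b := 40) ?_ (by omega)
    intro s1 f1 a22
    have b4 : s1.reg 4 = 0 := (f1.reg 4 rfl).trans hB.consts.r4
    have b3 : s1.reg 3 = n + 2 := (f1.reg 3 rfl).trans hB.consts.r3
    have b11 : s1.reg 11 = m := (f1.reg 11 rfl).trans r11
    have b14 : s1.reg 14 = rec := (f1.reg 14 rfl).trans r14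
    refine Runs.branch (a := 39) (fun hc => ?_) (fun _ => ?_) (by omega)
    · simp [Test.Holds, a22, b4] at hc
    · refine Runs.free ?_ (by decide) ⟨⟨?_, by simp, by simp⟩, ?_, ?_, ?_, ?_⟩ <;>
        simp [blk, Prog.Safe, Instr.Safe, Prog.eff, Instr.eff, b3, b11, b14, bridgeCode, f1.mem 5 rfl,
          f1.mem 6 rfl]
      omega
  · push Not at hf
    obtain ⟨x, hx, y, hy, ho⟩ := hf
    obtain ⟨X, rfl⟩ : ∃ X, XA = x :: X := by cases XA <;> simp_all
    obtain ⟨Y, rfl⟩ : ∃ Y, YA = y :: Y := by cases YA <;> simp_all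
    obtain ⟨T, X₁, Y₁, hm⟩ := Merge.exists P π x y X Y
    obtain ⟨-, -, X', Y', p, q, rfl, rfl, -⟩ := hm.stair
    obtain ⟨X₂, Y₂, hst⟩ := h.nodeStep_of_merge hP hL hR hm (by simpa using ho)
    refine ⟨_, _, _, _, _, _, hst, ?_⟩
    have e1 := hXcons x X rfl
    have e2 := hYcons y Y rfl
    have ey : (y : ℕ) ≠ n + 1 := by omega
    refine Runs.seq (a := 20) (b := 48 * T.length + 60) (R := fun s => s.reg 22 = 1)
      (Runs.free ?_ (by decide) ?_) ?_ (by omega)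
    · simp [testFunnel, Prog.Safe, Instr.Safe, Prog.eff, Instr.eff, Test.Holds, r15, r16, r11,
        e1, e2, r0, r1, r9, APt.code, x.isLt.ne, ey, hB.points.pair, ho]
      omega
    · simp [testFunnel, Prog.eff, Instr.eff, Test.Holds, r15, r16, r11,
        e1, e2, r0, r1, r9, APt.code, x.isLt.ne, ey, hB.points.pair, ho]
    intro s1 f1 a22
    have b4 : s1.reg 4 = 0 := (f1.reg 4 rfl).trans hB.consts.r4
    refine Runs.branch (a := 48 * T.length + 59) (fun _ => ?_) (fun hc => ?_) (by omega)
    swap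
    · simp [Test.Holds, a22, b4] at hc
    have hT := hst.lenT'
    refine Runs.seq (a := 48 * T.length + 51) (b := 2) (runs_findBridge (hB.frame f1 rfl rfl rfl rfl) (by omega) hm
      ((f1.reg 15 rfl).trans (by rw [r15, e1]; rfl)) ((f1.reg 16 rfl).trans (by rw [r16, e2]; rfl))
      ⟨?_, ?_⟩ ⟨?_, ?_⟩) ?_ (by omega)
    · intro i j hij
      obtain ⟨hc, hne⟩ := h.adjX i j (hij.trans (List.suffix_cons _ _).isInfix)
      rw [f1.mem 14 rfl, f1.reg 12 rfl, r12]
      exact ⟨(poly _ _ hc).2, fun h => hne (APt.code_injective h)⟩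
    · intro i hi
      rw [f1.mem 14 rfl, f1.reg 12 rfl, r12]
      rcases h.lastX i (by simpa [List.getLast?_cons] using hi) with h | h
      · exact .inl (congrArg APt.code h)
      · exact .inr (poly _ _ h).2
    · intro i j hij
      obtain ⟨hc, hne⟩ := h.adjY i j (hij.trans (List.suffix_cons _ _).isInfix)
      rw [f1.mem 13 rfl, f1.reg 13 rfl, r13]
      exact ⟨(poly _ _ hc).1, fun h => hne (APt.code_injective h)⟩
    · intro i hi
      rw [f1.mem 13 rfl, f1.reg 13 rfl, r13]
      rcases h.lastY i (by simpa [List.getLast?_cons] using hi) with h | h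
      · exact .inl (congrArg APt.code h)
      · exact .inr (poly _ _ h).1
    rintro s2 f2 ⟨hT2, p', q', X₃, Y₃, d1, d2, d15, d16⟩
    obtain ⟨rfl, -⟩ := List.cons.inj d1
    obtain ⟨rfl, -⟩ := List.cons.inj d2
    have b14 : s2.reg 14 = rec := (f2.reg 14 rfl).trans ((f1.reg 14 rfl).trans r14)
    refine Runs.free ?_ (by decide) ⟨⟨?_, ?_, ?_⟩, ?_, ?_, ?_, ?_⟩ <;>
      simp [blk, Prog.Safe, Instr.Safe, Prog.eff, Instr.eff, b14, bridgeCode, d15, d16, f2.mem 5 rfl,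
        f2.mem 6 rfl, f1.mem 5 rfl, f1.mem 6 rfl]
    exacts [hT2.len, hT2.fst, hT2.snd]

theorem isChain_of_infix {α : Type} {r : α → α → Prop} {l : List α}
    (h : ∀ x y, [x, y] <:+: l → r x y) : l.IsChain r :=
  List.isChain_iff_forall_rel_of_append_cons_cons.2 fun {a b l₁ l₂} e =>
    h a b ⟨l₁, l₂, by rw [e]; simp⟩

/-- A list of consecutive members of `C` is a stretch of the linked list, with the successor `w` of
its last vertex as end marker. -/
theorem runs_listTree_consec {W base : ℕ} {σ : State} {C : Set (APt n)} {w : APt n}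
    {l : List (Fin n)} (hW : base + (n + 1) + 2 * l.length + 2 < W) (hb : 0 < base)
    (hc : Consts n σ) (h5 : σ.reg 5 = base) (hd : DLinked P σ 13 14 C)
    (hadj : ∀ x y, [x, y] <:+: l → Consec P C (.pt x) (.pt y))
    {x z : Fin n} (hx : l.head? = some x) (hz : l.getLast? = some z) (hw : Consec P C (.pt z) w)
    (h25 : σ.reg 25 = x) (h26 : σ.reg 26 = w.code) :
    Runs W listTree σ (l.length * (11 * Nat.size l.length + 36) + 11) fun σ' =>
      σ'.reg 5 = base + l.length ∧
      (∀ j < 5, ∀ x < base, σ'.mem j x = σ.mem j x) ∧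
      ∃ A, StoresPts σ' (balTree l) (σ'.reg 24) A ∧ A.Nodup ∧
        ∀ x ∈ A, base ≤ x ∧ x < base + l.length := by
  refine runs_listTree σ l (e := w.code) (N := n + 1) hW hb hc.r2 hc.r4 h5 h26 (by omega) w.code_le
    ?_ ?_ ?_
  · obtain ⟨l', rfl⟩ : ∃ l', l = x :: l' := by cases l <;> simp_all
    rw [h25]
    exact ⟨l'.map Fin.val ++ [w.code], by simp⟩
  · refine List.isChain_append.2 ⟨(List.isChain_map _).2 (isChain_of_infix fun x y hxy =>
      (hd _ _ (hadj x y hxy)).1), List.isChain_singleton _, ?_⟩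
    intro i hi j hj
    rw [List.getLast?_map, hz] at hi
    simp only [Option.map_some, Option.mem_def, Option.some.injEq, List.head?_cons] at hi hj
    rw [← hi, ← hj]
    exact (hd _ _ hw).1
  · intro hm
    obtain ⟨i, hi, hiw⟩ := List.mem_map.1 hm
    have : Trans (LtX P) (LtX P) (LtX P) := ⟨LtX.trans⟩
    have hs : l.Pairwise (LtX P) :=
      List.isChain_iff_pairwise.1 (isChain_of_infix fun x y hxy => (hadj x y hxy).lt)
    obtain rfl : APt.pt i = w := APt.code_injective hiw
    rcases Pairwise.rel_getLast? hs hz hi with rfl | h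
    · exact LtX.irrefl _ hw.lt
    · exact LtX.irrefl _ (LtX.trans h hw.lt)

/-- Build the trees of the chords and of the chains, and link the ends of the bridge. -/
def closeNode : Prog :=
  .seq buildTree (.seq (blk [.store 9 14 24, .move 25 15, .load 26 13 11])
    (.seq listTree (.seq (blk [.store 7 14 24, .move 25 11, .load 26 13 16])
      (.seq listTree (.seq (.instr (.store 8 14 24))
        (.branch (.eq 15 11) .skip (blk [.store 13 15 16, .store 14 16 15])))))))

/-- The lists of a node are in the memory, in records from `rec + 1` on, and the cells up to `rec`
are the old ones, except for the pointers to these lists. -/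
structure Closed (P : Fin n → ℝ × ℝ) (C : Set (APt n)) (L R : List (Fin n))
    (T : List (Fin n × Fin n)) (p q : Fin n) (rec : ℕ) (σ σ' : State) : Prop where
  reg5 : σ'.reg 5 = rec + 1 + T.length + L.length + R.length
  old : ∀ j < 5, ∀ x ≤ rec, σ'.mem j x = σ.mem j x
  old7 : ∀ x ≠ rec, σ'.mem 7 x = σ.mem 7 x
  old8 : ∀ x ≠ rec, σ'.mem 8 x = σ.mem 8 x
  old9 : ∀ x ≠ rec, σ'.mem 9 x = σ.mem 9 x
  lists : ∃ A₁ A₂ A₃, StoresPts σ' (balTree L) (σ'.mem 7 rec) A₁ ∧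
    StoresPts σ' (balTree R) (σ'.mem 8 rec) A₂ ∧ StoresChords σ' (balTree T) (σ'.mem 9 rec) A₃ ∧
    (A₁ ++ A₂ ++ A₃).Nodup ∧ ∀ x ∈ A₁ ++ A₂ ++ A₃, rec < x ∧ x < σ'.reg 5
  poly : DLinked P σ' 13 14 (cut P C (.pt p) (.pt q))

/-- Both chains are read directly from the hull list: the left one from `p` up to the successor of
`m`, the right one from `m` up to the successor of `q`. For this reason the bridge ends are linked
to each other only at the very end. -/
theorem runs_closeNode {W rec : ℕ} {σ : State} {C : Set (APt n)} {a b : APt n}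
    {m p q : Fin n} {L R : List (Fin n)} {T : List (Fin n × Fin n)} {br : Option (Fin n × Fin n)}
    (hP : Function.Injective P) (hc : Consts n σ)
    (hW : rec + 1 + T.length + L.length + R.length + 3 * n + 4 < W)
    (hp : .posInf ∈ C) (poly : DLinked P σ 13 14 C)
    (h : NodeStep P π C a b m L R T br p q) (hT : HoldsChords T σ)
    (r5 : σ.reg 5 = rec + 1) (r11 : σ.reg 11 = m) (r14 : σ.reg 14 = rec)
    (r15 : σ.reg 15 = p) (r16 : σ.reg 16 = q) :
    Runs W closeNode σ ((T.length + L.length + R.length) * (11 * Nat.log 2 n + 47) + 38)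
      (Closed P C L R T p q rec σ) := by
  have tT := size_le_log h.lenT'
  have tL := size_le_log h.lenL
  have tR := size_le_log h.lenR
  have lT := h.lenT'
  have lL := h.lenL
  have lR := h.lenR
  set lg := Nat.log 2 n
  have bT : T.length * (11 * Nat.size T.length + 29) ≤ T.length * (11 * lg + 47) :=
    Nat.mul_le_mul_left _ (by omega)
  have bL : L.length * (11 * Nat.size L.length + 36) ≤ L.length * (11 * lg + 47) :=
    Nat.mul_le_mul_left _ (by omega)
  have bR : R.length * (11 * Nat.size R.length + 36) ≤ R.length * (11 * lg + 47) :=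
    Nat.mul_le_mul_left _ (by omega)
  obtain ⟨w, hw⟩ : ∃ w, Consec P C (.pt m) w := exists_next
    (by
      rcases h.ends with ⟨rfl, -⟩ | ⟨h1, -⟩
      · exact h.memp
      · have hlast := h.lastL
        have hhead := h.headL
        obtain ⟨l, rfl⟩ := List.getLast?_eq_some_iff.1 hlast
        rcases List.eq_nil_or_concat' l with rfl | ⟨l', x, rfl⟩
        · cases hhead; exact h.memp
        · exact (h.adjL x m ⟨l', [], by simp⟩).right) hp trivial
  obtain ⟨w', hw'⟩ : ∃ w, Consec P C (.pt q) w := exists_next h.memq hp trivial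
  -- The tree of the chords comes first, because the chords are in the segments 18 and 19 and the
  -- walks along the chains overwrite segment 18.
  refine Runs.seq (runs_buildTree (W := W) σ (by omega) hc.r2 hc.r4 r5 hT.len)
    (b := (L.length + R.length) * (11 * lg + 47) + 32) ?_ (by rw [add_mul, add_mul]; rw [add_mul]; omega)
  intro s1 f1 b1
  obtain ⟨A₃, st3, nd3, rg3⟩ := storesList_balTree b1 (by omega) T rfl
    (fun e x => s1.mem 3 x = e.1 ∧ s1.mem 4 x = e.2)
    fun i hi => ⟨(b1.item3 i hi).trans (hT.fst i hi), (b1.item4 i hi).trans (hT.snd i hi)⟩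
  have c1 : Consts n s1 := ⟨(f1.reg 0 rfl).trans hc.r0, (f1.reg 1 rfl).trans hc.r1,
    (f1.reg 2 rfl).trans hc.r2, (f1.reg 3 rfl).trans hc.r3, (f1.reg 4 rfl).trans hc.r4⟩
  have poly1 := poly.congr (f1.mem 13 rfl) (f1.mem 14 rfl)
  have e11 : s1.reg 11 = m := (f1.reg 11 rfl).trans r11
  have e14 : s1.reg 14 = rec := (f1.reg 14 rfl).trans r14
  have e15 : s1.reg 15 = p := (f1.reg 15 rfl).trans r15
  have e16 : s1.reg 16 = q := (f1.reg 16 rfl).trans r16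
  refine Runs.seq (a := 3) (b := (L.length + R.length) * (11 * lg + 47) + 29)
    (R := fun s => s.reg 25 = p ∧ s.reg 26 = w.code ∧
      ∀ x, s.mem 9 x = if x = rec then s1.reg 24 else s1.mem 9 x)
    (Runs.free ?_ (by decide) ?_) ?_ (by omega)
  · simp [blk, Prog.Safe, Instr.Safe]
  · simp [blk, Prog.eff, Instr.eff, e11, e14, e15, f1.mem 9 rfl]
    exact (poly1 _ _ hw).1
  rintro s2 f2 ⟨e25, e26, m9⟩
  have c2 : Consts n s2 := ⟨(f2.reg 0 rfl).trans c1.r0, (f2.reg 1 rfl).trans c1.r1,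
    (f2.reg 2 rfl).trans c1.r2, (f2.reg 3 rfl).trans c1.r3, (f2.reg 4 rfl).trans c1.r4⟩
  have poly2 := poly1.congr (f2.mem 13 rfl) (f2.mem 14 rfl)
  refine Runs.seq (runs_listTree_consec (W := W) (base := rec + 1 + T.length) (by omega) (by omega)
    c2 ((f2.reg 5 rfl).trans b1.reg5) poly2 h.adjL h.headL h.lastL hw e25 e26)
    (b := R.length * (11 * lg + 47) + 18) ?_ (by rw [add_mul]; omega)
  rintro s3 f3 ⟨g5, old3, A₁, st1, nd1, rg1⟩
  have c3 : Consts n s3 := ⟨(f3.reg 0 rfl).trans c2.r0, (f3.reg 1 rfl).trans c2.r1,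
    (f3.reg 2 rfl).trans c2.r2, (f3.reg 3 rfl).trans c2.r3, (f3.reg 4 rfl).trans c2.r4⟩
  have poly3 := poly2.congr (f3.mem 13 rfl) (f3.mem 14 rfl)
  have g11 : s3.reg 11 = m := (f3.reg 11 rfl).trans ((f2.reg 11 rfl).trans e11)
  have g14 : s3.reg 14 = rec := (f3.reg 14 rfl).trans ((f2.reg 14 rfl).trans e14)
  have g15 : s3.reg 15 = p := (f3.reg 15 rfl).trans ((f2.reg 15 rfl).trans e15)
  have g16 : s3.reg 16 = q := (f3.reg 16 rfl).trans ((f2.reg 16 rfl).trans e16)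
  refine Runs.seq (a := 3) (b := R.length * (11 * lg + 47) + 15)
    (R := fun s => s.reg 25 = m ∧ s.reg 26 = w'.code ∧
      ∀ x, s.mem 7 x = if x = rec then s3.reg 24 else s3.mem 7 x)
    (Runs.free ?_ (by decide) ?_) ?_ (by omega)
  · simp [blk, Prog.Safe, Instr.Safe]
  · simp [blk, Prog.eff, Instr.eff, g11, g14, g16]
    exact (poly3 _ _ hw').1
  rintro s4 f4 ⟨g25, g26, m7⟩
  have c4 : Consts n s4 := ⟨(f4.reg 0 rfl).trans c3.r0, (f4.reg 1 rfl).trans c3.r1,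
    (f4.reg 2 rfl).trans c3.r2, (f4.reg 3 rfl).trans c3.r3, (f4.reg 4 rfl).trans c3.r4⟩
  have poly4 := poly3.congr (f4.mem 13 rfl) (f4.mem 14 rfl)
  refine Runs.seq (runs_listTree_consec (W := W) (base := rec + 1 + T.length + L.length) (by omega)
    (by omega) c4 ((f4.reg 5 rfl).trans g5) poly4 h.adjR h.headR h.lastR hw' g25 g26)
    (b := 4) ?_ (by omega)
  rintro s5 f5 ⟨k5, old5, A₂, st2, nd2, rg2⟩
  have poly5 := poly4.congr (f5.mem 13 rfl) (f5.mem 14 rfl)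
  have k11 : s5.reg 11 = m := (f5.reg 11 rfl).trans ((f4.reg 11 rfl).trans g11)
  have k14 : s5.reg 14 = rec := (f5.reg 14 rfl).trans ((f4.reg 14 rfl).trans g14)
  have k15 : s5.reg 15 = p := (f5.reg 15 rfl).trans ((f4.reg 15 rfl).trans g15)
  have k16 : s5.reg 16 = q := (f5.reg 16 rfl).trans ((f4.reg 16 rfl).trans g16)
  refine (Runs.free (p := .seq (.instr (.store 8 14 24))
    (.branch (.eq 15 11) .skip (blk [.store 13 15 16, .store 14 16 15])))
    (Q := fun s => (∀ x, s.mem 8 x = if x = rec then s5.reg 24 else s5.mem 8 x) ∧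
      DLinked P s 13 14 (cut P C (.pt p) (.pt q))) ?_ (by decide) ?_).mono le_rfl ?_
  · simp [blk, Prog.Safe, Instr.Safe]
  -- If there is no bridge, `p` and `q` are the apex itself and the links are left alone, in
  -- agreement with the empty cut.
  · rcases h.ends with ⟨h1, h2⟩ | ⟨h1, h2⟩
    · rw [h1, h2, cut_self]
      constructor
      · simp [Prog.eff, Instr.eff, Test.Holds, k11, k14, k15, h1]
      · refine poly5.congr ?_ ?_ <;> funext x <;>
          simp [Prog.eff, Instr.eff, Test.Holds, k11, k15, h1]
    · have hne : (p : ℕ) ≠ m := fun he => LtX.irrefl m (Fin.ext he ▸ h1)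
      constructor
      · simp [blk, Prog.eff, Instr.eff, Test.Holds, k11, k14, k15, hne]
      · refine poly5.cut hP h.memp h.memq (LtX.trans h1 h2) ?_ ?_ <;>
          simp [blk, Prog.eff, Instr.eff, Test.Holds, k11, k15, k16, hne, APt.code] <;>
          exact fun _ => if_congr Iff.rfl rfl rfl
  rintro s6 f6 ⟨m8, poly6⟩
  have hnew : ∀ j < 5, s6.mem j = s5.mem j := by
    intro j hj; interval_cases j <;> exact f6.mem _ rfl
  have hnew4 : ∀ j < 5, s4.mem j = s3.mem j := by
    intro j hj; interval_cases j <;> exact f4.mem _ rfl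
  have hnew2 : ∀ j < 5, s2.mem j = s1.mem j := by
    intro j hj; interval_cases j <;> exact f2.mem _ rfl
  have old53 : ∀ j < 5, ∀ x < rec + 1 + T.length + L.length, s6.mem j x = s3.mem j x :=
    fun j hj x hx => by rw [hnew j hj, old5 j hj x hx, hnew4 j hj]
  have old51 : ∀ j < 5, ∀ x < rec + 1 + T.length, s6.mem j x = s1.mem j x :=
    fun j hj x hx => by rw [old53 j hj x (by omega), old3 j hj x hx, hnew2 j hj]
  have p7 : s6.mem 7 = s4.mem 7 := (f6.mem 7 rfl).trans (f5.mem 7 rfl)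
  have p9 : s6.mem 9 = s2.mem 9 := (f6.mem 9 rfl).trans ((f5.mem 9 rfl).trans ((f4.mem 9 rfl).trans
    (f3.mem 9 rfl)))
  have s6r5 : s6.reg 5 = rec + 1 + T.length + L.length + R.length := (f6.reg 5 rfl).trans k5
  refine ⟨s6r5, fun j hj x hx => ?_, fun x hx => ?_, fun x hx => ?_, fun x hx => ?_,
    ⟨A₁, A₂, A₃, ?_, ?_, ?_, ?_, ?_⟩, poly6⟩
  · rw [old51 j hj x (by omega), b1.old j x (by omega)]
  · rw [p7, m7, if_neg hx, f3.mem 7 rfl, f2.mem 7 rfl, f1.mem 7 rfl]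
  · rw [m8, if_neg hx, f5.mem 8 rfl, f4.mem 8 rfl, f3.mem 8 rfl, f2.mem 8 rfl, f1.mem 8 rfl]
  · rw [p9, m9, if_neg hx, f1.mem 9 rfl]
  · rw [p7, m7, if_pos rfl]
    exact st1.congr fun x hx j hj => old53 j hj x (rg1 x hx).2
  · rw [m8, if_pos rfl]
    exact st2.congr fun x hx j hj => by rw [hnew j hj]
  · rw [p9, m9, if_pos rfl]
    exact StoresChords.congr st3 fun x hx j hj => old51 j hj x (rg3 x hx).2
  · refine List.nodup_append.2 ⟨List.nodup_append.2 ⟨nd1, nd2, ?_⟩, nd3, ?_⟩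
    · intro x hx y hy
      have := rg1 x hx
      have := rg2 y hy
      omega
    · intro x hx y hy
      have := rg3 y hy
      rcases List.mem_append.1 hx with hx | hx
      · have := rg1 x hx; omega
      · have := rg2 x hx; omega
  · intro x hx
    rw [s6r5]
    rcases List.mem_append.1 hx with hx | hx
    · rcases List.mem_append.1 hx with hx | hx
      · have := rg1 x hx; omega
      · have := rg2 x hx; omega
    · have := rg3 x hx; omega

end PseudoTri

/-! ### The sweep over the priorities -/

namespace PseudoTri

open RealRAM

variable {n : ℕ} {P : Fin n → ℝ × ℝ} {π : Equiv.Perm (Fin n)}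

/-- The state when the points of priority above `t` have been treated: `C` is the union of the upper
hulls of the gaps between the remaining points, each gap has its tree in the records below `fr`, and
`own` tells for each record to which gap it belongs. -/
structure Sweep (P : Fin n → ℝ × ℝ) (π : Equiv.Perm (Fin n)) (t : ℕ) (C : Set (APt n)) (fr : ℕ)
    (own : ℕ → APt n) (σ : State) : Prop where
  base : Base P π σ
  le : t ≤ n
  reg5 : σ.reg 5 = fr
  reg10 : σ.reg 10 = t
  pos : 0 < fr
  inv : ∀ i : Fin n, σ.mem 12 ((π i : ℕ) + 1) = i
  seps : DLinked P σ 15 16 (seps π t)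
  poly : DLinked P σ 13 14 C
  negInf_mem : .negInf ∈ C
  posInf_mem : .posInf ∈ C
  hull : ∀ a b, Consec P (PseudoTri.seps π t) a b →
    ∀ z ∈ gap P a b, z ∈ C ↔ z ∈ upperHull P (gap P a b)
  tree : ∀ a b, Consec P (PseudoTri.seps π t) a b → ∃ T A, IsPTTree P π (gap P a b) T ∧
    StoresTree σ T (σ.mem 17 a.code) A ∧ A.Nodup ∧ ∀ x ∈ A, 0 < x ∧ x < fr ∧ own x = a
  space : fr + 2 * C.ncard + 3 * t ≤ 5 * n + 5

/-- Take the apex with the priority in register 10 out of the list of endpoints, and start the record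
of its pseudo-triangle. -/
def openNode : Prog :=
  blk [.load 11 12 10, .load 12 16 11, .load 13 15 11, .store 15 12 13, .store 16 13 12,
    .move 14 5, .add 5 5 2, .store 2 14 11, .store 3 14 12, .store 4 14 13,
    .load 25 17 12, .store 0 14 25, .load 25 17 11, .store 1 14 25, .store 17 12 14,
    .load 15 14 11, .load 16 13 11, .sub 10 10 2]

/-- The record of the apex `m`, with endpoints `a` and `b`, has been started. -/
structure Opened (a b u v : APt n) (m : Fin n) (t fr : ℕ) (σ σ' : State) : Prop where
  reg5 : σ'.reg 5 = fr + 1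
  reg10 : σ'.reg 10 = t
  reg11 : σ'.reg 11 = m
  reg12 : σ'.reg 12 = a.code
  reg13 : σ'.reg 13 = b.code
  reg14 : σ'.reg 14 = fr
  reg15 : σ'.reg 15 = u.code
  reg16 : σ'.reg 16 = v.code
  old : ∀ j < 5, ∀ x ≠ fr, σ'.mem j x = σ.mem j x
  mem0 : σ'.mem 0 fr = σ.mem 17 a.code
  mem1 : σ'.mem 1 fr = σ.mem 17 m
  mem2 : σ'.mem 2 fr = m
  mem3 : σ'.mem 3 fr = a.code
  mem4 : σ'.mem 4 fr = b.code
  mem15 : ∀ x, σ'.mem 15 x = if x = a.code then b.code else σ.mem 15 x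
  mem16 : ∀ x, σ'.mem 16 x = if x = b.code then a.code else σ.mem 16 x
  mem17 : ∀ x, σ'.mem 17 x = if x = a.code then fr else σ.mem 17 x

theorem runs_openNode {W t fr : ℕ} {σ : State} {C : Set (APt n)} {own : ℕ → APt n}
    (h : Sweep P π (t + 1) C fr own σ) {m : Fin n} (hm : (π m : ℕ) = t) {a b u v : APt n}
    (ha : Consec P (seps π (t + 1)) a (.pt m)) (hb : Consec P (seps π (t + 1)) (.pt m) b)
    (hu : Consec P C u (.pt m)) (hv : Consec P C (.pt m) v) (hW : fr + 1 < W) :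
    Runs W openNode σ 18 (Opened a b u v m t fr σ) := by
  have r2 := h.base.consts.r2
  have r5 := h.reg5
  have r10 := h.reg10
  have e1 : σ.mem 12 (t + 1) = m := hm ▸ h.inv m
  have e2 : σ.mem 16 m = a.code := (h.seps _ _ ha).2
  have e3 : σ.mem 15 m = b.code := (h.seps _ _ hb).1
  have e4 : σ.mem 14 m = u.code := (h.poly _ _ hu).2
  have e5 : σ.mem 13 m = v.code := (h.poly _ _ hv).1
  have hma : (m : ℕ) ≠ a.code := fun he => ALtX.irrefl a (by
    have : APt.pt m = a := APt.code_injective he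
    exact this ▸ ha.lt)
  refine Runs.free ?_ (by decide) ⟨?_, ?_, ?_, ?_, ?_, ?_, ?_, ?_, ?_, ?_, ?_, ?_, ?_, ?_, ?_, ?_, ?_⟩
  · simp [openNode, blk, Prog.Safe, Instr.Safe, Prog.eff, Instr.eff, r2, r5, r10]; omega
  case refine_10 =>
    intro j hj x hx
    interval_cases j <;>
      simp [openNode, blk, Prog.eff, Instr.eff, r2, r5, r10, e1, e2, e3, e4, e5, hma, hx]
  all_goals
    simp [openNode, blk, Prog.eff, Instr.eff, r2, r5, r10, e1, e2, e3, e4, e5, hma]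

theorem ALtX.le_trans {x y z : APt n} (h : x = y ∨ ALtX P x y) (h' : y = z ∨ ALtX P y z) :
    x = z ∨ ALtX P x z := by
  rcases h with rfl | h
  · exact h'
  · rcases h' with rfl | h'
    exacts [.inr h, .inr (h.trans h')]

theorem ALtX.not_lt_of_le {x y : APt n} (h : x = y ∨ ALtX P x y) : ¬ ALtX P y x := by
  rcases h with rfl | h
  exacts [ALtX.irrefl _, fun h' => h.asymm h']

/-- Treat the apex with the priority in register 10. -/
def nodeProg : Prog := .seq openNode (.seq funnelProg closeNode)

/-- Old records are below `fr` and no cell of them is overwritten, so the subtrees survive; the new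
record and its lists are at addresses from `fr` on. The allocation advances by one plus the numbers
of chords and chain vertices, which is at most three plus twice the number of points that leave `C`.
This is why `space` gives weight 2 to `C` and weight 3 to `t`. -/
theorem Sweep.step {t fr : ℕ} {σ s1 s2 s3 : State} {C : Set (APt n)} {own : ℕ → APt n}
    (hP : Function.Injective P) (h : Sweep P π (t + 1) C fr own σ) {m p q : Fin n}
    (hm : (π m : ℕ) = t) {a b u v : APt n} {L R : List (Fin n)} {T : List (Fin n × Fin n)}
    {br : Option (Fin n × Fin n)}
    (ha : Consec P (PseudoTri.seps π (t + 1)) a (.pt m))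
    (hb : Consec P (PseudoTri.seps π (t + 1)) (.pt m) b)
    (f1 : Frame openNode σ s1) (o : Opened a b u v m t fr σ s1)
    (hs : NodeStep P π C a b m L R T br p q) (f2 : Frame funnelProg s1 s2)
    (m5 : ∀ x, s2.mem 5 x = if x = fr then (bridgeCode br).1 else s1.mem 5 x)
    (m6 : ∀ x, s2.mem 6 x = if x = fr then (bridgeCode br).2 else s1.mem 6 x)
    (f3 : Frame closeNode s2 s3) (c : Closed P C L R T p q fr s2 s3) :
    ∃ fr' own', Sweep P π t (cut P C (.pt p) (.pt q)) fr' own' s3 := by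
  have hab := ha.lt.trans hb.lt
  have hap := le_of_mem_gap hab hs.left
  have hqb := le_of_mem_gap hab hs.right
  have eqcut := seps_eq_cut hm hP ha hb
  have c0 : Consec P (PseudoTri.seps π t) a b := eqcut ▸ Consec.cut_self ha.left hb.right hab
  have hold : ∀ j < 10, ∀ x < fr, s3.mem j x = σ.mem j x := by
    intro j hj x hx
    have hx' := hx.ne
    interval_cases j
    · rw [c.old 0 (by omega) x hx.le, f2.mem 0 rfl, o.old 0 (by omega) x hx']
    · rw [c.old 1 (by omega) x hx.le, f2.mem 1 rfl, o.old 1 (by omega) x hx']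
    · rw [c.old 2 (by omega) x hx.le, f2.mem 2 rfl, o.old 2 (by omega) x hx']
    · rw [c.old 3 (by omega) x hx.le, f2.mem 3 rfl, o.old 3 (by omega) x hx']
    · rw [c.old 4 (by omega) x hx.le, f2.mem 4 rfl, o.old 4 (by omega) x hx']
    · rw [f3.mem 5 rfl, m5, if_neg hx', f1.mem 5 rfl]
    · rw [f3.mem 6 rfl, m6, if_neg hx', f1.mem 6 rfl]
    · rw [c.old7 x hx', f2.mem 7 rfl, f1.mem 7 rfl]
    · rw [c.old8 x hx', f2.mem 8 rfl, f1.mem 8 rfl]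
    · rw [c.old9 x hx', f2.mem 9 rfl, f1.mem 9 rfl]
  have m17 : ∀ x, s3.mem 17 x = if x = a.code then fr else σ.mem 17 x := by
    rw [f3.mem 17 rfl, f2.mem 17 rfl]; exact o.mem17
  have hlen := hs.len
  have hsp := h.space
  -- Only the two gaps at `m` are fused; every other gap was there before and does not have `m` as
  -- its left end.
  have hout : ∀ a' b', Consec P (PseudoTri.seps π t) a' b' → (a' = a ∧ b' = b) ∨
      a' ≠ a ∧ a' ≠ .pt m ∧ Consec P (PseudoTri.seps π (t + 1)) a' b' := by
    intro a' b' hc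
    have hne : a' ≠ .pt m := by
      rintro rfl
      have := pt_mem_seps.1 hc.left
      omega
    rw [eqcut] at hc
    exact (hc.of_cut hP ha.left hb.right hab).imp id fun h => ⟨h.1, hne, h.2.2⟩
  classical
  -- A gap is named by its left end. The records of the gap on the right of `m` and all new records
  -- pass to the gap that starts at `a`.
  refine ⟨fr + 1 + T.length + L.length + R.length,
    fun x => if fr ≤ x ∨ own x = .pt m then a else own x, ?_, ?_, ?_, ?_, ?_, ?_, ?_, c.poly,
    ?_, ?_, ?_, ?_, ?_⟩
  · exact ((h.base.frame f1 rfl rfl rfl rfl).frame f2 rfl rfl rfl rfl).frame f3 rfl rfl rfl rfl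
  · have := h.le; omega
  · exact c.reg5
  · rw [f3.reg 10 rfl, f2.reg 10 rfl, o.reg10]
  · omega
  · rw [f3.mem 12 rfl, f2.mem 12 rfl, f1.mem 12 rfl]
    exact h.inv
  · rw [eqcut]
    refine h.seps.cut hP ha.left hb.right hab ?_ ?_
    · rw [f3.mem 15 rfl, f2.mem 15 rfl]; exact o.mem15
    · rw [f3.mem 16 rfl, f2.mem 16 rfl]; exact o.mem16
  · exact ⟨h.negInf_mem, fun hc => by simp [ALtX] at hc⟩
  · exact ⟨h.posInf_mem, fun hc => by simp [ALtX] at hc⟩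
  -- The bridge ends are in the fused gap, so no point strictly between them belongs to another gap.
  · intro a' b' hc z hz
    rcases hout a' b' hc with ⟨rfl, rfl⟩ | ⟨hne, -, hc'⟩
    · exact hs.hull z hz
    rw [← h.hull a' b' hc' z hz]
    refine and_iff_left ?_
    rintro ⟨h1, h2⟩
    have hz' := le_of_mem_gap hc'.lt hz
    rcases c0.le_or_le hP hc.left with h3 | h3
    · rcases hc.le_or_le hP c0.left with h4 | h4
      · rcases h4 with h4 | h4
        · exact hne h4.symm
        · exact ALtX.not_lt_of_le h3 h4
      · exact ALtX.not_lt_of_le (ALtX.le_trans hz'.2 (ALtX.le_trans (h4.imp Eq.symm id)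
          (hap.1.imp Eq.symm id))) h1
    · exact ALtX.not_lt_of_le (ALtX.le_trans hqb.2 (ALtX.le_trans (h3.imp Eq.symm id)
          (hz'.1.imp Eq.symm id))) h2
  · intro a' b' hc
    rcases hout a' b' hc with ⟨rfl, rfl⟩ | ⟨hne, hne', hc'⟩
    · obtain ⟨Tl, Al, pl, sl, nl, ol⟩ := h.tree _ _ ha
      obtain ⟨Tr, Ar, pr, sr, nr, or⟩ := h.tree _ _ hb
      obtain ⟨A₁, A₂, A₃, s1', s2', s3', nd, rg⟩ := c.lists
      refine ⟨.node ⟨m, a', b', br, balTree L, balTree R, balTree T⟩ Tl Tr,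
        fr :: (A₁ ++ A₂ ++ A₃ ++ Al ++ Ar), .node hs.spec ?_ ?_, ?_, ?_, ?_⟩
      · rwa [leftPart_gap ha.lt hb.lt]
      · rwa [rightPart_gap ha.lt hb.lt]
      · rw [m17, if_pos rfl]
        refine ⟨h.pos.ne', ?_, ?_, ?_, ?_, ?_, A₁, A₂, A₃, Al, Ar, s1', s2', s3', ?_, ?_, rfl⟩
        · rw [c.old 2 (by omega) _ le_rfl, f2.mem 2 rfl, o.mem2]
        · rw [c.old 3 (by omega) _ le_rfl, f2.mem 3 rfl, o.mem3]
        · rw [c.old 4 (by omega) _ le_rfl, f2.mem 4 rfl, o.mem4]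
        · rw [f3.mem 5 rfl, m5, if_pos rfl]
        · rw [f3.mem 6 rfl, m6, if_pos rfl]
        · rw [c.old 0 (by omega) _ le_rfl, f2.mem 0 rfl, o.mem0]
          exact sl.congr fun x hx j hj => hold j hj x (ol x hx).2.1
        · rw [c.old 1 (by omega) _ le_rfl, f2.mem 1 rfl, o.mem1]
          exact sr.congr fun x hx j hj => hold j hj x (or x hx).2.1
      -- The two subtrees share no record because their owners, `a'` and `m`, differ.
      · have hlr : (Al ++ Ar).Nodup := by
          refine List.nodup_append.2 ⟨nl, nr, ?_⟩
          rintro x hx y hy rfl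
          have : a' = .pt m := (ol x hx).2.2.symm.trans (or x hy).2.2
          exact ALtX.irrefl _ (this ▸ ha.lt)
        have hlt : ∀ x ∈ Al ++ Ar, x < fr := fun x hx => by
          rcases List.mem_append.1 hx with hx | hx
          exacts [(ol x hx).2.1, (or x hx).2.1]
        rw [List.append_assoc]
        refine List.nodup_cons.2 ⟨fun hx => ?_, List.nodup_append.2 ⟨nd, hlr, ?_⟩⟩
        · rcases List.mem_append.1 hx with hx | hx
          · exact absurd (rg _ hx).1 (lt_irrefl _)
          · exact absurd (hlt _ hx) (lt_irrefl _)
        · rintro x hx y hy rfl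
          exact absurd ((rg x hx).1.trans (hlt x hy)) (lt_irrefl _)
      · intro x hx
        have hpos := h.pos
        rw [List.append_assoc] at hx
        rcases List.mem_cons.1 hx with rfl | hx
        · exact ⟨hpos, by omega, if_pos (.inl le_rfl)⟩
        · rcases List.mem_append.1 hx with hx | hx
          · have := rg x hx
            rw [c.reg5] at this
            exact ⟨by omega, this.2, if_pos (.inl this.1.le)⟩
          · rcases List.mem_append.1 hx with hx | hx
            · obtain ⟨h1, h2, h3⟩ := ol x hx
              refine ⟨h1, by omega, ?_⟩
              rw [h3]; exact ite_self _
            · obtain ⟨h1, h2, h3⟩ := or x hx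
              exact ⟨h1, by omega, if_pos (.inr h3)⟩
    · obtain ⟨T', A, hp, hst, hnd, ho⟩ := h.tree a' b' hc'
      refine ⟨T', A, hp, ?_, hnd, fun x hx => ?_⟩
      · rw [m17, if_neg fun h => hne (APt.code_injective h)]
        exact hst.congr fun x hx j hj => hold j hj x (ho x hx).2.1
      · obtain ⟨h1, h2, h3⟩ := ho x hx
        refine ⟨h1, by omega, ?_⟩
        rw [h3, if_neg]
        rintro (h4 | h4)
        exacts [absurd h2 h4.not_gt, hne' h4]
  · omega

/-- The time for the rest of the sweep. -/
def sweepTime (n t k : ℕ) : ℕ :=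
  (2 * (11 * Nat.log 2 n + 47) + 48) * k + (2 * (11 * Nat.log 2 n + 47) + 140) * t

/-- The time spent is covered by the drop of the potential `sweepTime`. With `g = 11 log n + 47`,
the balanced trees cost `g` for each chord and each chain vertex, and the search for the bridge 48
for each chord. By `NodeStep.len` and `NodeStep.lenT` this is at most `2 g + 48` for each point that
leaves `C`, plus `2 g` and a constant below 140. -/
theorem runs_nodeProg {W t fr : ℕ} {σ : State} {C : Set (APt n)} {own : ℕ → APt n}
    (hP : Function.Injective P) (h : Sweep P π (t + 1) C fr own σ) (hW : 11 * n + 10 < W) :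
    ∃ k C', Runs W nodeProg σ k (fun σ' => ∃ fr' own', Sweep P π t C' fr' own' σ') ∧
      k + 1 + sweepTime n t C'.ncard ≤ sweepTime n (t + 1) C.ncard := by
  have htn : t < n := h.le
  obtain ⟨m, hm⟩ : ∃ m, (π m : ℕ) = t := ⟨π.symm ⟨t, htn⟩, by simp⟩
  have hmS : APt.pt m ∈ seps π (t + 1) := pt_mem_seps.2 (by omega)
  obtain ⟨a, ha⟩ := exists_prev (P := P) (negInf_mem_seps (π := π) (t := t + 1)) hmS trivial
  obtain ⟨b, hb⟩ := exists_next (P := P) hmS (posInf_mem_seps (π := π) (t := t + 1)) trivial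
  have hmC : APt.pt m ∈ C :=
    (h.hull _ _ ha _ (.inr (.inl rfl))).2 (mem_upperHull_right ha.lt)
  obtain ⟨u, hu⟩ := exists_prev (P := P) h.negInf_mem hmC trivial
  obtain ⟨v, hv⟩ := exists_next (P := P) hmC h.posInf_mem trivial
  -- A point of smaller priority between `a` and `b` would still be a separator, contrary to the
  -- choice of `a` and `b` as the neighbours of `m`.
  have hmin : ∀ i, ALtX P a (.pt i) → ALtX P (.pt i) b → π m ≤ π i := by
    intro i h1 h2
    by_contra! hc
    have hi : APt.pt i ∈ seps π (t + 1) := pt_mem_seps.2 (by have := Fin.lt_def.1 hc; omega)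
    by_cases hne : APt.pt i = .pt m
    · cases hne; exact lt_irrefl _ hc
    · rcases ALtX.total hP hne with h3 | h3
      exacts [ha.not_between _ hi h1 h3, hb.not_between _ hi h3 h2]
  have hsp := h.space
  obtain ⟨t₁, ht₁, s1, e1, o⟩ := runs_openNode (W := W) h hm ha hb hu hv (by omega)
  have f1 := e1.frame
  obtain ⟨L, R, T, br, p, q, hs, t₂, ht₂, s2, e2, hT, r15, r16, m5, m6⟩ := runs_funnelProg (W := W) hP
    (by omega) (h.base.frame f1 rfl rfl rfl rfl) h.negInf_mem h.posInf_mem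
    (h.poly.congr (f1.mem 13 rfl) (f1.mem 14 rfl)) ha.lt hb.lt hmin (h.hull _ _ ha) (h.hull _ _ hb)
    hu hv o.reg11 o.reg12 o.reg13 o.reg14 o.reg15 o.reg16
  have f2 := e2.frame
  have hlen := hs.len
  have hlenT := hs.lenT
  have lT := hs.lenT'
  have lL := hs.lenL
  have lR := hs.lenR
  obtain ⟨t₃, ht₃, s3, e3, c⟩ := runs_closeNode (W := W) hP
    ((h.base.frame f1 rfl rfl rfl rfl).frame f2 rfl rfl rfl rfl).consts (by omega) h.posInf_mem
    ((h.poly.congr (f1.mem 13 rfl) (f1.mem 14 rfl)).congr (f2.mem 13 rfl) (f2.mem 14 rfl)) hs hT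
    ((f2.reg 5 rfl).trans o.reg5) ((f2.reg 11 rfl).trans o.reg11) ((f2.reg 14 rfl).trans o.reg14)
    r15 r16
  refine ⟨t₁ + (t₂ + t₃), cut P C (.pt p) (.pt q), ⟨_, le_rfl, s3, .seq e1 (.seq e2 e3),
    h.step hP hm ha hb f1 o hs f2 m5 m6 e3.frame c⟩, ?_⟩
  simp only [sweepTime]
  have := Nat.mul_le_mul_left (11 * Nat.log 2 n + 47) hlen
  generalize 11 * Nat.log 2 n + 47 = g at *
  generalize (cut P C (.pt p) (.pt q)).ncard = N' at *
  nlinarith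

/-- Treat all points, from the last to the first. -/
def sweepProg : Prog := .loop (.lt 4 10) nodeProg

theorem runs_sweepProg {W t fr : ℕ} {σ : State} {C : Set (APt n)} {own : ℕ → APt n}
    (hP : Function.Injective P) (h : Sweep P π t C fr own σ) (hW : 11 * n + 10 < W) :
    Runs W sweepProg σ (sweepTime n t C.ncard + 1) fun σ' =>
      ∃ C' fr' own', Sweep P π 0 C' fr' own' σ' := by
  refine (Runs.loop σ (fun b s => ∃ t C fr own, Sweep P π t C fr own s ∧ b = sweepTime n t C.ncard)
    ?_ ⟨t, C, fr, own, h, rfl⟩).mono le_rfl ?_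
  · rintro b s ⟨t, C, fr, own, hs, rfl⟩ - hc
    simp only [Test.Holds, hs.base.consts.r4, hs.reg10] at hc
    obtain ⟨t, rfl⟩ : ∃ t', t = t' + 1 := ⟨t - 1, by omega⟩
    obtain ⟨k, C', hr, hk⟩ := runs_nodeProg hP hs hW
    refine ⟨k, hr.mono le_rfl fun s' _ ⟨fr', own', hs'⟩ => ⟨_, hk, t, C', fr', own', hs', rfl⟩⟩
  · rintro s - ⟨⟨b, t, C, fr, own, hs, -⟩, -, hc⟩
    simp only [Test.Holds, hs.base.consts.r4, hs.reg10, not_lt, Nat.le_zero] at hc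
    exact ⟨C, fr, own, hc ▸ hs⟩

/-- Build the tree of the upper hull, and put the pointers to both trees into registers 0 and 1. -/
def finishProg : Prog :=
  .seq (blk [.load 25 13 0, .move 26 1])
    (.seq listTree (blk [.move 1 24, .load 0 17 0]))

/-- At the end the dummies are the only separators. Their gap is the whole set, so its tree is the
tree sought and the hull list is the upper hull of all points. -/
theorem runs_finishProg {W fr : ℕ} {σ : State} {C : Set (APt n)} {own : ℕ → APt n}
    (hP : Function.Injective P) (h : Sweep P π 0 C fr own σ) (hW : 8 * n + 10 < W) :
    Runs W finishProg σ (n * (11 * Nat.log 2 n + 47) + 15) fun σ' =>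
      ∃ S : AugTree n, IsAugTree P π S ∧ Stores P π σ' S := by
  have c0 : Consec P (seps π 0) .negInf .posInf := by
    rw [seps_zero]
    refine ⟨by simp, by simp, trivial, ?_⟩
    rintro c (rfl | rfl) h1 h2
    exacts [ALtX.irrefl _ h1, ALtX.irrefl _ h2]
  have hull := h.hull _ _ c0
  obtain ⟨T, A, hT, sT, nA, oA⟩ := h.tree _ _ c0
  rw [gap_univ] at hull hT
  have hC : ∀ z, z ∈ C ↔ z ∈ upperHull P Set.univ := fun z => hull z trivial
  obtain ⟨l, hl, ml⟩ := exists_sorted hP {i | .pt i ∈ C}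
  have hln := (nodup_of_ltX hl).length_le_card
  rw [Fintype.card_fin] at hln
  have hsz := size_le_log hln
  have hsp := h.space
  have hb : l.length * (11 * Nat.size l.length + 36) ≤ n * (11 * Nat.log 2 n + 47) :=
    Nat.mul_le_mul hln (by omega)
  have adj : ∀ x y, [x, y] <:+: l → Consec P C (.pt x) (.pt y) := by
    intro x y hxy
    refine ⟨(ml x).1 (hxy.subset (by simp)), (ml y).1 (hxy.subset (by simp)),
      show LtX P x y by simpa using hl.sublist hxy.sublist, fun c hc h1 h2 => ?_⟩
    obtain ⟨i, rfl⟩ := exists_pt_of_between h1 h2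
    exact Pairwise.not_between LtX.irrefl (fun _ _ _ => LtX.trans) hl hxy ((ml i).2 hc) h1 h2
  have last : ∀ x ∈ l.getLast?, Consec P C (.pt x) .posInf := by
    intro x hx
    refine ⟨(ml x).1 (List.mem_of_mem_getLast? hx), h.posInf_mem, trivial, fun c hc h1 h2 => ?_⟩
    obtain ⟨i, rfl⟩ := exists_pt_of_between h1 h2
    rcases Pairwise.rel_getLast? hl hx ((ml i).2 hc) with rfl | h3
    exacts [LtX.irrefl _ h1, LtX.irrefl _ (LtX.trans h1 h3)]
  -- The address `n` is the code of the left dummy, whose successor is the first hull vertex, or the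
  -- right dummy with code `n + 1` if there are no points.
  have first : [σ.mem 13 n] <+: l.map Fin.val ++ [n + 1] := by
    cases l with
    | nil =>
      have : Consec P C .negInf .posInf := by
        refine ⟨h.negInf_mem, h.posInf_mem, trivial, fun c hc h1 h2 => ?_⟩
        obtain ⟨i, rfl⟩ := exists_pt_of_between h1 h2
        simpa using (ml i).2 hc
      rw [show σ.mem 13 n = n + 1 from (h.poly _ _ this).1]
      simp
    | cons x l =>
      have : Consec P C .negInf (.pt x) := by
        refine ⟨h.negInf_mem, (ml x).1 (by simp), trivial, fun c hc h1 h2 => ?_⟩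
        obtain ⟨i, rfl⟩ := exists_pt_of_between h1 h2
        rcases List.mem_cons.1 ((ml i).2 hc) with rfl | hi
        · exact LtX.irrefl _ h2
        · exact LtX.irrefl _ (LtX.trans h2 (List.rel_of_pairwise_cons hl hi))
      rw [show σ.mem 13 n = x from (h.poly _ _ this).1]
      exact ⟨l.map Fin.val ++ [n + 1], by simp⟩
  have r0 := h.base.consts.r0
  have r1 := h.base.consts.r1
  refine Runs.seq (a := 2) (b := n * (11 * Nat.log 2 n + 47) + 13)
    (R := fun s => s.reg 25 = σ.mem 13 n ∧ s.reg 26 = n + 1) (Runs.free ?_ (by decide) ?_) ?_ (by omega)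
  · simp [blk, Prog.Safe, Instr.Safe]
  · simp [blk, Prog.eff, Instr.eff, r0, r1]
  rintro s1 f1 ⟨a25, a26⟩
  have hB1 := h.base.frame f1 rfl rfl rfl rfl
  refine Runs.seq (runs_listTree (W := W) (base := fr) (N := n + 1) (e := n + 1) s1 l (by omega) h.pos
    hB1.consts.r2 hB1.consts.r4 ((f1.reg 5 rfl).trans h.reg5) a26 (by omega) le_rfl (a25 ▸ first)
    ?_ ?_) (b := 2) ?_ (by omega)
  · refine List.isChain_append.2 ⟨(List.isChain_map _).2 (isChain_of_infix fun x y hxy => ?_),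
      List.isChain_singleton _, ?_⟩
    · rw [f1.mem 13 rfl]
      exact (h.poly _ _ (adj x y hxy)).1
    · intro i hi j hj
      rw [List.getLast?_map] at hi
      obtain ⟨x, hx, rfl⟩ := Option.map_eq_some_iff.1 (Option.mem_def.1 hi)
      obtain rfl : n + 1 = j := by simpa using hj
      rw [f1.mem 13 rfl]
      exact (h.poly _ _ (last x hx)).1
  · intro hm
    obtain ⟨i, -, hi⟩ := List.mem_map.1 hm
    omega
  rintro s2 f2 ⟨-, old, B, sB, nB, rB⟩
  have hB2 := hB1.frame f2 rfl rfl rfl rfl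
  have hmem : ((blk [.move 1 24, .load 0 17 0]).eff s2).mem = s2.mem := by
    simp [blk, Prog.eff, Instr.eff]
  refine Runs.free ?_ (by decide) ⟨⟨T, balTree l⟩, ⟨hT, ?_, balanced_balTree l⟩, ?_, A, B, ?_, ?_, ?_⟩
  · simp [blk, Prog.Safe, Instr.Safe]
  · rw [inorder_balTree]
    exact ⟨hl, fun r => (ml r).trans (hC _)⟩
  · intro i
    rw [hmem, show ((blk [.move 1 24, .load 0 17 0]).eff s2).rmem = s2.rmem by
      simp [blk, Prog.eff, Instr.eff]]
    exact hB2.points i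
  · have hroot : ((blk [.move 1 24, .load 0 17 0]).eff s2).reg 0 = σ.mem 17 n := by
      simp [blk, Prog.eff, Instr.eff, hB2.consts.r0, f2.mem 17 rfl, f1.mem 17 rfl]
    rw [hroot]
    refine StoresTree.congr sT fun x hx j hj => ?_
    rw [hmem]
    have hx' := (oA x hx).2.1
    interval_cases j
    · rw [old 0 (by omega) x hx', f1.mem 0 rfl]
    · rw [old 1 (by omega) x hx', f1.mem 1 rfl]
    · rw [old 2 (by omega) x hx', f1.mem 2 rfl]
    · rw [old 3 (by omega) x hx', f1.mem 3 rfl]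
    · rw [old 4 (by omega) x hx', f1.mem 4 rfl]
    · rw [f2.mem 5 rfl, f1.mem 5 rfl]
    · rw [f2.mem 6 rfl, f1.mem 6 rfl]
    · rw [f2.mem 7 rfl, f1.mem 7 rfl]
    · rw [f2.mem 8 rfl, f1.mem 8 rfl]
    · rw [f2.mem 9 rfl, f1.mem 9 rfl]
  · have hroot : ((blk [.move 1 24, .load 0 17 0]).eff s2).reg 1 = s2.reg 24 := by
      simp [blk, Prog.eff, Instr.eff]
    rw [hroot]
    exact sB.congr fun x _ j _ => by rw [hmem]
  · refine List.nodup_append.2 ⟨nA, nB, ?_⟩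
    rintro x hx y hy rfl
    have := (oA x hx).2.1
    have := (rB x hy).1
    omega

end PseudoTri

/-! ### Sorting with a tournament tree -/

namespace PseudoTri

open RealRAM

variable {n : ℕ} {P : Fin n → ℝ × ℝ} {π : Equiv.Perm (Fin n)}

/-- `x` names the leftmost point of `S`, or is `n` if `S` is empty. -/
def IsMinOf (P : Fin n → ℝ × ℝ) (x : ℕ) (S : Set (Fin n)) : Prop :=
  (x = n ∧ S = ∅) ∨ ∃ i : Fin n, x = i ∧ i ∈ S ∧ ∀ j ∈ S, j = i ∨ LtX P i j

/-- Replace the point in register 20 by the one in register 21, if the latter is more to the left. -/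
def leftmostProg : Prog :=
  .branch (.eq 21 0) .skip (.branch (.eq 20 0) (.instr (.move 20 21))
    (.seq (blk [.rload 1 0 20, .rload 2 0 21]) (.branch (.rlt 2 1) (.instr (.move 20 21))
      (.branch (.rlt 1 2) .skip (.seq (blk [.rload 1 1 20, .rload 2 1 21])
        (.branch (.rlt 2 1) (.instr (.move 20 21)) .skip))))))

theorem runs_leftmostProg {W : ℕ} {σ : State} (hP : Function.Injective P) (hB : Base P π σ)
    {S S' : Set (Fin n)} (h : IsMinOf P (σ.reg 20) S) (h' : IsMinOf P (σ.reg 21) S') :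
    Runs W leftmostProg σ 10 fun σ' => IsMinOf P (σ'.reg 20) (S ∪ S') := by
  have r0 := hB.consts.r0
  rcases h' with ⟨e', rfl⟩ | ⟨i', e', hi', hm'⟩
  · refine Runs.free ?_ (by decide) ?_
    · simp [leftmostProg, Prog.Safe, Test.Holds, e', r0]
    · simpa [leftmostProg, Prog.eff, Test.Holds, e', r0] using h
  have hne' : (i' : ℕ) ≠ n := i'.isLt.ne
  rcases h with ⟨e, rfl⟩ | ⟨i, e, hi, hm⟩
  · refine Runs.free ?_ (by decide) (.inr ⟨i', ?_, .inr hi', by simpa using hm'⟩)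
    · simp [leftmostProg, Prog.Safe, Instr.Safe, Test.Holds, e, e', r0, hne']
    · simp [leftmostProg, Prog.eff, Instr.eff, Test.Holds, e, e', r0, hne']
  have hne : (i : ℕ) ≠ n := i.isLt.ne
  obtain ⟨x1, x2, -⟩ := hB.points i
  obtain ⟨y1, y2, -⟩ := hB.points i'
  refine Runs.free ?_ (by decide) ?_
  · simp [leftmostProg, blk, Prog.Safe, Instr.Safe]
  by_cases hlt : LtX P i' i
  · refine .inr ⟨i', ?_, .inr hi', ?_⟩
    · rcases hlt with h1 | ⟨h1, h2⟩
      · simp [leftmostProg, blk, Prog.eff, Instr.eff, Test.Holds, e, e', r0, hne, hne', x1, y1, h1]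
      · simp [leftmostProg, blk, Prog.eff, Instr.eff, Test.Holds, e, e', r0, hne, hne', x1, y1, x2, y2,
          h1, h2]
    · rintro j (hj | hj)
      · rcases hm j hj with rfl | h
        exacts [.inr hlt, .inr (hlt.trans h)]
      · exact hm' j hj
  · refine .inr ⟨i, ?_, .inl hi, ?_⟩
    · have h1 : ¬ (P i').1 < (P i).1 := fun h => hlt (.inl h)
      by_cases h2 : (P i).1 < (P i').1
      · simp [leftmostProg, blk, Prog.eff, Instr.eff, Test.Holds, e, e', r0, hne, hne', x1, y1, h1, h2]
      · have h3 : ¬ (P i').2 < (P i).2 := fun h => hlt (.inr ⟨le_antisymm (not_lt.1 h2) (not_lt.1 h1), h⟩)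
        simp [leftmostProg, blk, Prog.eff, Instr.eff, Test.Holds, e, e', r0, hne, hne', x1, y1, x2, y2,
          h1, h2, h3]
    · rintro j (hj | hj)
      · exact hm j hj
      · have hle : i = i' ∨ LtX P i i' := by
          by_cases h : i = i'
          exacts [.inl h, .inr ((LtX.total hP h).resolve_right hlt)]
        rcases hm' j hj with rfl | h
        · exact hle.imp Eq.symm id
        · rcases hle with rfl | h'
          exacts [.inr h, .inr (h'.trans h)]

/-! ### The tournament tree -/

/-- Node `j` of the tournament tree is `i` or an ancestor of `i`. -/
def Anc (i j : ℕ) : Prop := ∃ k, i / 2 ^ k = j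

theorem Anc.refl (i : ℕ) : Anc i i := ⟨0, by simp⟩

theorem Anc.half {i j : ℕ} (h : Anc (i / 2) j) : Anc i j := by
  obtain ⟨k, hk⟩ := h
  exact ⟨k + 1, by rw [pow_succ', ← Nat.div_div_eq_div_mul, hk]⟩

theorem Anc.eq_or_half {i j : ℕ} (h : Anc i j) : j = i ∨ Anc (i / 2) j := by
  obtain ⟨k, hk⟩ := h
  cases k with
  | zero => exact .inl (by simpa using hk.symm)
  | succ k => exact .inr ⟨k, by rw [Nat.div_div_eq_div_mul, ← pow_succ', hk]⟩

theorem Anc.le {i j : ℕ} (h : Anc i j) : j ≤ i := by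
  obtain ⟨k, rfl⟩ := h
  exact Nat.div_le_self _ _

theorem Anc.one {i : ℕ} (h : 0 < i) : Anc i 1 := by
  induction i using Nat.strong_induction_on with
  | _ i ih =>
    rcases Nat.lt_or_ge i 2 with h' | h'
    · obtain rfl : i = 1 := by omega
      exact .refl 1
    · exact (ih (i / 2) (by omega) (by omega)).half

/-- The leaves have the numbers from `n` to `2 n - 1`, and halving any of them gives a number below
`n`; so no leaf is a proper ancestor of another. This needs no power of two. -/
theorem anc_leaf {i j : Fin n} : Anc (n + i) (n + j) ↔ i = j := by
  refine ⟨fun h => ?_, fun h => h ▸ .refl _⟩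
  rcases h.eq_or_half with h | h
  · exact Fin.ext (by omega)
  · have := h.le; omega

theorem anc_children {i j : ℕ} (h : j < i) : Anc i j ↔ Anc i (2 * j) ∨ Anc i (2 * j + 1) := by
  constructor
  · rintro ⟨k, hk⟩
    cases k with
    | zero => simp at hk; omega
    | succ k =>
      rw [pow_succ, ← Nat.div_div_eq_div_mul] at hk
      rcases Nat.mod_two_eq_zero_or_one (i / 2 ^ k) with h | h
      · exact .inl ⟨k, by omega⟩
      · exact .inr ⟨k, by omega⟩
  · rintro (⟨k, hk⟩ | ⟨k, hk⟩) <;>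
      exact ⟨k + 1, by rw [pow_succ, ← Nat.div_div_eq_div_mul, hk]; omega⟩

/-- Node `j` of the tournament tree in segment 11 holds the leftmost of the points of `V` below it. -/
def Wins (P : Fin n → ℝ × ℝ) (V : Set (Fin n)) (σ : State) (j : ℕ) : Prop :=
  IsMinOf P (σ.mem 11 j) {i : Fin n | Anc (n + i) j ∧ i ∈ V}

/-- Play the match at the node in register 6. -/
def matchProg : Prog :=
  .seq (blk [.add 7 6 6, .load 20 11 7, .add 7 7 2, .load 21 11 7])
    (.seq leftmostProg (.instr (.store 11 6 20)))

theorem runs_matchProg {W j : ℕ} {σ : State} {V : Set (Fin n)} (hP : Function.Injective P)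
    (hB : Base P π σ) (hW : 2 * n + 1 < W) (hj : j < n) (h6 : σ.reg 6 = j)
    (h1 : Wins P V σ (2 * j)) (h2 : Wins P V σ (2 * j + 1)) :
    Runs W matchProg σ 15 fun σ' => Wins P V σ' j ∧ ∀ i ≠ j, σ'.mem 11 i = σ.mem 11 i := by
  have r2 := hB.consts.r2
  refine Runs.seq (a := 4) (b := 11)
    (R := fun s => s.reg 20 = σ.mem 11 (2 * j) ∧ s.reg 21 = σ.mem 11 (2 * j + 1))
    (Runs.free ?_ (by decide) ?_) ?_ le_rfl
  · simp [blk, Prog.Safe, Instr.Safe, Prog.eff, Instr.eff, h6, r2]; omega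
  · simp [blk, Prog.eff, Instr.eff, h6, r2, two_mul]
  rintro s1 f1 ⟨a20, a21⟩
  rw [Wins, ← a20] at h1
  rw [Wins, ← a21] at h2
  refine Runs.seq (a := 10) (b := 1) (runs_leftmostProg hP (hB.frame f1 rfl rfl rfl rfl) h1 h2) ?_
    le_rfl
  intro s2 f2 hm
  have e6 : s2.reg 6 = j := (f2.reg 6 rfl).trans ((f1.reg 6 rfl).trans h6)
  have e11 : s2.mem 11 = σ.mem 11 := (f2.mem 11 rfl).trans (f1.mem 11 rfl)
  refine Runs.free ?_ (by decide) ⟨?_, ?_⟩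
  · simp [Prog.Safe, Instr.Safe]
  · have hset : {i : Fin n | Anc (n + i) j ∧ i ∈ V} =
        {i : Fin n | Anc (n + i) (2 * j) ∧ i ∈ V} ∪ {i : Fin n | Anc (n + i) (2 * j + 1) ∧ i ∈ V} := by
      ext i
      simp only [Set.mem_ofPred_eq, Set.mem_union, anc_children (show j < n + i by omega), or_and_right]
    rw [Wins, hset]
    simpa [Prog.eff, Instr.eff, e6] using hm
  · intro i hi
    simp [Prog.eff, Instr.eff, e6, hi, e11]

theorem Wins.congr {V V' : Set (Fin n)} {σ σ' : State} {j : ℕ} (h : Wins P V σ j)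
    (hj : σ'.mem 11 j = σ.mem 11 j) (hV : ∀ i : Fin n, Anc (n + i) j → (i ∈ V' ↔ i ∈ V)) :
    Wins P V' σ' j := by
  have hset : {i : Fin n | Anc (n + i) j ∧ i ∈ V'} =
      {i : Fin n | Anc (n + i) j ∧ i ∈ V} :=
    Set.ext fun i => and_congr_right (hV i)
  rw [Wins, hj, hset]
  exact h

/-- Put the points into the leaves of the tournament tree, and invert the permutation. -/
def leavesProg : Prog :=
  .loop (.lt 8 0) (blk [.add 7 0 8, .store 11 7 8, .load 20 10 8, .store 12 20 8, .add 8 8 2])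

theorem runs_leavesProg {W : ℕ} {σ : State} (hB : Base P π σ) (hW : 2 * n + 1 < W)
    (h8 : σ.reg 8 = 0) :
    Runs W leavesProg σ (6 * n + 1) fun σ' =>
      (∀ i : Fin n, σ'.mem 11 (n + i) = i) ∧ ∀ i : Fin n, σ'.mem 12 ((π i : ℕ) + 1) = i := by
  refine (Runs.loop σ (fun b s => b = 6 * (n - s.reg 8) ∧
    (∀ i : Fin n, (i : ℕ) < s.reg 8 → s.mem 11 (n + i) = i) ∧
    ∀ i : Fin n, (i : ℕ) < s.reg 8 → s.mem 12 ((π i : ℕ) + 1) = i) ?_ ?_ (b := 6 * n)).mono le_rfl ?_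
  · rintro b s ⟨rfl, h11, h12⟩ hF hc
    have hBs := hB.frame hF rfl rfl rfl rfl
    have r0 := hBs.consts.r0
    have r2 := hBs.consts.r2
    simp only [Test.Holds, r0] at hc
    have hpr := (hBs.points ⟨s.reg 8, hc⟩).2.2
    simp only at hpr
    refine ⟨5, Runs.free ?_ (by decide) ⟨6 * (n - (s.reg 8 + 1)), by omega, ?_, fun i hi => ?_,
      fun i hi => ?_⟩⟩
    · simp [blk, Prog.Safe, Instr.Safe, Prog.eff, Instr.eff, r0, r2]; omega
    · simp [blk, Prog.eff, Instr.eff, r2]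
    · simp [blk, Prog.eff, Instr.eff, r2] at hi
      simp [blk, Prog.eff, Instr.eff, r0]
      split_ifs with h
      · exact h.symm
      · exact h11 i (by omega)
    · simp [blk, Prog.eff, Instr.eff, r2] at hi
      simp [blk, Prog.eff, Instr.eff, hpr]
      split_ifs with h
      · exact (congrArg Fin.val (π.injective (Fin.ext h))).symm
      · refine h12 i (lt_of_le_of_ne (by omega) fun h' => h ?_)
        congr 2
        exact Fin.ext h'
  · simp [h8]
  · rintro s - ⟨⟨b, rfl, h11, h12⟩, hF, hc⟩
    simp only [Test.Holds, (hB.frame hF rfl rfl rfl rfl).consts.r0, not_lt] at hc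
    exact ⟨fun i => h11 i (by omega), fun i => h12 i (by omega)⟩

/-- Play all matches of the tournament. -/
def playAll : Prog :=
  .seq (.instr (.sub 6 0 2)) (.loop (.lt 4 6) (.seq matchProg (.instr (.sub 6 6 2))))

/-- Matches are played in the order of decreasing node numbers, so that the results at the children
`2 j` and `2 j + 1` are known before node `j` is played. -/
theorem runs_playAll {W : ℕ} {σ : State} (hP : Function.Injective P) (hB : Base P π σ)
    (hW : 2 * n + 1 < W) (hl : ∀ i : Fin n, σ.mem 11 (n + i) = i) :
    Runs W playAll σ (17 * n + 2) fun σ' => ∀ j, 0 < j → j < 2 * n → Wins P Set.univ σ' j := by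
  refine Runs.seq (a := 1) (b := 17 * n + 1) (R := fun s => s.reg 6 = n - 1)
    (Runs.free ?_ (by decide) ?_) ?_ (by omega)
  · simp [Prog.Safe, Instr.Safe]
  · simp [Prog.eff, Instr.eff, hB.consts.r0, hB.consts.r2]
  intro s1 f1 a6
  have hB1 := hB.frame f1 rfl rfl rfl rfl
  refine (Runs.loop s1 (fun b s => b = 17 * s.reg 6 ∧ s.reg 6 ≤ n - 1 ∧
    ∀ j, s.reg 6 < j → j < 2 * n → Wins P Set.univ s j) ?_ (b := 17 * (n - 1)) ?_).mono (by omega) ?_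
  · rintro b s ⟨rfl, hle, hw⟩ hF hc
    have hBs := hB1.frame hF rfl rfl rfl rfl
    simp only [Test.Holds, hBs.consts.r4] at hc
    refine ⟨16, Runs.seq (a := 15) (b := 1) (runs_matchProg hP hBs hW (by omega) rfl
      (hw _ (by omega) (by omega)) (hw _ (by omega) (by omega))) ?_ le_rfl⟩
    rintro s2 f2 ⟨hw2, hold⟩
    have e6 := f2.reg 6 rfl
    have e2 := (hBs.frame f2 rfl rfl rfl rfl).consts.r2
    refine Runs.free ?_ (by decide) ⟨17 * (s.reg 6 - 1), by omega, ?_, ?_, ?_⟩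
    · simp [Prog.Safe, Instr.Safe]
    · simp [Prog.eff, Instr.eff, e6, e2]
    · simp [Prog.eff, Instr.eff, e6, e2]; omega
    · intro j hj hj'
      simp [Prog.eff, Instr.eff, e6, e2] at hj
      have hsame : Wins P Set.univ s2 j := by
        by_cases h : j = s.reg 6
        · exact h ▸ hw2
        · exact (hw j (by omega) hj').congr (hold j h) fun _ _ => Iff.rfl
      exact hsame.congr (by simp [Prog.eff, Instr.eff]) fun _ _ => Iff.rfl
  · refine ⟨by rw [a6], a6.le, fun j hj hj' => ?_⟩
    have hn : n ≤ j := by omega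
    obtain ⟨i, rfl⟩ : ∃ i : Fin n, j = n + i := ⟨⟨j - n, by omega⟩, by simp; omega⟩
    refine .inr ⟨i, ?_, ⟨.refl _, trivial⟩, fun x hx => .inl (anc_leaf.1 hx.1)⟩
    rw [f1.mem 11 rfl, hl]
  · rintro s - ⟨⟨b, rfl, hle, hw⟩, hF, hc⟩
    simp only [Test.Holds, (hB1.frame hF rfl rfl rfl rfl).consts.r4, not_lt, Nat.le_zero] at hc
    exact fun j hj hj' => hw j (by omega) hj'

/-- Replay the matches from the node in register 6 up to the root. -/
def replay : Prog := .loop (.lt 4 6) (.seq matchProg (.instr (.half 6 6)))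

/-- When a leaf changes, only its ancestors can hold a wrong winner. Their number is a bit length,
whence the logarithmic cost. -/
theorem runs_replay {W i : ℕ} {σ : State} {V : Set (Fin n)} (hP : Function.Injective P)
    (hB : Base P π σ) (hW : 2 * n + 1 < W) (h6 : σ.reg 6 = i) (hi : i < n)
    (hw : ∀ j, 0 < j → j < 2 * n → ¬ Anc i j → Wins P V σ j) :
    Runs W replay σ (17 * Nat.size i + 1) fun σ' => ∀ j, 0 < j → j < 2 * n → Wins P V σ' j := by
  refine (Runs.loop σ (fun b s => b = 17 * Nat.size (s.reg 6) ∧ s.reg 6 < n ∧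
    ∀ j, 0 < j → j < 2 * n → ¬ Anc (s.reg 6) j → Wins P V s j) ?_ (b := 17 * Nat.size i)
    ⟨by rw [h6], by rwa [h6], by rwa [h6]⟩).mono le_rfl ?_
  · rintro b s ⟨rfl, hlt, hw⟩ hF hc
    have hBs := hB.frame hF rfl rfl rfl rfl
    simp only [Test.Holds, hBs.consts.r4] at hc
    refine ⟨16, Runs.seq (a := 15) (b := 1) (runs_matchProg hP hBs hW hlt rfl
      (hw _ (by omega) (by omega) fun h => by have := h.le; omega)
      (hw _ (by omega) (by omega) fun h => by have := h.le; omega)) ?_ le_rfl⟩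
    rintro s2 f2 ⟨hw2, hold⟩
    have e6 := f2.reg 6 rfl
    have hsz := size_half hc
    refine Runs.free ?_ (by decide) ⟨17 * Nat.size (s.reg 6 / 2), by omega, ?_, ?_, ?_⟩
    · simp [Prog.Safe, Instr.Safe]
    · simp [Prog.eff, Instr.eff, e6]
    · simp [Prog.eff, Instr.eff, e6]; omega
    · intro j hj hj' ha
      simp [Prog.eff, Instr.eff, e6] at ha
      have hsame : Wins P V s2 j := by
        by_cases h : j = s.reg 6
        · exact h ▸ hw2
        · exact (hw j hj hj' fun h' => h'.eq_or_half.elim h ha).congr (hold j h) fun _ _ => Iff.rfl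
      exact hsame.congr (by simp [Prog.eff, Instr.eff]) fun _ _ => Iff.rfl
  · rintro s - ⟨⟨b, rfl, hlt, hw⟩, hF, hc⟩
    simp only [Test.Holds, (hB.frame hF rfl rfl rfl rfl).consts.r4, not_lt, Nat.le_zero] at hc
    refine fun j hj hj' => hw j hj hj' fun h => ?_
    have := h.le; omega

/-! ### Extraction of the points from left to right -/

theorem DLinked.insert_max {σ σ' : State} {k k' : ℕ} {S : Set (APt n)} (h : DLinked P σ k k' S)
    {l w : APt n} (hl : l ∈ S) (hmax : ∀ z ∈ S, z = l ∨ ALtX P z l) (hlw : ALtX P l w)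
    (hk : ∀ x, σ'.mem k x = if x = l.code then w.code else σ.mem k x)
    (hk' : ∀ x, σ'.mem k' x = if x = w.code then l.code else σ.mem k' x) :
    DLinked P σ' k k' (insert w S) := by
  intro a b hab
  by_cases hb : b = w
  · subst hb
    obtain rfl : a = l := by
      rcases hab.left with rfl | ha
      · exact absurd hab.lt (ALtX.irrefl _)
      · exact (hmax a ha).resolve_right fun h' => hab.not_between l (.inr hl) h' hlw
    simp [hk, hk']
  · have hbS : b ∈ S := hab.right.resolve_left hb
    have hbl := hmax b hbS
    have ha : a ≠ l := fun h' => ALtX.not_lt_of_le hbl (h' ▸ hab.lt)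
    have haS : a ∈ S := hab.left.resolve_left fun h' =>
      ALtX.not_lt_of_le hbl (hlw.trans (h' ▸ hab.lt))
    rw [hk, hk', if_neg fun h' => ha (APt.code_injective h'),
      if_neg fun h' => hb (APt.code_injective h')]
    exact h a b ⟨haS, hbS, hab.lt, fun c hc => hab.not_between c (.inr hc)⟩

/-- Append the point in register 18 to both linked lists, behind the one in register 9. -/
def linkLast : Prog := blk [.store 13 9 18, .store 14 18 9, .store 15 9 18, .store 16 18 9]

theorem runs_linkLast {W : ℕ} {σ : State} {S : Set (APt n)} (h : DLinked P σ 13 14 S)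
    (h' : DLinked P σ 15 16 S) {l w : APt n} (hl : l ∈ S) (hmax : ∀ z ∈ S, z = l ∨ ALtX P z l)
    (hlw : ALtX P l w) (h9 : σ.reg 9 = l.code) (h18 : σ.reg 18 = w.code) :
    Runs W linkLast σ 4 fun σ' => DLinked P σ' 13 14 (insert w S) ∧ DLinked P σ' 15 16 (insert w S) := by
  refine Runs.free ?_ (by decide)
    ⟨h.insert_max hl hmax hlw ?_ ?_, h'.insert_max hl hmax hlw ?_ ?_⟩ <;>
    simp [linkLast, blk, Prog.Safe, Instr.Safe, Prog.eff, Instr.eff, h9, h18]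

/-- The left dummy and the points not in `V`. -/
def outside (V : Set (Fin n)) : Set (APt n) := {z | ∀ i, z = .pt i → i ∉ V} \ {.posInf}

/-- The points not in `V` are linked from left to right, up to the last one, `l`; those in `V` are to
the right of them and still in the tournament. -/
structure Extracted (P : Fin n → ℝ × ℝ) (V : Set (Fin n)) (l : APt n) (σ : State) : Prop where
  wins : ∀ j, 0 < j → j < 2 * n → Wins P V σ j
  reg8 : σ.reg 8 = V.ncard
  reg9 : σ.reg 9 = l.code
  mem : l ∈ outside V
  max : ∀ z ∈ outside V, z = l ∨ ALtX P z l
  lt : ∀ z ∈ outside V, ∀ i ∈ V, ALtX P z (.pt i)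
  poly : DLinked P σ 13 14 (outside V)
  seps : DLinked P σ 15 16 (outside V)

/-- Remove the leftmost point from the tournament and append it to the lists. -/
def extractMin : Prog :=
  .seq (.instr (.load 18 11 2)) (.seq linkLast
    (.seq (blk [.move 9 18, .add 7 0 18, .store 11 7 0, .half 6 7, .sub 8 8 2]) replay))

theorem outside_sdiff {V : Set (Fin n)} {w : Fin n} (hw : w ∈ V) :
    outside (V \ {w}) = insert (.pt w) (outside V) := by
  ext z
  rcases z with _ | i | _
  · simp [outside]
  · by_cases h : i = w
    · subst h; simp [outside]
    · simp [outside, h]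
  · simp [outside]

/-- The winner at the root is the leftmost remaining point. Its leaf is emptied by writing `n`, the
code for no point, and the matches above it are replayed. -/
theorem runs_extractMin {W : ℕ} {σ : State} {V : Set (Fin n)} {l : APt n}
    (hP : Function.Injective P) (hB : Base P π σ) (hW : 2 * n + 1 < W) (h : Extracted P V l σ)
    (hV : 0 < σ.reg 8) :
    Runs W extractMin σ (17 * Nat.log 2 n + 28) fun σ' =>
      ∃ V' l', Extracted P V' l' σ' ∧ V'.ncard + 1 = V.ncard := by
  have hne : V.Nonempty := by
    rw [h.reg8] at hV
    exact (Set.ncard_pos V.toFinite).1 hV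
  have hn : 0 < n := hne.some.pos
  have hset : {i : Fin n | Anc (n + i) 1 ∧ i ∈ V} = V :=
    Set.ext fun i => and_iff_right (Anc.one (by omega))
  have h1 := h.wins 1 (by omega) (by omega)
  rw [Wins, hset] at h1
  obtain ⟨w, hw, hwV, hmin⟩ : ∃ w : Fin n, σ.mem 11 1 = w ∧ w ∈ V ∧ ∀ j ∈ V, j = w ∨ LtX P w j :=
    h1.resolve_left fun h' => hne.ne_empty h'.2
  refine Runs.seq (a := 1) (b := 17 * Nat.log 2 n + 27) (R := fun s => s.reg 18 = w)
    (Runs.free ?_ (by decide) ?_) ?_ (by omega)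
  · simp [Prog.Safe, Instr.Safe]
  · simp [Prog.eff, Instr.eff, hB.consts.r2, hw]
  intro s1 f1 a18
  refine Runs.seq (a := 4) (b := 17 * Nat.log 2 n + 23) (runs_linkLast
    (h.poly.congr (f1.mem 13 rfl) (f1.mem 14 rfl)) (h.seps.congr (f1.mem 15 rfl) (f1.mem 16 rfl))
    h.mem h.max (h.lt l h.mem w hwV) ((f1.reg 9 rfl).trans h.reg9) a18) ?_ (by omega)
  rintro s2 f2 ⟨d1, d2⟩
  have e0 : s2.reg 0 = n := (f2.reg 0 rfl).trans ((f1.reg 0 rfl).trans hB.consts.r0)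
  have e2 : s2.reg 2 = 1 := (f2.reg 2 rfl).trans ((f1.reg 2 rfl).trans hB.consts.r2)
  have e8 : s2.reg 8 = V.ncard := (f2.reg 8 rfl).trans ((f1.reg 8 rfl).trans h.reg8)
  have e18 : s2.reg 18 = w := (f2.reg 18 rfl).trans a18
  have e11 : s2.mem 11 = σ.mem 11 := (f2.mem 11 rfl).trans (f1.mem 11 rfl)
  refine Runs.seq (a := 5) (b := 17 * Nat.log 2 n + 18) (R := fun s => s.reg 9 = w ∧
    s.reg 6 = (n + w) / 2 ∧ s.reg 8 = V.ncard - 1 ∧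
    ∀ j, s.mem 11 j = if j = n + w then n else σ.mem 11 j) (Runs.free ?_ (by decide) ?_) ?_ (by omega)
  · simp [blk, Prog.Safe, Instr.Safe, Prog.eff, Instr.eff, e0, e18]; omega
  · simp [blk, Prog.eff, Instr.eff, e0, e2, e8, e18, e11]
  rintro s3 f3 ⟨g9, g6, g8, g11⟩
  have hB3 : Base P π s3 := ((hB.frame f1 rfl rfl rfl rfl).frame f2 rfl rfl rfl rfl).frame f3
    rfl rfl rfl rfl
  have hsz := size_le_log (show (n + w) / 2 ≤ n by omega)
  -- Nodes outside the path from the leaf of `w` to the root do not have `w` below them, and so keep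
  -- correct winners. The emptied leaf itself is correct because no remaining point is below it.
  refine (runs_replay (V := V \ {w}) hP hB3 hW g6 (by omega) fun j hj hj' ha => ?_).mono (by omega) ?_
  · by_cases hjw : j = n + w
    · refine .inl ⟨by rw [g11, if_pos hjw], Set.eq_empty_of_forall_notMem fun i hi => hi.2.2 ?_⟩
      rw [hjw] at hi
      exact anc_leaf.1 hi.1
    · refine (h.wins j hj hj').congr (by rw [g11, if_neg hjw]) fun i hi => ?_
      refine and_iff_left ?_
      rintro rfl
      exact hi.eq_or_half.elim hjw ha
  · intro s4 f4 hwins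
    have hcard : (V \ {w}).ncard + 1 = V.ncard := Set.ncard_sdiff_singleton_add_one hwV
    refine ⟨V \ {w}, .pt w, ⟨hwins, ?_, ?_, ?_, ?_, ?_, ?_, ?_⟩, hcard⟩
    · rw [f4.reg 8 rfl, g8]; omega
    · rw [f4.reg 9 rfl, g9]; rfl
    · rw [outside_sdiff hwV]; exact .inl rfl
    · rw [outside_sdiff hwV]
      rintro z (rfl | hz)
      · exact .inl rfl
      · exact .inr (h.lt z hz w hwV)
    · rw [outside_sdiff hwV]
      rintro z (rfl | hz) i ⟨hi, hiw⟩
      · exact (hmin i hi).resolve_left hiw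
      · exact h.lt z hz i hi
    · rw [outside_sdiff hwV]
      exact (d1.congr (f3.mem 13 rfl) (f3.mem 14 rfl)).congr (f4.mem 13 rfl) (f4.mem 14 rfl)
    · rw [outside_sdiff hwV]
      exact (d2.congr (f3.mem 15 rfl) (f3.mem 16 rfl)).congr (f4.mem 15 rfl) (f4.mem 16 rfl)

/-- Link all points from left to right. -/
def extractAll : Prog :=
  .seq (blk [.move 8 0, .move 9 0])
    (.seq (.loop (.lt 4 8) extractMin) (.seq (.instr (.move 18 1)) linkLast))

theorem runs_extractAll {W : ℕ} {σ : State} (hP : Function.Injective P) (hB : Base P π σ)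
    (hW : 2 * n + 1 < W) (hw : ∀ j, 0 < j → j < 2 * n → Wins P Set.univ σ j) :
    Runs W extractAll σ (n * (17 * Nat.log 2 n + 29) + 8) fun σ' =>
      DLinked P σ' 13 14 Set.univ ∧ DLinked P σ' 15 16 Set.univ := by
  have hout : outside (Set.univ : Set (Fin n)) = {.negInf} := by
    ext z
    rcases z with _ | i | _ <;> simp [outside]
  have hnone : ∀ a b, ¬ Consec P (outside (Set.univ : Set (Fin n))) a b := by
    rw [hout]
    rintro a b ⟨rfl, rfl, h, -⟩
    exact ALtX.irrefl _ h
  refine Runs.seq (a := 2) (b := n * (17 * Nat.log 2 n + 29) + 6)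
    (R := Extracted P Set.univ .negInf) (Runs.free ?_ (by decide) ⟨?_, ?_, ?_, ?_, ?_, ?_, ?_, ?_⟩)
    ?_ (by omega)
  · simp [blk, Prog.Safe, Instr.Safe]
  · exact fun j hj hj' => (hw j hj hj').congr (by simp [blk, Prog.eff, Instr.eff]) fun _ _ => Iff.rfl
  · simp [blk, Prog.eff, Instr.eff, hB.consts.r0, Set.ncard_univ]
  · simp [blk, Prog.eff, Instr.eff, hB.consts.r0, APt.code]
  · rw [hout]; rfl
  · rw [hout]; exact fun z hz => .inl hz
  · rw [hout]; rintro z rfl i -; trivial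
  · exact fun a b hab => absurd hab (hnone a b)
  · exact fun a b hab => absurd hab (hnone a b)
  intro s1 f1 h1
  have hB1 := hB.frame f1 rfl rfl rfl rfl
  refine Runs.seq (Runs.loop s1 (fun b s => ∃ V l, Extracted P V l s ∧
    b = V.ncard * (17 * Nat.log 2 n + 29)) ?_ (b := n * (17 * Nat.log 2 n + 29))
    ⟨_, _, h1, by simp [Set.ncard_univ]⟩) (b := 5) ?_ (by omega)
  · rintro b s ⟨V, l, hs, rfl⟩ hF hc
    have hBs := hB1.frame hF rfl rfl rfl rfl
    simp only [Test.Holds, hBs.consts.r4] at hc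
    refine ⟨_, (runs_extractMin hP hBs hW hs hc).mono le_rfl ?_⟩
    rintro s' - ⟨V', l', hs', hcard⟩
    exact ⟨_, by rw [← hcard, add_mul]; omega, V', l', hs', rfl⟩
  rintro s2 - ⟨⟨b, V, l, hs, -⟩, hF, hc⟩
  have hB2 := hB1.frame hF rfl rfl rfl rfl
  simp only [Test.Holds, hB2.consts.r4, hs.reg8, not_lt, Nat.le_zero] at hc
  obtain rfl : V = ∅ := (Set.ncard_eq_zero V.toFinite).1 hc
  refine Runs.seq (a := 1) (b := 4) (R := fun s => s.reg 18 = n + 1) (Runs.free ?_ (by decide) ?_) ?_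
    (by omega)
  · simp [Prog.Safe, Instr.Safe]
  · simp [Prog.eff, Instr.eff, hB2.consts.r1]
  intro s3 f3 a18
  have huniv : insert APt.posInf (outside (∅ : Set (Fin n))) = Set.univ := by
    ext z
    rcases z with _ | i | _ <;> simp [outside]
  rw [← huniv]
  refine runs_linkLast (hs.poly.congr (f3.mem 13 rfl) (f3.mem 14 rfl))
    (hs.seps.congr (f3.mem 15 rfl) (f3.mem 16 rfl)) hs.mem hs.max ?_
    ((f3.reg 9 rfl).trans hs.reg9) a18
  have hl := hs.mem
  cases l with
  | posInf => exact absurd rfl hl.2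
  | negInf => trivial
  | pt i => trivial

end PseudoTri

/-! ### The whole program -/

namespace PseudoTri

open RealRAM

variable {n : ℕ} {P : Fin n → ℝ × ℝ} {π : Equiv.Perm (Fin n)}

/-- Initialize the registers and sort the points. -/
def prepareProg : Prog :=
  .seq (blk [.const 2 1, .add 1 0 2, .add 3 1 2, .const 4 0, .const 5 1, .move 10 0, .const 8 0])
    (.seq leavesProg (.seq playAll extractAll))

theorem ncard_univ_le : (Set.univ : Set (APt n)).ncard ≤ n + 2 := by
  rw [Set.ncard_univ, ← Nat.card_fin (n + 2)]
  exact Nat.card_le_card_of_injective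
    (fun z => (⟨z.code, Nat.lt_succ_of_le z.code_le⟩ : Fin (n + 2)))
    fun x y h => APt.code_injective (congrArg Fin.val h)

/-- At first every point is a separator. Each gap consists of its two ends, both on its hull, so the
union of the hulls is everything and all trees are empty. The space bound is then `1 + 2 (n + 2) + 3
n`. -/
theorem Sweep.start {σ : State} (hB : Base P π σ) (h5 : σ.reg 5 = 1)
    (h10 : σ.reg 10 = n) (h12 : ∀ i : Fin n, σ.mem 12 ((π i : ℕ) + 1) = i)
    (h17 : ∀ x, σ.mem 17 x = 0) (hpoly : DLinked P σ 13 14 Set.univ)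
    (hseps : DLinked P σ 15 16 Set.univ) :
    Sweep P π n Set.univ 1 (fun _ => .negInf) σ := by
  have hgap : ∀ a b, Consec P (PseudoTri.seps π n) a b → gap P a b = {a, b} := by
    intro a b hab
    rw [seps_all] at hab
    ext z
    constructor
    · rintro (h | h | h)
      exacts [.inl h, .inr h, absurd h.2 (hab.not_between z trivial h.1)]
    · rintro (h | h)
      exacts [.inl h, .inr (.inl h)]
  refine ⟨hB, le_rfl, h5, h10, one_pos, h12, by rwa [seps_all], hpoly, trivial, trivial, ?_, ?_, ?_⟩
  · intro a b hab z hz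
    refine iff_of_true trivial ?_
    have hz' := hz
    rw [hgap a b hab] at hz'
    rcases hz' with rfl | rfl
    exacts [mem_upperHull_left hab.lt, mem_upperHull_right hab.lt]
  · intro a b hab
    -- An empty tree is the null pointer, which segment 17 contains from the start.
    exact ⟨.nil, [], .nil (fun h => ALtX.irrefl _ (h ▸ hab.lt)) (hgap a b hab), ⟨h17 _, rfl⟩,
      List.nodup_nil, by simp⟩
  · have := ncard_univ_le (n := n)
    omega

theorem runs_prepareProg {W : ℕ} (hP : Function.Injective P) (hW : 2 * n + 3 < W) :
    Runs W prepareProg (input P π) (n * (17 * Nat.log 2 n + 52) + 18)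
      (Sweep P π n Set.univ 1 fun _ => .negInf) := by
  refine Runs.seq (a := 7) (b := n * (17 * Nat.log 2 n + 52) + 11) (R := fun s => Base P π s ∧
    s.reg 5 = 1 ∧ s.reg 10 = n ∧ s.reg 8 = 0 ∧ ∀ x, s.mem 17 x = 0) (Runs.free ?_ (by decide) ?_) ?_
    (by omega)
  · simp [blk, Prog.Safe, Instr.Safe, Prog.eff, Instr.eff, input]; omega
  · refine ⟨⟨fun i => ?_, ⟨?_, ?_, ?_, ?_, ?_⟩, ?_⟩, ?_⟩ <;>
      simp [blk, Prog.eff, Instr.eff, input]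
  rintro s1 f1 ⟨hB1, a5, a10, a8, a17⟩
  refine Runs.seq (runs_leavesProg hB1 (by omega) a8) (b := n * (17 * Nat.log 2 n + 46) + 10) ?_
    (by ring_nf; omega)
  rintro s2 f2 ⟨h11, h12⟩
  have hB2 := hB1.frame f2 rfl rfl rfl rfl
  refine Runs.seq (runs_playAll hP hB2 (by omega) h11) (b := n * (17 * Nat.log 2 n + 29) + 8) ?_
    (by ring_nf; omega)
  intro s3 f3 hw
  have hB3 := hB2.frame f3 rfl rfl rfl rfl
  refine (runs_extractAll hP hB3 (by omega) hw).mono le_rfl ?_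
  rintro s4 f4 ⟨d1, d2⟩
  refine Sweep.start (hB3.frame f4 rfl rfl rfl rfl) ?_ ?_ ?_ ?_ d1 d2
  · rw [f4.reg 5 rfl, f3.reg 5 rfl, f2.reg 5 rfl, a5]
  · rw [f4.reg 10 rfl, f3.reg 10 rfl, f2.reg 10 rfl, a10]
  · rw [f4.mem 12 rfl, f3.mem 12 rfl]; exact h12
  · rw [f4.mem 17 rfl, f3.mem 17 rfl, f2.mem 17 rfl]; exact a17

/-- Construct the augmented pseudo-triangulation tree. -/
def constructProg : Prog := .seq prepareProg (.seq sweepProg finishProg)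

theorem runs_constructProg {W : ℕ} (hP : Function.Injective P) (hW : 11 * n + 10 < W) :
    Runs W constructProg (input P π) (1000 * (n * Nat.log 2 n + 1)) fun σ =>
      ∃ S : AugTree n, IsAugTree P π S ∧ Stores P π σ S := by
  have hn : n ≤ n * Nat.log 2 n + 1 := by
    rcases Nat.lt_or_ge n 2 with h | h
    · omega
    · have := Nat.le_mul_of_pos_right n (Nat.log_pos one_lt_two h)
      omega
  have hl : Nat.log 2 n ≤ n * Nat.log 2 n := by
    rcases Nat.eq_zero_or_pos n with rfl | h
    · simp
    · exact Nat.le_mul_of_pos_left _ h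
  have hcard := ncard_univ_le (n := n)
  have ht : sweepTime n n (Set.univ : Set (APt n)).ncard ≤ sweepTime n n (n + 2) :=
    Nat.add_le_add_right (Nat.mul_le_mul_left _ hcard) _
  refine Runs.seq (runs_prepareProg hP (by omega)) (b := sweepTime n n (n + 2) + 1 +
    (n * (11 * Nat.log 2 n + 47) + 15)) (fun s1 _ h1 => ?_) ?_
  · refine Runs.seq (runs_sweepProg hP h1 hW) (fun s2 _ h2 => ?_) (Nat.add_le_add_right
      (Nat.add_le_add_right ht 1) _)
    obtain ⟨C, fr, own, h2⟩ := h2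
    exact runs_finishProg hP h2 (by omega)
  · simp only [sweepTime]
    generalize Nat.log 2 n = lg at *
    have : n * (17 * lg + 52) + 18 + ((2 * (11 * lg + 47) + 48) * (n + 2) +
        (2 * (11 * lg + 47) + 140) * n + 1 + (n * (11 * lg + 47) + 15)) =
        72 * (n * lg) + 475 * n + 44 * lg + 318 := by ring
    -- With `hn` and `hl` the sum is at most `(72 + 475 + 44) n lg + 475 + 318`, so 1000 suffices
    -- for both coefficients.
    omega

end PseudoTri

theorem mainTheorem7 :
    ∃ C : ℕ,
      (∀ (n : ℕ) (P : Fin n → ℝ × ℝ), Function.Injective P →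
        ∀ (π : Equiv.Perm (Fin n)) (S : PseudoTri.AugTree n),
          PseudoTri.IsAugTree P π S → S.words ≤ C * n) ∧
      ∃ prog : RealRAM.Prog,
        ∀ (n : ℕ) (P : Fin n → ℝ × ℝ), Function.Injective P →
          ∀ π : Equiv.Perm (Fin n),
            ∃ (S : PseudoTri.AugTree n) (T : ℕ) (σ : RealRAM.State),
              PseudoTri.IsAugTree P π S ∧
              RealRAM.Exec ((n + 2) ^ C) prog (PseudoTri.input P π) T σ ∧
              PseudoTri.Stores P π σ S ∧
              T ≤ C * (n * Nat.log 2 n + 1) := by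
  refine ⟨1000, fun n P hP π S hS => (hS.words_le hP).trans (Nat.mul_le_mul_right n (by norm_num)),
    PseudoTri.constructProg, fun n P hP π => ?_⟩
  -- The largest word needed is bounded by `11 n + 10`: at most `5 n + 5` for the first free
  -- address, `3 n` for the lists of one node, and another `3 n` plus a constant as slack for codes
  -- and sums of indices. The fifth power of `n + 2` already exceeds it.
  have hW : ∀ C, 5 ≤ C → 11 * n + 10 < (n + 2) ^ C := fun C hC => by
    have h1 : (n + 2) ^ 5 ≤ (n + 2) ^ C := Nat.pow_le_pow_right (by omega) hC
    have h2 : 2 ^ 4 * (n + 2) ≤ (n + 2) ^ 4 * (n + 2) :=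
      Nat.mul_le_mul_right _ (Nat.pow_le_pow_left (by omega) 4)
    rw [← pow_succ] at h2
    have h3 := h2.trans h1
    omega
  obtain ⟨T, hT, σ, e, S, hS, hst⟩ := PseudoTri.runs_constructProg (π := π) hP (hW 1000 (by norm_num))
  exact ⟨S, T, σ, hS, e, hst, hT⟩
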